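/- **Circuits.** A boolean circuit $C$ with $n$ inputs and $m\ge 1$ gates is a sequence of $m$ gates, each a binary $\wedge$, a binary $\vee$ or a unary $\neg$, whose operands are inputs $x_0,\dots,x_{n-1}$ or earlier gates; the last gate is the output. $C$ is satisfiable if $C(x)=1$ for some $x\in\{0,1\}^n$. Let $e(C)$ be the binary string consisting of the $(n+m)\times(n+m)$ adjacency matrix of the graph of $C$ (whose nodes are the inputs followed by the gates), followed by two bits for each gate that specify its type. A quantum circuit has finitely many qubits and a finite list of gates, each a one-qubit unitary or a controlled-not gate; its size is its number of gates. The input is supplied in the first qubits, all other qubits start in $|0\rangle$, and the output is obtained by measuring one designated qubit of the final state. A family of quantum circuits $Q_{n,m,k}$ ($n,m,k\in\mathbb N$) is uniform if there is an algorithm that, from $(n,m,k)$, computes the number of qubits, the output qubit, the list of gate types with the qubits on which the gates act, and the entries of the matrices of the one-qubit gates to any desired precision $2^{-p}$. **Theorem.** There exist a uniform family of quantum circuits $Q_{n,m,k}$ and constants $c>0$ and $d\in\mathbb N$ such that, for all $n\ge 0$, $m\ge 1$ and all real $0<\varepsilon\le 1/2$, the circuit $Q=Q_{n,m,k}$ with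 $k=\lceil\log_2(1/\varepsilon)\rceil$ has size at most $$c\,\sqrt{2^n\log(1/\varepsilon)}\;m^d$$ and solves the circuit satisfiability problem within accuracy $\varepsilon$: for every boolean circuit $C$ with $n$ inputs and $m$ gates, on input $e(C)$ the output of $Q$ is $1$ if $C$ is satisfiable, and $0$ otherwise, with probability at least $1-\varepsilon$. -/

import Mathlib

/-! ### Classical boolean circuits and circuit satisfiability -/

/-- A boolean gate whose operands are taken among `N` available nodes. -/
inductive BGate (N : ℕ) : Type
  | and (i j : Fin N) : BGate N
  | or (i j : Fin N) : BGate N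
  | not (i : Fin N) : BGate N

namespace BGate

/-- The value of a gate, given the values of the available nodes. -/
def eval {N : ℕ} (v : Fin N → Bool) : BGate N → Bool
  | and i j => v i && v j
  | or i j => v i || v j
  | not i => !(v i)

/-- Whether node number `u` is an operand of the gate. -/
def reads {N : ℕ} (u : ℕ) : BGate N → Bool
  | and i j => decide ((i : ℕ) = u) || decide ((j : ℕ) = u)
  | or i j => decide ((i : ℕ) = u) || decide ((j : ℕ) = u)
  | not i => decide ((i : ℕ) = u)

/-- A two-bit label that specifies the type of the gate. -/
def label {N : ℕ} : BGate N → Bool × Bool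
  | and _ _ => (false, false)
  | or _ _ => (false, true)
  | not _ => (true, false)

end BGate

/-- A boolean circuit with `n` inputs and `m` gates, listed from left to right. The nodes
`0, …, n - 1` are the inputs and node `n + j` is the `j`-th gate; the operands of a gate are
inputs or earlier gates. -/
inductive BCircuit (n : ℕ) : ℕ → Type
  | nil : BCircuit n 0
  | snoc {m : ℕ} (C : BCircuit n m) (g : BGate (n + m)) : BCircuit n (m + 1)

namespace BCircuit

variable {n : ℕ}

/-- The values of all nodes on the input `x`. -/
def nodes (x : Fin n → Bool) : {m : ℕ} → BCircuit n m → Fin (n + m) → Bool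
  | _, nil => x
  | _, snoc C g => Fin.snoc (α := fun _ => Bool) (nodes x C) (g.eval (nodes x C))

/-- The output of the circuit is the value of its last gate (`false`, by convention, for the
circuit without gates, which has no output). -/
def output (x : Fin n → Bool) : {m : ℕ} → BCircuit n m → Bool
  | _, nil => false
  | _, snoc C g => g.eval (nodes x C)

/-- A circuit is satisfiable if its output is 1 for some input. -/
def Satisfiable {m : ℕ} (C : BCircuit n m) : Prop :=
  ∃ x : Fin n → Bool, C.output x = true

/-- Whether there is an edge from node `u` to node `v` in the graph of the circuit. -/
def hasEdge (u v : ℕ) : {m : ℕ} → BCircuit n m → Bool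
  | _, nil => false
  | _, snoc (m := m) C g => if v = n + m then g.reads u else hasEdge u v C

/-- The label of the `j`-th gate. -/
def gateLabel (j : ℕ) : {m : ℕ} → BCircuit n m → Bool × Bool
  | _, nil => (false, false)
  | _, snoc (m := m) C g => if j = m then g.label else gateLabel j C

/-- The length of the encoding of a circuit with `n` inputs and `m` gates. -/
def encLen (n m : ℕ) : ℕ := (n + m) * (n + m) + 2 * m

/-- The binary string `e(C)` that encodes the circuit `C`: the adjacency matrix of its graph, row
by row, followed by the labels of its gates, two bits for each. -/
def encode {m : ℕ} (C : BCircuit n m) : Fin (encLen n m) → Bool :=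
  Fin.append
    (fun k : Fin ((n + m) * (n + m)) =>
      C.hasEdge ((k : ℕ) / (n + m)) ((k : ℕ) % (n + m)))
    (fun k : Fin (2 * m) =>
      if (k : ℕ) % 2 = 0 then (C.gateLabel ((k : ℕ) / 2)).1
      else (C.gateLabel ((k : ℕ) / 2)).2)

end BCircuit

/-! ### Quantum circuits -/

/-- A quantum gate on a system of `w` qubits: an arbitrary one-qubit unitary `U` applied to qubit
`q`, or a controlled-not gate with control `p` and target `q`. -/
inductive QGate (w : ℕ) : Type
  | one (U : Matrix.unitaryGroup Bool ℂ) (q : Fin w) : QGate w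
  | cnot (p q : Fin w) (h : p ≠ q) : QGate w

namespace QGate

variable {w : ℕ}

/-- The action of a gate on a vector of amplitudes, indexed by the computational basis. -/
noncomputable def apply (ψ : (Fin w → Bool) → ℂ) : QGate w → (Fin w → Bool) → ℂ
  | one U q => fun x => ∑ b : Bool, (U : Matrix Bool Bool ℂ) (x q) b * ψ (Function.update x q b)
  | cnot p q _ => fun x => ψ (Function.update x q (xor (x q) (x p)))

/-- The type of the gate and the qubits on which it acts. -/
def wiring : QGate w → ℕ ⊕ ℕ × ℕ
  | one _ q => Sum.inl q
  | cnot p q _ => Sum.inr (p, q)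

end QGate

/-- A quantum circuit for inputs of `l` bits. The input is supplied in the first `l` qubits, the
other qubits are initialized to 0, the gates are applied in the order of the list, and the output
is obtained by measuring the qubit `out` of the final state. -/
structure QCircuit (l : ℕ) where
  /-- the number of qubits -/
  width : ℕ
  le_width : l ≤ width
  gates : List (QGate width)
  out : Fin width

namespace QCircuit

variable {l : ℕ}

/-- The size of a quantum circuit is its number of gates. -/
def size (Q : QCircuit l) : ℕ := Q.gates.length

/-- The basis state that holds the input `z`, followed by zeros. -/
def initString (Q : QCircuit l) (z : Fin l → Bool) : Fin Q.width → Bool :=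
  fun q => if h : (q : ℕ) < l then z ⟨q, h⟩ else false

/-- The final state on the input `z`. -/
noncomputable def finalState (Q : QCircuit l) (z : Fin l → Bool) : (Fin Q.width → Bool) → ℂ :=
  Q.gates.foldl (fun ψ g => g.apply ψ) (Pi.single (Q.initString z) 1)

/-- The probability that the output is `b` on the input `z`. -/
noncomputable def outputProb (Q : QCircuit l) (z : Fin l → Bool) (b : Bool) : ℝ :=
  ∑ y : Fin Q.width → Bool, if y Q.out = b then ‖Q.finalState z y‖ ^ 2 else 0

/-- The discrete part of the description of a circuit: the number of qubits, the output qubit, and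
the list of the gates with the qubits on which they act. -/
def layout (Q : QCircuit l) : ℕ × ℕ × List (ℕ ⊕ ℕ × ℕ) :=
  (Q.width, (Q.out : ℕ), Q.gates.map QGate.wiring)

end QCircuit

open Classical in
/-- A quantum circuit solves circuit satisfiability within accuracy `ε`, for circuits with `n`
inputs and `m` gates: for every such circuit `C`, given `e(C)` as input, the output is 1 if `C` is
satisfiable and 0 otherwise, with probability at least `1 - ε`. -/
def SolvesCircuitSat {n m : ℕ} (Q : QCircuit (BCircuit.encLen n m)) (ε : ℝ) : Prop :=
  ∀ C : BCircuit n m, 1 - ε ≤ Q.outputProb C.encode (decide C.Satisfiable)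

/-- A family of quantum circuits, indexed by `n`, `m` and an accuracy parameter `k`, is uniform if
there is a (classical) algorithm that produces an explicit description of each of its members: the
layout of the circuit, and, for each of its one-qubit gates, the entries of the matrix to any
desired precision `2 ^ (-p)`. -/
def UniformFamily (Q : (n m k : ℕ) → QCircuit (BCircuit.encLen n m)) : Prop :=
  Computable (fun a : ℕ × ℕ × ℕ => (Q a.1 a.2.1 a.2.2).layout) ∧
  ∃ approx : (ℕ × ℕ × ℕ) × ℕ × (Bool × Bool) × ℕ → ℤ × ℤ,
    Computable approx ∧
    ∀ (n m k i : ℕ) (U : Matrix.unitaryGroup Bool ℂ) (q : Fin (Q n m k).width),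
      (Q n m k).gates[i]? = some (QGate.one U q) →
      ∀ (r s : Bool) (p : ℕ),
        ‖(U : Matrix Bool Bool ℂ) r s
            - (((approx ((n, m, k), i, (r, s), p)).1 : ℂ)
              + ((approx ((n, m, k), i, (r, s), p)).2 : ℂ) * Complex.I) / 2 ^ p‖
          ≤ 1 / 2 ^ p

/-! Let `s = min n (2 * m)`. A circuit with `m` gates reads at most `2 * m` inputs, so
satisfiability is a question about `s` bits: input `u` receives the bit whose index is the number of
read inputs below `u` (`Prog.satisfiable_iff`). Let `t` be the number of solutions among the `2 ^ s`
strings. For each `j = 1, …, K`, where `K = min k (2 ^ s)`, an amplitude amplification tuned to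
exactly `j` solutions is run on a register of its own, and the output is the disjunction of
everything that these runs detect. Without solutions nothing is ever detected. If `1 ≤ t ≤ K`, the
run for `j = t` succeeds with certainty. If `t > K`, then `K = k`, and each of the `k` runs fails
with probability at most `1 / 4`, so that all fail with probability at most `2 ^ (-k) ≤ ε`.

The run for `j` takes about `√(2 ^ s / j)` iterations, and the sum of `1 / √j` over `j ≤ K` is at
most `2 * √K`; this turns `k` runs into a cost of order `√(2 ^ s * k)` up to polynomial factors
(`satRaw_length`). Those factors are polynomial in `n + m`; the dependence on `n` disappears because
for `n > 2 * m` the ratio `2 ^ n / 2 ^ s` absorbs it (`pow_four_mul_le`).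

A single run must be exact for `t = j` and still work for every `t ≥ j`, where a fixed number of
iterations could overshoot. An auxiliary qubit with a tuned rotation makes the initial angle `θ`
satisfy `sin θ = √(t / j) * sin (π / 2 ^ (r + 2))`. Detection takes place at the start and after
successive batches of `1, 2, 4, …, 2 ^ r` iterations. An unsuccessful detection projects back to a
multiple of the unmarked part of the initial state, so the surviving amplitude is the product of
`cos (2 ^ i * θ)` over `i ≤ r + 1`. For `t = j` the last factor is `cos (π / 2) = 0`
(`survivor_of_exact`). For `t ≥ j`, the product times `2 ^ (r + 2) * sin θ` is `sin (2 ^ (r + 2) *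
θ)`, and the multiplier is at least `2`, so the product is at most `1 / 2` in absolute value
(`survivor_le_quarter`).

The gates realize this without measurement: each detection is copied to a fresh flag qubit, and only
the branch with all flags zero is followed. There the state is a product over the registers
(`Tracks`, `search_state`), so the probability of output 0 is the product of the surviving weights
(`outputProb_satCircuit_false`). The oracle is a straight-line program of negated conjunctions that
evaluates the encoded circuit; it is run reversibly in a clean workspace and then undone
(`Prog.oracleProg_spec`, `computes_oracle`).

For uniformity, gates are coded by natural numbers, and the list of codes is primitive recursive.
The only irrational data are square roots built from `sin (π / 2 ^ (r + 2)) ^ 2`, which is a nested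
radical, and these are approximated with integer square roots (`entryApprox_spec`). -/

namespace SatSearch

open Matrix

/-! ### Raw gates: descriptions of gates by natural numbers -/

/-- An eighth root of unity, or its conjugate. -/
noncomputable def phaseUnit (e : ℕ) : ℂ :=
  if e = 0 then (1 + Complex.I) / (√2 : ℝ) else (1 - Complex.I) / (√2 : ℝ)

/-- The matrix `diag (1, ω)`. -/
def phaseMat (ω : ℂ) : Matrix Bool Bool ℂ :=
  Matrix.of fun r s => if r = s then (if r then ω else 1) else 0

/-- The entries of the real symmetric reflection whose off-diagonal entry is `√x`. -/
noncomputable def reflEntry (x : ℝ) (r s : Bool) : ℝ :=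
  if r = s then (if r then -√(1 - x) else √(1 - x)) else √x

/-- The real symmetric reflection whose off-diagonal entry is `√x`. -/
noncomputable def reflMat (x : ℝ) : Matrix Bool Bool ℂ :=
  Matrix.of fun r s => (reflEntry x r s : ℂ)

lemma phaseUnit_star (e : ℕ) : star (phaseUnit e) * phaseUnit e = 1 := by
  have h2 : ((√2 : ℝ) : ℂ) * (√2 : ℝ) = 2 := by
    rw [← Complex.ofReal_mul, Real.mul_self_sqrt (by norm_num)]; norm_num
  have h0 : ((√2 : ℝ) : ℂ) ≠ 0 := by
    intro h; rw [h] at h2; norm_num at h2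
  unfold phaseUnit
  split_ifs
  all_goals
    simp only [star_div₀, star_add, star_sub, star_one, Complex.star_def, Complex.conj_I,
      Complex.conj_ofReal]
    field_simp
    rw [pow_two, h2]
    ring_nf
    rw [Complex.I_sq]; norm_num

lemma phaseMat_mem {ω : ℂ} (h : star ω * ω = 1) : phaseMat ω ∈ unitaryGroup Bool ℂ := by
  rw [mem_unitaryGroup_iff']
  ext r s
  have h' : (starRingEnd ℂ) ω * ω = 1 := h
  cases r <;> cases s <;> simp [phaseMat, Matrix.mul_apply, star_apply, h']

lemma reflMat_mem {x : ℝ} (h0 : 0 ≤ x) (h1 : x ≤ 1) : reflMat x ∈ unitaryGroup Bool ℂ := by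
  rw [mem_unitaryGroup_iff']
  have h2 : ((√(1 - x) : ℝ) : ℂ) * (√(1 - x) : ℝ) = 1 - x := by
    rw [← Complex.ofReal_mul, Real.mul_self_sqrt (by linarith)]; push_cast; ring
  have h3 : ((√x : ℝ) : ℂ) * (√x : ℝ) = x := by
    rw [← Complex.ofReal_mul, Real.mul_self_sqrt h0]
  ext r s
  cases r <;> cases s <;> simp [reflMat, reflEntry, Matrix.mul_apply, star_apply, h2, h3, mul_comm]

/-- The square of the off-diagonal entry of a reflection gate. -/
noncomputable def rotParam (r s j : ℕ) : ℝ :=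
  min 1 (2 ^ s / j * Real.sin (Real.pi / 2 ^ (r + 2)) ^ 2)

/-- Together with the cap at 1 in `rotParam`, this makes every code denote a unitary. In the
searches the cap has no effect (`rotParam_eq`). Special values of the same parameter give the
Hadamard, negation and sign gates, so a single family of reflections covers all real gates. -/
lemma rotParam_nonneg (r s j : ℕ) : 0 ≤ rotParam r s j := by
  unfold rotParam; positivity

lemma rotParam_le_one (r s j : ℕ) : rotParam r s j ≤ 1 := min_le_left _ _

/-- The one-qubit unitary with a given code. -/
noncomputable def unitaryOf : ℕ × ℕ × ℕ → unitaryGroup Bool ℂ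
  | (0, e, _) => ⟨phaseMat (phaseUnit e), phaseMat_mem (phaseUnit_star e)⟩
  | (r + 1, s, j) =>
      ⟨reflMat (rotParam r s j), reflMat_mem (rotParam_nonneg r s j) (rotParam_le_one r s j)⟩

/-- A raw gate: a qubit and the code of a one-qubit unitary, or the control and the target of a
controlled-not. -/
abbrev RawGate := (ℕ × ℕ × ℕ × ℕ) ⊕ (ℕ × ℕ)

/-- Assignments of bits to all natural numbers; almost all of them are 0 in practice. -/
abbrev Config := ℕ → Bool

namespace RawGate

/-- Action of a raw gate on amplitudes. -/
noncomputable def act (ψ : Config → ℂ) : RawGate → Config → ℂ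
  | Sum.inl (q, c) => fun x =>
      ∑ b : Bool, (unitaryOf c : Matrix Bool Bool ℂ) (x q) b * ψ (Function.update x q b)
  | Sum.inr (p, q) => fun x =>
      if p = q then ψ x else ψ (Function.update x q (xor (x q) (x p)))

/-- Strict upper bound for the qubits of a raw gate. -/
def bound : RawGate → ℕ
  | Sum.inl (q, _) => q + 1
  | Sum.inr (p, q) => max (p + 1) (q + 1)

/-- Whether the raw gate describes a genuine gate. -/
def proper : RawGate → Bool
  | Sum.inl _ => true
  | Sum.inr (p, q) => !decide (p = q)

/-- The wiring of a raw gate. -/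
def wiring : RawGate → ℕ ⊕ ℕ × ℕ
  | Sum.inl (q, _) => Sum.inl q
  | Sum.inr (p, q) => Sum.inr (p, q)

/-- The quantum gate described by a proper raw gate. -/
noncomputable def toGate {w : ℕ} : (g : RawGate) → g.bound ≤ w ∧ g.proper = true → QGate w
  | Sum.inl (q, c), h => QGate.one (unitaryOf c) ⟨q, h.1⟩
  | Sum.inr (p, q), h => QGate.cnot ⟨p, (le_max_left _ _).trans h.1⟩
      ⟨q, (le_max_right _ _).trans h.1⟩ (by simpa [proper] using h.2)

lemma toGate_wiring {w : ℕ} (g : RawGate) (h : g.bound ≤ w ∧ g.proper = true) :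
    (g.toGate h).wiring = g.wiring := by
  rcases g with ⟨q, c⟩ | ⟨p, q⟩ <;> rfl

end RawGate

/-- Extension of a finite assignment by zeros. -/
def extend {w : ℕ} (y : Fin w → Bool) : Config := fun q => if h : q < w then y ⟨q, h⟩ else false

lemma extend_apply {w : ℕ} (y : Fin w → Bool) (q : Fin w) : extend y q = y q := by
  simp [extend]

lemma extend_of_le {w : ℕ} (y : Fin w → Bool) {q : ℕ} (h : w ≤ q) : extend y q = false := by
  simp [extend, not_lt.mpr h]

lemma extend_update {w : ℕ} (y : Fin w → Bool) (q : Fin w) (b : Bool) :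
    extend (Function.update y q b) = Function.update (extend y) q b := by
  funext i
  by_cases hi : i = q
  · subst hi; simp [extend]
  · rw [Function.update_of_ne hi]
    unfold extend
    split_ifs with h
    · rw [Function.update_of_ne]
      intro h'; exact hi (by rw [← h'])
    · rfl

/-- A gate only changes qubits below its bound, so it preserves the configurations that vanish from
`w` on. The whole analysis can therefore take place on `Config`, where no number of qubits has to be
fixed. -/
lemma RawGate.apply_toGate {w : ℕ} (g : RawGate) (h : g.bound ≤ w ∧ g.proper = true)
    (ψ : Config → ℂ) :
    (g.toGate h).apply (fun y : Fin w → Bool => ψ (extend y)) = fun y => g.act ψ (extend y) := by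
  rcases g with ⟨q, c⟩ | ⟨p, q⟩
  · funext y
    have hq : extend y q = y ⟨q, h.1⟩ := extend_apply y ⟨q, h.1⟩
    simp only [RawGate.toGate, QGate.apply, RawGate.act, extend_update, hq]
  · funext y
    have hpq : p ≠ q := by simpa [RawGate.proper] using h.2
    have hq : extend y q = y ⟨q, (le_max_right _ _).trans h.1⟩ := extend_apply y ⟨q, _⟩
    have hp : extend y p = y ⟨p, (le_max_left _ _).trans h.1⟩ := extend_apply y ⟨p, _⟩
    simp only [RawGate.toGate, QGate.apply, RawGate.act, if_neg hpq, extend_update, hq, hp]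

/-! ### Quantum circuits built from lists of raw gates -/

/-- The action of a list of raw gates. -/
noncomputable def runRaw (L : List RawGate) (ψ : Config → ℂ) : Config → ℂ :=
  L.foldl (fun ψ g => g.act ψ) ψ

@[simp] lemma runRaw_nil (ψ : Config → ℂ) : runRaw [] ψ = ψ := rfl

@[simp] lemma runRaw_cons (g : RawGate) (L : List RawGate) (ψ : Config → ℂ) :
    runRaw (g :: L) ψ = runRaw L (g.act ψ) := rfl

@[simp] lemma runRaw_append (L L' : List RawGate) (ψ : Config → ℂ) :
    runRaw (L ++ L') ψ = runRaw L' (runRaw L ψ) := List.foldl_append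

/-- The least number of qubits that accommodates all gates of the list. -/
def listBound (L : List RawGate) : ℕ := L.foldl (fun b g => max b g.bound) 0

lemma le_foldl_max (L : List RawGate) (b : ℕ) :
    b ≤ L.foldl (fun b g => max b g.bound) b ∧
      ∀ g ∈ L, RawGate.bound g ≤ L.foldl (fun b g => max b g.bound) b := by
  induction L generalizing b with
  | nil => simp
  | cons a L ih =>
    simp only [List.foldl_cons, List.mem_cons, forall_eq_or_imp]
    exact ⟨(le_max_left _ _).trans (ih _).1, (le_max_right _ _).trans (ih _).1, (ih _).2⟩

lemma bound_le_listBound {L : List RawGate} {g : RawGate} (h : g ∈ L) : g.bound ≤ listBound L :=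
  (le_foldl_max L 0).2 g h

/-- The number of qubits of the circuit built from raw gates. -/
def rawWidth (l w out : ℕ) (L : List RawGate) : ℕ := max (max l w) (max (out + 1) (listBound L))

lemma filter_proper {l w out : ℕ} {L : List RawGate} :
    ∀ g ∈ L.filter RawGate.proper, g.bound ≤ rawWidth l w out L ∧ g.proper = true := fun g hg => by
  rw [List.mem_filter] at hg
  exact ⟨(bound_le_listBound hg.1).trans ((le_max_right _ _).trans (le_max_right _ _)), hg.2⟩

/-- The quantum circuit built from a list of raw gates, with at least `w` qubits. -/
noncomputable def ofRaw (l w out : ℕ) (L : List RawGate) : QCircuit l where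
  width := rawWidth l w out L
  le_width := (le_max_left _ _).trans (le_max_left _ _)
  gates := (L.filter RawGate.proper).pmap (fun g h => g.toGate h) filter_proper
  out := ⟨out, Nat.lt_of_succ_le ((le_max_left (out + 1) (listBound L)).trans (le_max_right _ _))⟩

lemma ofRaw_layout (l w out : ℕ) (L : List RawGate) :
    (ofRaw l w out L).layout =
      (rawWidth l w out L, out, (L.filter RawGate.proper).map RawGate.wiring) := by
  simp only [QCircuit.layout, ofRaw, List.map_pmap, RawGate.toGate_wiring, List.pmap_eq_map]

lemma ofRaw_size_le (l w out : ℕ) (L : List RawGate) : (ofRaw l w out L).size ≤ L.length := by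
  simp only [QCircuit.size, ofRaw, List.length_pmap]
  exact List.length_filter_le _ _

lemma pmap_toGate_getElem? {w : ℕ} {L : List RawGate}
    {H : ∀ g ∈ L, RawGate.bound g ≤ w ∧ g.proper = true} {i : ℕ} {U : unitaryGroup Bool ℂ}
    {q : Fin w} (h : (L.pmap (fun g h => g.toGate h) H)[i]? = some (QGate.one U q)) :
    ∃ c, L[i]? = some (Sum.inl ((q : ℕ), c)) ∧ U = unitaryOf c := by
  rw [List.getElem?_pmap, Option.pmap_eq_some_iff] at h
  obtain ⟨g, hg, hab, h'⟩ := h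
  rcases g with ⟨q', c⟩ | ⟨p, q'⟩
  · simp only [RawGate.toGate, QGate.one.injEq] at h'
    refine ⟨c, ?_, h'.1⟩
    rw [h'.2]
    exact hab
  · simp [RawGate.toGate] at h'

lemma ofRaw_getElem? {l w out : ℕ} {L : List RawGate} {i : ℕ} {U : unitaryGroup Bool ℂ}
    {q : Fin (ofRaw l w out L).width} (h : (ofRaw l w out L).gates[i]? = some (QGate.one U q)) :
    ∃ c, (L.filter RawGate.proper)[i]? = some (Sum.inl ((q : ℕ), c)) ∧ U = unitaryOf c :=
  pmap_toGate_getElem? (w := rawWidth l w out L) h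

lemma foldl_apply_pmap {w : ℕ} (L : List RawGate)
    (H : ∀ g ∈ L.filter RawGate.proper, RawGate.bound g ≤ w ∧ g.proper = true) (ψ : Config → ℂ) :
    ((L.filter RawGate.proper).pmap (fun g h => g.toGate h) H).foldl (fun ψ g => g.apply ψ)
      (fun y : Fin w → Bool => ψ (extend y)) = fun y => runRaw L ψ (extend y) := by
  induction L generalizing ψ with
  | nil => rfl
  | cons g L ih =>
    by_cases hg : g.proper = true
    · have e : (g :: L).filter RawGate.proper = g :: L.filter RawGate.proper := by simp [hg]
      have H' := H
      rw [e] at H'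
      have e2 : ((g :: L).filter RawGate.proper).pmap (fun g h => g.toGate h) H =
          (g :: L.filter RawGate.proper).pmap (fun g h => g.toGate h) H' := by congr 1
      rw [e2, List.pmap_cons, List.foldl_cons, RawGate.apply_toGate, ih]
      rfl
    · have e : (g :: L).filter RawGate.proper = L.filter RawGate.proper := by simp [hg]
      have H' := H
      rw [e] at H'
      have e2 : ((g :: L).filter RawGate.proper).pmap (fun g h => g.toGate h) H =
          (L.filter RawGate.proper).pmap (fun g h => g.toGate h) H' := by congr 1
      rw [e2, ih]
      -- A controlled-not whose control equals its target acts as the identity on `Config` by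
      -- definition, so removing it is harmless.
      have : g.act ψ = ψ := by
        rcases g with ⟨q', c⟩ | ⟨p, q'⟩
        · simp [RawGate.proper] at hg
        · funext x
          have : p = q' := by simpa [RawGate.proper] using hg
          simp [RawGate.act, this]
      simp [this]

open Classical in
/-- The state that consists of a single configuration. -/
noncomputable def basisState (x : Config) : Config → ℂ := fun y => if y = x then 1 else 0

lemma ofRaw_finalState {l : ℕ} (w out : ℕ) (L : List RawGate) (z : Fin l → Bool) :
    (ofRaw l w out L).finalState z = fun y => runRaw L (basisState (extend z)) (extend y) := by
  have key := foldl_apply_pmap (w := rawWidth l w out L) L filter_proper (basisState (extend z))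
  have hi : (Pi.single ((ofRaw l w out L).initString z) 1 :
      (Fin (ofRaw l w out L).width → Bool) → ℂ) =
      fun y => basisState (extend z) (extend y) := by
    funext y
    unfold basisState
    rw [Pi.single_apply]
    congr 1
    apply propext
    constructor
    · rintro rfl
      funext i
      by_cases hi : i < (ofRaw l w out L).width
      · rw [show extend ((ofRaw l w out L).initString z) i = (ofRaw l w out L).initString z ⟨i, hi⟩
          from extend_apply _ ⟨i, hi⟩]
        rfl
      · rw [extend_of_le _ (not_lt.mp hi),
          extend_of_le _ ((ofRaw l w out L).le_width.trans (not_lt.mp hi))]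
    · intro h
      funext q
      have := congrFun h q
      rw [extend_apply] at this
      rw [this]; rfl
  unfold QCircuit.finalState
  rw [hi]
  exact key

/-! ### Conservation of the norm -/

/-- Every configuration is counted twice on the right. Grouping configurations that differ only in
qubit `q` reduces statements about a one-qubit gate to its two-by-two matrix. -/
lemma sum_eq_half_sum_update {w : ℕ} (q : Fin w) (f : (Fin w → Bool) → ℝ) :
    ∑ y, f y = (∑ y, ∑ b : Bool, f (Function.update y q b)) / 2 := by
  have h : ∀ y : Fin w → Bool, ∑ b : Bool, f (Function.update y q b) =
      f y + f (Function.update y q (!(y q))) := by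
    intro y
    have := Function.update_eq_self q y
    rw [Fintype.sum_bool]
    cases hb : y q <;> rw [hb] at this <;> simp [this, add_comm]
  have inv : Function.Involutive fun y : Fin w → Bool => Function.update y q (!(y q)) := by
    intro y; simp
  have h2 : ∑ y, f (Function.update y q (!(y q))) = ∑ y, f y :=
    Equiv.sum_comp inv.toPerm f
  simp_rw [h, Finset.sum_add_distrib, h2]
  ring

lemma unitary_norm (U : unitaryGroup Bool ℂ) (v : Bool → ℂ) :
    ∑ b, ‖∑ c, (U : Matrix Bool Bool ℂ) b c * v c‖ ^ 2 = ∑ c, ‖v c‖ ^ 2 := by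
  have hU : star (U : Matrix Bool Bool ℂ) * (U : Matrix Bool Bool ℂ) = 1 :=
    mem_unitaryGroup_iff'.mp U.2
  have key : star ((U : Matrix Bool Bool ℂ) *ᵥ v) ⬝ᵥ ((U : Matrix Bool Bool ℂ) *ᵥ v) =
      star v ⬝ᵥ v := by
    rw [star_mulVec, ← dotProduct_mulVec, mulVec_mulVec, ← star_eq_conjTranspose, hU, one_mulVec]
  have h : ∀ u : Bool → ℂ, star u ⬝ᵥ u = ((∑ b, ‖u b‖ ^ 2 : ℝ) : ℂ) := by
    intro u
    simp only [dotProduct, Pi.star_apply, Complex.star_def, Complex.conj_mul', Complex.ofReal_sum,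
      Complex.ofReal_pow]
  rw [h, h] at key
  exact_mod_cast key

lemma norm_apply {w : ℕ} (g : QGate w) (ψ : (Fin w → Bool) → ℂ) :
    ∑ y, ‖g.apply ψ y‖ ^ 2 = ∑ y, ‖ψ y‖ ^ 2 := by
  cases g with
  | one U q =>
    rw [sum_eq_half_sum_update q, sum_eq_half_sum_update q (fun y => ‖ψ y‖ ^ 2)]
    congr 1
    refine Finset.sum_congr rfl fun y _ => ?_
    simp only [QGate.apply, Function.update_self, Function.update_idem]
    exact unitary_norm U fun b => ψ (Function.update y q b)
  | cnot p q h =>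
    have inv : Function.Involutive
        fun y : Fin w → Bool => Function.update y q (xor (y q) (y p)) := by
      intro y; simp [h]
    exact Equiv.sum_comp inv.toPerm (fun y => ‖ψ y‖ ^ 2)

lemma norm_finalState {l : ℕ} (Q : QCircuit l) (z : Fin l → Bool) :
    ∑ y, ‖Q.finalState z y‖ ^ 2 = 1 := by
  have h : ∀ (L : List (QGate Q.width)) (ψ : (Fin Q.width → Bool) → ℂ),
      ∑ y, ‖L.foldl (fun ψ g => g.apply ψ) ψ y‖ ^ 2 = ∑ y, ‖ψ y‖ ^ 2 := by
    intro L
    induction L with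
    | nil => intro ψ; rfl
    | cons g L ih => intro ψ; rw [List.foldl_cons, ih, norm_apply]
  rw [QCircuit.finalState, h, Finset.sum_eq_single (Q.initString z)]
  · simp
  · intro b _ hb; simp [hb]
  · simp

/-- By conservation of the norm, only the probability of output 0 needs to be computed for the
search circuit. -/
lemma outputProb_true {l : ℕ} (Q : QCircuit l) (z : Fin l → Bool) :
    Q.outputProb z true = 1 - Q.outputProb z false := by
  rw [eq_sub_iff_add_eq, ← norm_finalState Q z, QCircuit.outputProb, QCircuit.outputProb,
    ← Finset.sum_add_distrib]
  refine Finset.sum_congr rfl fun y _ => ?_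
  cases y Q.out <;> simp

/-! ### Elementary gates -/

/-- The raw gate that multiplies by an eighth root of unity or its conjugate. -/
def tGate (e q : ℕ) : RawGate := Sum.inl (q, 0, e, 0)

/-- The raw Hadamard gate. -/
def hGate (q : ℕ) : RawGate := Sum.inl (q, 1, 0, 1)

/-- The raw negation gate. -/
def xGate (q : ℕ) : RawGate := Sum.inl (q, 1, 1, 1)

/-- The raw sign gate. -/
def zGate (q : ℕ) : RawGate := Sum.inl (q, 1, 0, 0)

/-- The raw controlled-not gate. -/
def cnotGate (p q : ℕ) : RawGate := Sum.inr (p, q)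

lemma sin_sq_pi_div_four : Real.sin (Real.pi / 2 ^ (0 + 2)) ^ 2 = 1 / 2 := by
  rw [show Real.pi / 2 ^ (0 + 2) = Real.pi / 4 by norm_num, Real.sin_pi_div_four, div_pow,
    Real.sq_sqrt (by norm_num)]
  norm_num

lemma rotParam_hadamard : rotParam 0 0 1 = 1 / 2 := by
  rw [rotParam, sin_sq_pi_div_four]; norm_num

lemma rotParam_not : rotParam 0 1 1 = 1 := by
  rw [rotParam, sin_sq_pi_div_four]; norm_num

lemma rotParam_sign : rotParam 0 0 0 = 0 := by
  rw [rotParam]; norm_num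

lemma act_refl (r s j q : ℕ) (ψ : Config → ℂ) :
    RawGate.act ψ (Sum.inl (q, r + 1, s, j)) = fun x =>
      ∑ b : Bool, (reflEntry (rotParam r s j) (x q) b : ℂ) * ψ (Function.update x q b) := rfl

lemma act_tGate (e q : ℕ) (ψ : Config → ℂ) :
    (tGate e q).act ψ = fun x => (if x q then phaseUnit e else 1) * ψ x := by
  funext x
  have hx := Function.update_eq_self q x
  have : (tGate e q).act ψ x =
    ∑ b : Bool, phaseMat (phaseUnit e) (x q) b * ψ (Function.update x q b) := rfl
  rw [this, Fintype.sum_bool]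
  cases h : x q <;> rw [h] at hx <;> simp [phaseMat, hx]

lemma act_zGate (q : ℕ) (ψ : Config → ℂ) :
    (zGate q).act ψ = fun x => (if x q then -1 else 1) * ψ x := by
  funext x
  have hx := Function.update_eq_self q x
  rw [zGate, act_refl, rotParam_sign]
  simp only [Fintype.sum_bool]
  cases h : x q <;> rw [h] at hx <;> simp [reflEntry, hx]

lemma act_xGate (q : ℕ) (ψ : Config → ℂ) :
    (xGate q).act ψ = fun x => ψ (Function.update x q (!(x q))) := by
  funext x
  rw [xGate, act_refl, rotParam_not]
  simp only [Fintype.sum_bool]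
  cases h : x q <;> simp [reflEntry]

lemma act_cnotGate {p q : ℕ} (h : p ≠ q) (ψ : Config → ℂ) :
    (cnotGate p q).act ψ = fun x => ψ (Function.update x q (xor (x q) (x p))) := by
  funext x
  simp [cnotGate, RawGate.act, h]

/-- Gates for the doubly controlled sign. -/
def cczList (a b c : ℕ) : List RawGate :=
  [tGate 0 a, tGate 0 b, tGate 0 c, cnotGate a b, tGate 1 b, cnotGate b c, tGate 0 c,
    cnotGate a c, tGate 1 c, cnotGate b c, tGate 1 c, cnotGate a c, cnotGate a b]

lemma phaseUnit_relations : phaseUnit 0 * phaseUnit 1 = 1 ∧ phaseUnit 0 ^ 4 = -1 := by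
  have h2 : ((√2 : ℝ) : ℂ) ^ 2 = 2 := by
    rw [← Complex.ofReal_pow, Real.sq_sqrt (by norm_num)]; norm_num
  have h0 : ((√2 : ℝ) : ℂ) ≠ 0 := by
    intro h; rw [h] at h2; norm_num at h2
  have h4 : ((√2 : ℝ) : ℂ) ^ 4 = 4 := by
    rw [show ((√2 : ℝ) : ℂ) ^ 4 = (((√2 : ℝ) : ℂ) ^ 2) ^ 2 by ring, h2]; norm_num
  have hI : Complex.I ^ 2 = -1 := Complex.I_sq
  constructor
  · simp only [phaseUnit, if_true, one_ne_zero, if_false]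
    field_simp
    rw [h2]; linear_combination -hI
  · simp only [phaseUnit, if_true, div_pow, h4]
    rw [div_eq_iff (by norm_num)]
    linear_combination (Complex.I ^ 2 + 4 * Complex.I + 5) * hI

/-- For bits, `4abc = a + b + c - (a ⊕ b) - (a ⊕ c) - (b ⊕ c) + (a ⊕ b ⊕ c)`. The controlled-nots
produce the seven parities in turn, each receives the phase `ω` or its conjugate, and `ω ^ 4 = -1`.
-/
lemma runRaw_cczList {a b c : ℕ} (hab : a ≠ b) (hac : a ≠ c) (hbc : b ≠ c) (ψ : Config → ℂ) :
    runRaw (cczList a b c) ψ = fun x => (if x a && x b && x c then -1 else 1) * ψ x := by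
  obtain ⟨hu, hv⟩ := phaseUnit_relations
  funext x
  simp only [cczList, runRaw_cons, runRaw_nil, act_tGate, act_cnotGate hab, act_cnotGate hac,
    act_cnotGate hbc, Function.update_self, Function.update_of_ne hab, Function.update_of_ne hac,
    Function.update_of_ne hbc, Function.update_of_ne hbc.symm]
  have hx : ∀ A : Bool, Function.update (Function.update (Function.update x b A) c (x c)) b (x b)
      = x := by
    intro A
    rw [Function.update_comm hbc, Function.update_idem, Function.update_eq_self,
      Function.update_eq_self]
  generalize phaseUnit 0 = u at *
  generalize phaseUnit 1 = v at *
  cases ha : x a <;> cases hb : x b <;> cases hc : x c <;> rw [hb, hc] at hx <;>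
    simp [hx]
  -- With one or two bits set, the phases multiply to `(u * v) ^ 2 = 1`; with all three set, they
  -- give `u ^ 4 = -1`.
  iterate 6 linear_combination (u * v + 1) * ψ x * hu
  linear_combination ψ x * hv

lemma act_hGate (q : ℕ) (ψ : Config → ℂ) :
    (hGate q).act ψ = fun x => (√(1 / 2) : ℝ) *
      (ψ (Function.update x q false) + (if x q then -1 else 1) * ψ (Function.update x q true)) := by
  funext x
  rw [hGate, act_refl, rotParam_hadamard]
  simp only [Fintype.sum_bool]
  cases h : x q <;> simp [reflEntry] <;> norm_num <;> ring

/-- Gates for the doubly controlled negation. -/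
def toffoliList (a b c : ℕ) : List RawGate := hGate c :: (cczList a b c ++ [hGate c])

/-- Conjugation with Hadamard gates on the target turns the doubly controlled sign into a doubly
controlled negation. -/
lemma runRaw_toffoliList {a b c : ℕ} (hab : a ≠ b) (hac : a ≠ c) (hbc : b ≠ c) (ψ : Config → ℂ) :
    runRaw (toffoliList a b c) ψ = fun x => ψ (Function.update x c (xor (x c) (x a && x b))) := by
  have h2 : ((√(1 / 2) : ℝ) : ℂ) * (√(1 / 2) : ℝ) = 1 / 2 := by
    rw [← Complex.ofReal_mul, Real.mul_self_sqrt (by norm_num)]; norm_num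
  funext x
  simp only [toffoliList, runRaw_cons, runRaw_append, runRaw_nil, act_hGate,
    runRaw_cczList hab hac hbc, Function.update_self, Function.update_of_ne hac,
    Function.update_of_ne hbc, Function.update_idem]
  generalize ((√(1 / 2) : ℝ) : ℂ) = h at *
  cases ha : x a <;> cases hb : x b <;> cases hc : x c <;> simp <;>
    ring_nf <;> rw [pow_two, h2] <;> ring

/-- The negated conjunction of bits `a` and `b` is added to bit `c`. -/
def nandStep (a b c : ℕ) (x : Config) : Config :=
  Function.update x c (xor (x c) (!(x a && x b)))

/-- Gates for `nandStep`. -/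
def nandList (a b c : ℕ) : List RawGate :=
  xGate c :: (if a = b then [cnotGate a c] else toffoliList a b c)

/-- Equal operands must be allowed, since negation is programmed as a negated conjunction of a node
with itself. The doubly controlled gate needs distinct controls, so a controlled-not replaces it in
that case. -/
lemma runRaw_nandList {a b c : ℕ} (hac : a ≠ c) (hbc : b ≠ c) (ψ : Config → ℂ) :
    runRaw (nandList a b c) ψ = fun x => ψ (nandStep a b c x) := by
  funext x
  rw [nandList, runRaw_cons, act_xGate]
  split_ifs with h
  · subst h
    simp only [runRaw_cons, runRaw_nil, act_cnotGate hac, Function.update_self,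
      Function.update_idem, nandStep, Bool.and_self]
    congr 2
    cases x c <;> cases x a <;> rfl
  · simp only [runRaw_toffoliList h hac hbc, Function.update_self, Function.update_idem, nandStep]
    congr 2
    cases x c <;> cases x a <;> cases x b <;> rfl

lemma nandList_length (a b c : ℕ) : (nandList a b c).length ≤ 16 := by
  unfold nandList
  split_ifs <;> simp [toffoliList, cczList]

lemma nandStep_nandStep {a b c : ℕ} (hac : a ≠ c) (hbc : b ≠ c) (x : Config) :
    nandStep a b c (nandStep a b c x) = x := by
  unfold nandStep
  simp [hac, hbc]

/-! ### Straight-line programs -/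

/-- A straight-line program of negated conjunctions, with the newest instruction first. The
operands are the numbers of earlier nodes. -/
abbrev Prog := List (ℕ × ℕ)

namespace Prog

/-- The values of the nodes, where the nodes below `ι` are inputs, and the instructions define the
nodes from `ι` on. An instruction whose operands are not earlier nodes is ignored. -/
def val (ι : ℕ) (v : Config) : Prog → Config
  | [] => v
  | (a, b) :: P =>
      if a < ι + P.length ∧ b < ι + P.length then
        Function.update (val ι v P) (ι + P.length) (!(val ι v P a && val ι v P b))
      else val ι v P

/-- Execution of a program in place; node `i` is kept in bit `α i`. -/
def exec (ι : ℕ) (α : ℕ → ℕ) : Prog → Config → Config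
  | [], x => x
  | (a, b) :: P, x =>
      if a < ι + P.length ∧ b < ι + P.length then
        nandStep (α a) (α b) (α (ι + P.length)) (exec ι α P x)
      else exec ι α P x

/-- The inverse of `exec`. -/
def unexec (ι : ℕ) (α : ℕ → ℕ) : Prog → Config → Config
  | [], x => x
  | (a, b) :: P, x =>
      if a < ι + P.length ∧ b < ι + P.length then
        unexec ι α P (nandStep (α a) (α b) (α (ι + P.length)) x)
      else unexec ι α P x

/-- Gates for one instruction. -/
def instr (α : ℕ → ℕ) (c : ℕ) (ab : ℕ × ℕ) : List RawGate :=
  if ab.1 < c ∧ ab.2 < c then nandList (α ab.1) (α ab.2) (α c) else []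

/-- Gates that compute the nodes of a program. -/
def compute (ι : ℕ) (α : ℕ → ℕ) : Prog → List RawGate
  | [] => []
  | ab :: P => compute ι α P ++ instr α (ι + P.length) ab

/-- Gates that undo `compute`. -/
def uncompute (ι : ℕ) (α : ℕ → ℕ) : Prog → List RawGate
  | [] => []
  | ab :: P => instr α (ι + P.length) ab ++ uncompute ι α P

variable {ι : ℕ} {α : ℕ → ℕ}

lemma compute_length (P : Prog) : (compute ι α P).length ≤ 16 * P.length := by
  induction P with
  | nil => simp [compute]
  | cons ab P ih =>
    have : (instr α (ι + P.length) ab).length ≤ 16 := by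
      unfold instr; split_ifs
      · exact nandList_length _ _ _
      · simp
    simp only [compute, List.length_append, List.length_cons]
    omega

lemma uncompute_length (P : Prog) : (uncompute ι α P).length ≤ 16 * P.length := by
  induction P with
  | nil => simp [uncompute]
  | cons ab P ih =>
    have : (instr α (ι + P.length) ab).length ≤ 16 := by
      unfold instr; split_ifs
      · exact nandList_length _ _ _
      · simp
    simp only [uncompute, List.length_append, List.length_cons]
    omega

lemma runRaw_instr (hα : Function.Injective α) {c : ℕ} (a b : ℕ) (ψ : Config → ℂ) :
    runRaw (instr α c (a, b)) ψ = fun x =>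
      ψ (if a < c ∧ b < c then nandStep (α a) (α b) (α c) x else x) := by
  unfold instr
  split_ifs with h
  · exact runRaw_nandList (hα.ne h.1.ne) (hα.ne h.2.ne) ψ
  · rfl

/-- A permutation gate acts on amplitudes by composition, which reverses the order of the steps;
this is why the inverse execution appears here and the forward one in `runRaw_uncompute`. -/
lemma runRaw_compute (hα : Function.Injective α) (P : Prog) (ψ : Config → ℂ) :
    runRaw (compute ι α P) ψ = fun x => ψ (unexec ι α P x) := by
  induction P generalizing ψ with
  | nil => rfl
  | cons ab P ih =>
    obtain ⟨a, b⟩ := ab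
    rw [compute, runRaw_append, ih, runRaw_instr hα]
    funext x
    simp only [unexec]
    split_ifs <;> rfl

lemma runRaw_uncompute (hα : Function.Injective α) (P : Prog) (ψ : Config → ℂ) :
    runRaw (uncompute ι α P) ψ = fun x => ψ (exec ι α P x) := by
  induction P generalizing ψ with
  | nil => rfl
  | cons ab P ih =>
    obtain ⟨a, b⟩ := ab
    rw [uncompute, runRaw_append, runRaw_instr hα, ih]
    funext x
    simp only [exec]

lemma unexec_exec (hα : Function.Injective α) (P : Prog) (x : Config) :
    unexec ι α P (exec ι α P x) = x := by
  induction P with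
  | nil => rfl
  | cons ab P ih =>
    obtain ⟨a, b⟩ := ab
    simp only [exec, unexec]
    split_ifs with h
    · rw [nandStep_nandStep (hα.ne h.1.ne) (hα.ne h.2.ne), ih]
    · exact ih

lemma nandStep_update {a b c q : ℕ} (ha : a ≠ q) (hb : b ≠ q) (hc : c ≠ q) (x : Config) (t : Bool) :
    nandStep a b c (Function.update x q t) = Function.update (nandStep a b c x) q t := by
  unfold nandStep
  rw [Function.update_of_ne ha, Function.update_of_ne hb, Function.update_of_ne hc,
    Function.update_comm hc]

lemma unexec_update {q : ℕ} (hq : ∀ i, α i ≠ q) (P : Prog) (x : Config) (t : Bool) :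
    unexec ι α P (Function.update x q t) = Function.update (unexec ι α P x) q t := by
  induction P generalizing x with
  | nil => rfl
  | cons ab P ih =>
    obtain ⟨a, b⟩ := ab
    simp only [unexec]
    split_ifs with h
    · rw [nandStep_update (hq _) (hq _) (hq _), ih]
    · exact ih x

lemma exec_of_ne {q : ℕ} (hq : ∀ i, α i ≠ q) (P : Prog) (x : Config) :
    exec ι α P x q = x q := by
  induction P with
  | nil => rfl
  | cons ab P ih =>
    obtain ⟨a, b⟩ := ab
    simp only [exec]
    split_ifs with h
    · rw [nandStep, Function.update_of_ne (hq _).symm, ih]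
    · exact ih

lemma val_of_le {v : Config} (P : Prog) {i : ℕ} (hi : ι + P.length ≤ i) : val ι v P i = v i := by
  induction P with
  | nil => rfl
  | cons ab P ih =>
    obtain ⟨a, b⟩ := ab
    simp only [List.length_cons] at hi
    simp only [val]
    split_ifs with h
    · rw [Function.update_of_ne (by omega), ih (by omega)]
    · exact ih (by omega)

/-- In-place execution adds a value to the target bit, while `val` overwrites it. The two agree
because all targets start at zero and no target is written twice. -/
lemma exec_apply (hα : Function.Injective α) (P : Prog) (x : Config)
    (hx : ∀ i, ι ≤ i → x (α i) = false) (i : ℕ) :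
    exec ι α P x (α i) = val ι (fun i => x (α i)) P i := by
  induction P generalizing i with
  | nil => rfl
  | cons ab P ih =>
    obtain ⟨a, b⟩ := ab
    simp only [exec, val]
    split_ifs with h
    · rw [nandStep, ih, ih, ih]
      by_cases hi : i = ι + P.length
      · subst hi
        rw [Function.update_self, Function.update_self, val_of_le P le_rfl,
          hx _ (Nat.le_add_right _ _), Bool.false_xor]
      · rw [Function.update_of_ne (hα.ne hi), Function.update_of_ne hi, ih]
    · exact ih i

/-- Gates that multiply by a sign according to the value of node `r`. -/
def signList (ι : ℕ) (α : ℕ → ℕ) (P : Prog) (r : ℕ) : List RawGate :=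
  compute ι α P ++ zGate (α r) :: uncompute ι α P

/-- Gates that add the value of node `r` to bit `q`. -/
def copyList (ι : ℕ) (α : ℕ → ℕ) (P : Prog) (r q : ℕ) : List RawGate :=
  compute ι α P ++ cnotGate (α r) q :: uncompute ι α P

lemma signList_length (P : Prog) (r : ℕ) : (signList ι α P r).length ≤ 32 * P.length + 1 := by
  have h1 := compute_length (ι := ι) (α := α) P
  have h2 := uncompute_length (ι := ι) (α := α) P
  simp only [signList, List.length_append, List.length_cons]
  omega

lemma copyList_length (P : Prog) (r q : ℕ) : (copyList ι α P r q).length ≤ 32 * P.length + 1 := by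
  have h1 := compute_length (ι := ι) (α := α) P
  have h2 := uncompute_length (ι := ι) (α := α) P
  simp only [copyList, List.length_append, List.length_cons]
  omega

lemma runRaw_signList (hα : Function.Injective α) (P : Prog) (r : ℕ) (ψ : Config → ℂ) :
    runRaw (signList ι α P r) ψ = fun x =>
      (if exec ι α P x (α r) then -1 else 1) * ψ x := by
  funext x
  rw [signList, runRaw_append, runRaw_compute hα, runRaw_cons, act_zGate, runRaw_uncompute hα]
  simp only [unexec_exec hα]

/-- Bit `q` lies outside the range of `α`, so the program neither reads nor changes it, and
uncomputing restores everything else. -/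
lemma runRaw_copyList (hα : Function.Injective α) (P : Prog) (r : ℕ) {q : ℕ} (hq : ∀ i, α i ≠ q)
    (ψ : Config → ℂ) :
    runRaw (copyList ι α P r q) ψ = fun x =>
      ψ (Function.update x q (xor (x q) (exec ι α P x (α r)))) := by
  funext x
  rw [copyList, runRaw_append, runRaw_compute hα, runRaw_cons, act_cnotGate (hq r),
    runRaw_uncompute hα]
  simp only [unexec_update hq, unexec_exec hα, exec_of_ne hq]

end Prog


namespace Prog

/-! ### Building programs -/

variable {ι : ℕ} {v : Config}

/-- Node `i` is available in the program and has the value `b`. -/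
def Good (ι : ℕ) (v : Config) (P : Prog) (i : ℕ) (b : Bool) : Prop :=
  i < ι + P.length ∧ val ι v P i = b

lemma val_append (L P : Prog) {i : ℕ} (hi : i < ι + P.length) :
    val ι v (L ++ P) i = val ι v P i := by
  induction L with
  | nil => rfl
  | cons ab L ih =>
    obtain ⟨a, b⟩ := ab
    simp only [List.cons_append, val]
    split_ifs with h
    · rw [Function.update_of_ne, ih]
      rw [List.length_append]; omega
    · exact ih

lemma Good.mono {P P' : Prog} {i : ℕ} {b : Bool} (h : Good ι v P i b) (hP : P <:+ P') :
    Good ι v P' i b := by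
  obtain ⟨L, rfl⟩ := hP
  refine ⟨?_, ?_⟩
  · have := h.1; rw [List.length_append]; omega
  · rw [val_append L P h.1, h.2]

lemma Good.input {i : ℕ} (P : Prog) (hi : i < ι) : Good ι v P i (v i) :=
  Good.mono (P := []) ⟨by simpa using hi, rfl⟩ (List.nil_suffix)

/-- The program `p.1` extends `P` by at most `k` instructions, and node `p.2` has the value `b`. -/
structure Yields (ι : ℕ) (v : Config) (P : Prog) (p : Prog × ℕ) (k : ℕ) (b : Bool) : Prop where
  suffix : P <:+ p.1
  length_le : p.1.length ≤ P.length + k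
  good : Good ι v p.1 p.2 b

lemma Yields.of_good {P : Prog} {i : ℕ} {b : Bool} (h : Good ι v P i b) :
    Yields ι v P (P, i) 0 b := ⟨List.suffix_rfl, le_rfl, h⟩

/-- Append a negated conjunction. -/
def nandB (ι : ℕ) (P : Prog) (a b : ℕ) : Prog × ℕ := ((a, b) :: P, ι + P.length)

/-- Append a negation. -/
def notB (ι : ℕ) (P : Prog) (a : ℕ) : Prog × ℕ := nandB ι P a a

/-- Append a conjunction. -/
def andB (ι : ℕ) (P : Prog) (a b : ℕ) : Prog × ℕ :=
  notB ι (nandB ι P a b).1 (nandB ι P a b).2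

/-- Append a disjunction. -/
def orB (ι : ℕ) (P : Prog) (a b : ℕ) : Prog × ℕ :=
  let p := notB ι P a
  let q := notB ι p.1 b
  nandB ι q.1 p.2 q.2

/-- Append a choice between `a` and `b`, according to `c`. -/
def muxB (ι : ℕ) (P : Prog) (c a b : ℕ) : Prog × ℕ :=
  let p := nandB ι P c a
  let q := notB ι p.1 c
  let r := nandB ι q.1 q.2 b
  nandB ι r.1 p.2 r.2

section

variable {P : Prog} {a b c : ℕ} {x y t : Bool}

lemma nandB_spec (ha : Good ι v P a x) (hb : Good ι v P b y) :
    Yields ι v P (nandB ι P a b) 1 (!(x && y)) := by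
  refine ⟨List.suffix_cons _ _, le_rfl, ?_, ?_⟩
  · simp [nandB]
  · simp [nandB, val, ha.1, hb.1, ha.2, hb.2]

lemma notB_spec (ha : Good ι v P a x) : Yields ι v P (notB ι P a) 1 (!x) := by
  simpa [notB] using nandB_spec ha ha

lemma andB_spec (ha : Good ι v P a x) (hb : Good ι v P b y) :
    Yields ι v P (andB ι P a b) 2 (x && y) := by
  have h1 := nandB_spec ha hb
  have h2 := notB_spec h1.good
  refine ⟨h1.suffix.trans h2.suffix, ?_, ?_⟩
  · have := h1.length_le; have := h2.length_le
    simp only [andB]; omega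
  · simpa [andB] using h2.good

lemma orB_spec (ha : Good ι v P a x) (hb : Good ι v P b y) :
    Yields ι v P (orB ι P a b) 3 (x || y) := by
  have h1 := notB_spec ha
  have h2 := notB_spec (hb.mono h1.suffix)
  have h3 := nandB_spec (h1.good.mono h2.suffix) h2.good
  refine ⟨h1.suffix.trans (h2.suffix.trans h3.suffix), ?_, ?_⟩
  · have := h1.length_le; have := h2.length_le; have := h3.length_le
    simp only [orB]; omega
  · simpa [orB] using h3.good

lemma muxB_spec (hc : Good ι v P c t) (ha : Good ι v P a x) (hb : Good ι v P b y) :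
    Yields ι v P (muxB ι P c a b) 4 (if t then x else y) := by
  have h1 := nandB_spec hc ha
  have h2 := notB_spec (hc.mono h1.suffix)
  have h3 := nandB_spec h2.good (hb.mono (h1.suffix.trans h2.suffix))
  have h4 := nandB_spec (h1.good.mono (h2.suffix.trans h3.suffix)) h3.good
  refine ⟨h1.suffix.trans (h2.suffix.trans (h3.suffix.trans h4.suffix)), ?_, ?_⟩
  · have := h1.length_le; have := h2.length_le; have := h3.length_le; have := h4.length_le
    simp only [muxB]; omega
  · have := h4.good
    cases t <;> simpa [muxB] using this

end

/-- Append the disjunction of the results of `f` for `0, …, k - 1`; node `z` is false. -/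
def orFold (ι z : ℕ) (f : Prog → ℕ → Prog × ℕ) (P : Prog) (k : ℕ) : Prog × ℕ :=
  (List.range k).foldl (fun p i => orB ι (f p.1 i).1 p.2 (f p.1 i).2) (P, z)

/-- The hypothesis on `f` ranges over all extensions of `P`, because each call starts from the
program left by the previous ones. -/
lemma orFold_spec {z : ℕ} {f : Prog → ℕ → Prog × ℕ} {P : Prog} {k K : ℕ} {F : ℕ → Bool}
    (hz : Good ι v P z false)
    (hf : ∀ P', P <:+ P' → ∀ i < k, Yields ι v P' (f P' i) K (F i)) :
    Yields ι v P (orFold ι z f P k) (k * (K + 3)) ((List.range k).any F) := by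
  induction k with
  | zero => simpa [orFold] using Yields.of_good hz
  | succ k ih =>
    have h1 := ih fun P' h i hi => hf P' h i (by omega)
    have e : orFold ι z f P (k + 1) =
        orB ι (f (orFold ι z f P k).1 k).1 (orFold ι z f P k).2 (f (orFold ι z f P k).1 k).2 := by
      simp [orFold, List.range_succ, List.foldl_append]
    have h2 := hf _ h1.suffix k (by omega)
    have h3 := orB_spec (h1.good.mono h2.suffix) h2.good
    rw [e]
    refine ⟨h1.suffix.trans (h2.suffix.trans h3.suffix), ?_, ?_⟩
    · have := h1.length_le; have := h2.length_le; have := h3.length_le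
      rw [add_mul]; omega
    · simpa [List.range_succ, List.any_append] using h3.good

/-- Collect the results of `f` for `0, …, k - 1`. -/
def mapFold (f : Prog → ℕ → Prog × ℕ) (P : Prog) (k : ℕ) : Prog × List ℕ :=
  (List.range k).foldl (fun p i => ((f p.1 i).1, p.2 ++ [(f p.1 i).2])) (P, [])

lemma getD_append_singleton {L : List ℕ} {k a d i : ℕ} (h : L.length = k) :
    (L ++ [a]).getD i d = if i = k then a else L.getD i d := by
  subst h
  split_ifs with hi
  · subst hi; simp [List.getD]
  · rcases lt_or_gt_of_ne hi with hi | hi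
    · simp [List.getD, List.getElem?_append_left hi]
    · rw [List.getD_eq_default _ _ (by simp; omega), List.getD_eq_default _ _ hi.le]

lemma mapFold_spec {f : Prog → ℕ → Prog × ℕ} {P : Prog} {k K z : ℕ} {F : ℕ → Bool}
    (hf : ∀ P', P <:+ P' → ∀ i < k, Yields ι v P' (f P' i) K (F i)) :
    P <:+ (mapFold f P k).1 ∧ (mapFold f P k).1.length ≤ P.length + k * K ∧
      (mapFold f P k).2.length = k ∧
      ∀ i < k, Good ι v (mapFold f P k).1 ((mapFold f P k).2.getD i z) (F i) := by
  induction k with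
  | zero => simp [mapFold]
  | succ k ih =>
    obtain ⟨h1, h2, h3, h4⟩ := ih fun P' h i hi => hf P' h i (by omega)
    have e : mapFold f P (k + 1) = ((f (mapFold f P k).1 k).1,
        (mapFold f P k).2 ++ [(f (mapFold f P k).1 k).2]) := by
      simp [mapFold, List.range_succ, List.foldl_append]
    have h5 := hf _ h1 k (by omega)
    rw [e]
    refine ⟨h1.trans h5.suffix, ?_, by simp [h3], fun i hi => ?_⟩
    · have := h5.length_le
      rw [add_mul]; simp only; omega
    · simp only
      rw [getD_append_singleton h3]
      split_ifs with hik
      · subst hik; exact h5.good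
      · exact (h4 i (by omega)).mono h5.suffix

/-! ### Evaluation of an encoded circuit on a compressed assignment -/

/-- The value of a gate with `N` available nodes whose values are `w`, given the incidence vector
of its operands and its label. -/
def gateVal (e : ℕ → Bool) (lab : Bool × Bool) (w : ℕ → Bool) (N : ℕ) : Bool :=
  if lab.1 then !((List.range N).any fun u => e u && w u)
  else if lab.2 then (List.range N).any fun u => e u && w u
  else !((List.range N).any fun u => e u && !(w u))

/-- The values of the nodes of a circuit given by its edges and its labels, after `j` gates. -/
def nodeVal (E : ℕ → ℕ → Bool) (lab : ℕ → Bool × Bool) (n : ℕ) (x : ℕ → Bool) : ℕ → ℕ → Bool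
  | 0 => x
  | j + 1 => Function.update (nodeVal E lab n x j) (n + j)
      (gateVal (fun u => E u (n + j)) (lab j) (nodeVal E lab n x j) (n + j))

/-- Whether some node reads node `u`. -/
def isRead (E : ℕ → ℕ → Bool) (N u : ℕ) : Bool := (List.range N).any fun w => E u w

/-- The number of nodes below `u` that are read. -/
def readRank (E : ℕ → ℕ → Bool) (N u : ℕ) : ℕ := (List.range u).countP (isRead E N)

/-- The program that tests whether node `u` is read. -/
def usedB (ι z N : ℕ) (P : Prog) (u : ℕ) : Prog × ℕ :=
  orFold ι z (fun P w => (P, u * N + w)) P N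

/-- The state of the program that distributes the search bits to the inputs: the program, the queue
of the remaining search bits, and the inputs defined so far. -/
abbrev QueueState := Prog × List ℕ × List ℕ

/-- Define input `u`. -/
def queueStep (ι z s N : ℕ) (S : QueueState) (u : ℕ) : QueueState :=
  let p := usedB ι z N S.1 u
  let q := mapFold (fun P i => muxB ι P p.2 (S.2.1.getD (i + 1) z) (S.2.1.getD i z)) p.1 s
  (q.1, q.2, S.2.2 ++ [S.2.1.getD 0 z])

/-- Distribute the search bits to the first `n` inputs. -/
def queueProg (ι z s N l n : ℕ) : QueueState :=
  (List.range n).foldl (queueStep ι z s N) ([], (List.range s).map (fun i => l + 1 + i), [])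

/-- Define the value of gate `j`, given the numbers of the nodes that hold the earlier values. -/
def gateStep (ι z n m : ℕ) (S : Prog × List ℕ) (j : ℕ) : Prog × List ℕ :=
  let p1 := orFold ι z (fun P u => andB ι P (u * (n + m) + (n + j)) (S.2.getD u z)) S.1 (n + j)
  let p2 := orFold ι z (fun P u => andB ι (notB ι P (S.2.getD u z)).1 (u * (n + m) + (n + j))
    (notB ι P (S.2.getD u z)).2) p1.1 (n + j)
  let p3 := notB ι p2.1 p1.2
  let p4 := notB ι p3.1 p2.2
  let p5 := muxB ι p4.1 ((n + m) * (n + m) + (2 * j + 1)) p1.2 p4.2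
  let p6 := muxB ι p5.1 ((n + m) * (n + m) + 2 * j) p3.2 p5.2
  (p6.1, S.2 ++ [p6.2])

/-- The program of the oracle: it evaluates the circuit on the assignment given by the search bits,
and conjoins the result with the auxiliary bit. -/
def oracleProg (n m s : ℕ) : Prog × ℕ :=
  let l := BCircuit.encLen n m
  let z := l + 1 + s
  let S := queueProg (z + 1) z s (n + m) l n
  let T := (List.range m).foldl (gateStep (z + 1) z n m) (S.1, S.2.2)
  andB (z + 1) T.1 (T.2.getD (n + m - 1) z) l

/-- The program that tests whether one of `k` nodes, from node `i` on, is true. -/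
def anyProg (ι z i k : ℕ) : Prog × ℕ := orFold ι z (fun P j => (P, i + j)) [] k

lemma anyProg_spec {z i k : ℕ} (hz : z < ι) (hvz : v z = false) (hk : i + k ≤ ι) :
    Yields ι v [] (anyProg ι z i k) (k * 3) ((List.range k).any fun j => v (i + j)) := by
  have hz' := Good.input (v := v) [] hz
  rw [hvz] at hz'
  have := orFold_spec (f := fun P j => (P, i + j)) (k := k) (K := 0) (F := fun j => v (i + j)) hz'
    fun P' _ j hj => Yields.of_good (Good.input P' (by omega))
  simpa [anyProg] using this

lemma usedB_spec {z N u : ℕ} {P : Prog} {E : ℕ → ℕ → Bool} (hz : z < ι) (hvz : v z = false)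
    (hu : u < N) (hN : N * N ≤ ι) (hE : ∀ w < N, v (u * N + w) = E u w) :
    Yields ι v P (usedB ι z N P u) (N * 3) (isRead E N u) := by
  have hz' := Good.input (v := v) P hz
  rw [hvz] at hz'
  have := orFold_spec (f := fun P w => (P, u * N + w)) (k := N) (K := 0) (F := fun w => E u w) hz'
    fun P' _ w hw => by
      rw [← hE w hw]
      refine Yields.of_good (Good.input P' (lt_of_lt_of_le ?_ hN))
      calc u * N + w < u * N + N := by omega
        _ = (u + 1) * N := by ring
        _ ≤ N * N := Nat.mul_le_mul_right _ hu
  simpa [usedB, isRead] using this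

lemma readRank_succ (E : ℕ → ℕ → Bool) (N u : ℕ) :
    readRank E N (u + 1) = readRank E N u + if isRead E N u then 1 else 0 := by
  simp [readRank, List.range_succ, List.countP_append, List.countP_cons]

/-- The assignment given by the search bits `Y`. -/
def spread (E : ℕ → ℕ → Bool) (N : ℕ) (Y : ℕ → Bool) (u : ℕ) : Bool := Y (readRank E N u)

/-- Which inputs are read depends on the encoded circuit, so the distribution of search bits has to
be computed. Each input takes the head of the queue, and the queue is shifted by one exactly when
that input is read. An unread input also takes the head, which does no harm. -/
lemma queueProg_spec {z s N l n : ℕ} {E : ℕ → ℕ → Bool} {Y : ℕ → Bool} (hz : z < ι)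
    (hvz : v z = false) (hn : n ≤ N) (hN : N * N ≤ ι) (hE : ∀ u < N, ∀ w < N, v (u * N + w) = E u w)
    (hY : ∀ i < s, v (l + 1 + i) = Y i) (hl : l + 1 + s ≤ ι) (hYs : ∀ i, s ≤ i → Y i = false) :
    (queueProg ι z s N l n).1.length ≤ n * (N * 3 + s * 4) ∧
    (queueProg ι z s N l n).2.2.length = n ∧
    ∀ u < n, Good ι v (queueProg ι z s N l n).1 ((queueProg ι z s N l n).2.2.getD u z)
      (spread E N Y u) := by
  -- The induction also needs the contents of the queue: entry `i` is the search bit `i` places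
  -- after the current rank.
  suffices H : (queueProg ι z s N l n).1.length ≤ n * (N * 3 + s * 4) ∧
      (queueProg ι z s N l n).2.2.length = n ∧
      (∀ i, Good ι v (queueProg ι z s N l n).1 ((queueProg ι z s N l n).2.1.getD i z)
        (Y (readRank E N n + i))) ∧
      ∀ u < n, Good ι v (queueProg ι z s N l n).1 ((queueProg ι z s N l n).2.2.getD u z)
        (spread E N Y u) from ⟨H.1, H.2.1, H.2.2.2⟩
  induction n with
  | zero =>
    refine ⟨by simp [queueProg], by simp [queueProg], fun i => ?_, by simp⟩
    simp only [queueProg, List.range_zero, List.foldl_nil, readRank, List.countP_nil, zero_add]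
    by_cases hi : i < s
    · rw [List.getD_eq_getElem _ _ (by simpa using hi), List.getElem_map, List.getElem_range,
        ← hY i hi]
      exact Good.input _ (by omega)
    · rw [List.getD_eq_default _ _ (by simpa using hi), hYs i (by omega), ← hvz]
      exact Good.input _ hz
  | succ n ih =>
    obtain ⟨h1, h2, h3, h4⟩ := ih (by omega)
    have e : queueProg ι z s N l (n + 1) = queueStep ι z s N (queueProg ι z s N l n) n := by
      simp [queueProg, List.range_succ, List.foldl_append]
    rw [e]
    generalize queueProg ι z s N l n = S at *
    have hu := usedB_spec (P := S.1) hz hvz (by omega : n < N) hN (hE n (by omega))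
    obtain ⟨k1, k2, k3, k4⟩ := mapFold_spec (z := z) (k := s) (K := 4)
      (f := fun P i => muxB ι P (usedB ι z N S.1 n).2 (S.2.1.getD (i + 1) z) (S.2.1.getD i z))
      (F := fun i => if isRead E N n then Y (readRank E N n + (i + 1)) else Y (readRank E N n + i))
      fun P' hP' i _ => muxB_spec (hu.good.mono hP') ((h3 (i + 1)).mono (hu.suffix.trans hP'))
        ((h3 i).mono (hu.suffix.trans hP'))
    simp only [queueStep]
    generalize mapFold (fun P i => muxB ι P (usedB ι z N S.1 n).2 (S.2.1.getD (i + 1) z)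
      (S.2.1.getD i z)) (usedB ι z N S.1 n).1 s = q at *
    have hext := hu.suffix.trans k1
    refine ⟨?_, by simp [h2], fun i => ?_, fun u hu' => ?_⟩
    · have := hu.length_le
      rw [add_mul]; omega
    · by_cases hi : i < s
      · have := k4 i hi
        rw [readRank_succ]
        split_ifs at this ⊢
        · rwa [show readRank E N n + 1 + i = readRank E N n + (i + 1) by omega]
        · exact this
      -- Past its end the queue reads the default node `z`, which is false, in accordance with the
      -- vanishing of `Y` from `s` on.
      · rw [List.getD_eq_default _ _ (by omega), hYs _ (by omega), ← hvz]
        exact Good.input _ hz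
    · rw [getD_append_singleton h2]
      split_ifs with hun
      · subst hun
        exact (h3 0).mono hext
      · exact (h4 u (by omega)).mono hext

/-- The program cannot branch on the encoding. It forms the disjunction of the operands (`p1`) and
of their negations (`p2`), which determine the result for every gate type, and the two label bits
select among them. -/
lemma gateStep_spec {z n m j : ℕ} {E : ℕ → ℕ → Bool} {lab : ℕ → Bool × Bool} {w : ℕ → Bool}
    {S : Prog × List ℕ} (hz : z < ι) (hvz : v z = false) (hj : j < m)
    (hι : (n + m) * (n + m) + 2 * m ≤ ι)
    (hE : ∀ u < n + m, ∀ w < n + m, v (u * (n + m) + w) = E u w)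
    (hl1 : v ((n + m) * (n + m) + 2 * j) = (lab j).1)
    (hl2 : v ((n + m) * (n + m) + (2 * j + 1)) = (lab j).2)
    (hS : ∀ u < n + j, Good ι v S.1 (S.2.getD u z) (w u)) (hSl : S.2.length = n + j) :
    S.1 <:+ (gateStep ι z n m S j).1 ∧
    (gateStep ι z n m S j).1.length ≤ S.1.length + ((n + m) * 11 + 10) ∧
    (gateStep ι z n m S j).2.length = n + j + 1 ∧
    ∀ u < n + j + 1, Good ι v (gateStep ι z n m S j).1 ((gateStep ι z n m S j).2.getD u z)
      (Function.update w (n + j) (gateVal (fun u => E u (n + j)) (lab j) w (n + j)) u) := by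
  have hedge : ∀ P, ∀ u < n + j, Good ι v P (u * (n + m) + (n + j)) (E u (n + j)) := by
    intro P u hu
    rw [← hE u (by omega) (n + j) (by omega)]
    refine Good.input P (lt_of_lt_of_le ?_ ((Nat.le_add_right _ _).trans hι))
    calc u * (n + m) + (n + j) < u * (n + m) + (n + m) := by omega
      _ = (u + 1) * (n + m) := by ring
      _ ≤ (n + m) * (n + m) := Nat.mul_le_mul_right _ (by omega)
  have hz' := fun P => (hvz ▸ Good.input (v := v) P hz : Good ι v P z false)
  have h1 := orFold_spec (hz' S.1) (k := n + j) (K := 2)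
    (f := fun P u => andB ι P (u * (n + m) + (n + j)) (S.2.getD u z))
    (F := fun u => E u (n + j) && w u)
    fun P' hP' u hu => andB_spec (hedge P' u hu) ((hS u hu).mono hP')
  have hnot : ∀ P', S.1 <:+ P' → ∀ u < n + j, Yields ι v P' (andB ι (notB ι P' (S.2.getD u z)).1
      (u * (n + m) + (n + j)) (notB ι P' (S.2.getD u z)).2) 3 (E u (n + j) && !(w u)) := by
    intro P' hP' u hu
    have k1 := notB_spec ((hS u hu).mono hP')
    have k2 := andB_spec (hedge _ u hu) k1.good
    refine ⟨k1.suffix.trans k2.suffix, ?_, k2.good⟩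
    have := k1.length_le; have := k2.length_le; omega
  simp only [gateStep]
  generalize orFold ι z (fun P u => andB ι P (u * (n + m) + (n + j)) (S.2.getD u z)) S.1 (n + j)
    = p1 at *
  have h2 := orFold_spec (hz' p1.1) (k := n + j) (K := 3)
    (f := fun P u => andB ι (notB ι P (S.2.getD u z)).1 (u * (n + m) + (n + j))
      (notB ι P (S.2.getD u z)).2) (F := fun u => E u (n + j) && !(w u))
    fun P' hP' u hu => hnot P' (h1.suffix.trans hP') u hu
  generalize orFold ι z (fun P u => andB ι (notB ι P (S.2.getD u z)).1 (u * (n + m) + (n + j))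
    (notB ι P (S.2.getD u z)).2) p1.1 (n + j) = p2 at *
  have h3 := notB_spec (h1.good.mono h2.suffix)
  generalize notB ι p2.1 p1.2 = p3 at *
  have h4 := notB_spec (h2.good.mono h3.suffix)
  generalize notB ι p3.1 p2.2 = p4 at *
  have h5 := muxB_spec (Good.input p4.1 (show (n + m) * (n + m) + (2 * j + 1) < ι by omega))
    (h1.good.mono (h2.suffix.trans (h3.suffix.trans h4.suffix))) h4.good
  generalize muxB ι p4.1 ((n + m) * (n + m) + (2 * j + 1)) p1.2 p4.2 = p5 at *
  have h6 := muxB_spec (Good.input p5.1 (show (n + m) * (n + m) + 2 * j < ι by omega))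
    (h3.good.mono (h4.suffix.trans h5.suffix)) h5.good
  generalize muxB ι p5.1 ((n + m) * (n + m) + 2 * j) p3.2 p5.2 = p6 at *
  have hext := h1.suffix.trans (h2.suffix.trans (h3.suffix.trans (h4.suffix.trans
    (h5.suffix.trans h6.suffix))))
  refine ⟨hext, ?_, by simp [hSl], fun u hu => ?_⟩
  · have := h1.length_le; have := h2.length_le; have := h3.length_le
    have := h4.length_le; have := h5.length_le; have := h6.length_le
    omega
  · rw [getD_append_singleton hSl]
    split_ifs with huj
    · subst huj
      rw [Function.update_self]
      have := h6.good
      rw [hl1, hl2] at this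
      exact this
    · rw [Function.update_of_ne huj]
      exact (hS u (by omega)).mono hext

/-- Node `l` holds the auxiliary bit. The conjunction with it is what lets the rotation of the
auxiliary qubit scale the weight of the marked configurations. -/
lemma oracleProg_spec {n m s : ℕ} (hm : 1 ≤ m) {E : ℕ → ℕ → Bool} {lab : ℕ → Bool × Bool}
    {Y : ℕ → Bool} (hE : ∀ u < n + m, ∀ w < n + m, v (u * (n + m) + w) = E u w)
    (hl1 : ∀ j < m, v ((n + m) * (n + m) + 2 * j) = (lab j).1)
    (hl2 : ∀ j < m, v ((n + m) * (n + m) + (2 * j + 1)) = (lab j).2)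
    (hY : ∀ i < s, v (BCircuit.encLen n m + 1 + i) = Y i) (hYs : ∀ i, s ≤ i → Y i = false)
    (hz : v (BCircuit.encLen n m + 1 + s) = false) :
    Yields (BCircuit.encLen n m + 1 + s + 1) v [] (oracleProg n m s)
      (n * ((n + m) * 3 + s * 4) + m * ((n + m) * 11 + 10) + 2)
      (nodeVal E lab n (spread E (n + m) Y) m (n + m - 1) && v (BCircuit.encLen n m)) := by
  simp only [oracleProg]
  set l := BCircuit.encLen n m with hl
  have hl' : l = (n + m) * (n + m) + 2 * m := rfl
  set z := l + 1 + s with hzdef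
  obtain ⟨h1, h2, h3⟩ := queueProg_spec (ι := z + 1) (v := v) (z := z) (s := s) (N := n + m)
    (l := l) (n := n) (Y := Y) (by omega) hz (by omega) (by omega) hE hY (by omega) hYs
  generalize queueProg (z + 1) z s (n + m) l n = S at *
  have key : ∀ j ≤ m, S.1 <:+ ((List.range j).foldl (gateStep (z + 1) z n m) (S.1, S.2.2)).1 ∧
      ((List.range j).foldl (gateStep (z + 1) z n m) (S.1, S.2.2)).1.length ≤
        S.1.length + j * ((n + m) * 11 + 10) ∧
      ((List.range j).foldl (gateStep (z + 1) z n m) (S.1, S.2.2)).2.length = n + j ∧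
      ∀ u < n + j, Good (z + 1) v ((List.range j).foldl (gateStep (z + 1) z n m) (S.1, S.2.2)).1
        (((List.range j).foldl (gateStep (z + 1) z n m) (S.1, S.2.2)).2.getD u z)
        (nodeVal E lab n (spread E (n + m) Y) j u) := by
    intro j
    induction j with
    | zero =>
      intro _
      simp only [List.range_zero, List.foldl_nil, nodeVal]
      exact ⟨List.suffix_rfl, by omega, h2, h3⟩
    | succ j ih =>
      intro hj
      obtain ⟨i1, i2, i3, i4⟩ := ih (by omega)
      simp only [List.range_succ, List.foldl_append, List.foldl_cons, List.foldl_nil]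
      generalize (List.range j).foldl (gateStep (z + 1) z n m) (S.1, S.2.2) = T at *
      obtain ⟨j1, j2, j3, j4⟩ := gateStep_spec (ι := z + 1) (S := T) (by omega : z < z + 1) hz
        (by omega : j < m) (by omega) hE (hl1 j (by omega)) (hl2 j (by omega)) i4 i3
      refine ⟨i1.trans j1, ?_, j3, j4⟩
      rw [add_mul]; omega
  obtain ⟨k1, k2, k3, k4⟩ := key m le_rfl
  generalize (List.range m).foldl (gateStep (z + 1) z n m) (S.1, S.2.2) = T at *
  have hfin := andB_spec (k4 (n + m - 1) (by omega)) (Good.input T.1 (show l < z + 1 by omega))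
  refine ⟨List.nil_suffix, ?_, hfin.good⟩
  have := hfin.length_le
  simp only [List.length_nil]
  omega

end Prog


namespace Prog

/-! ### Satisfiability in terms of compressed assignments -/

lemma any_range_congr {k : ℕ} {f g : ℕ → Bool} (h : ∀ i < k, f i = g i) :
    (List.range k).any f = (List.range k).any g := by
  induction k with
  | zero => rfl
  | succ k ih =>
    simp only [List.range_succ, List.any_append, List.any_cons, List.any_nil]
    rw [ih fun i hi => h i (by omega), h k (by omega)]

lemma nodeVal_congr {E E' : ℕ → ℕ → Bool} {lab lab' : ℕ → Bool × Bool} {n : ℕ} {x : ℕ → Bool}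
    {m : ℕ} (hE : ∀ j < m, ∀ u, E u (n + j) = E' u (n + j)) (hl : ∀ j < m, lab j = lab' j) :
    nodeVal E lab n x m = nodeVal E' lab' n x m := by
  induction m with
  | zero => rfl
  | succ m ih =>
    simp only [nodeVal]
    rw [ih (fun j hj => hE j (by omega)) (fun j hj => hl j (by omega)), hl m (by omega),
      show (fun u => E u (n + m)) = fun u => E' u (n + m) from funext (hE m (by omega))]

lemma any_range_eq_and {N : ℕ} (w : ℕ → Bool) (i : Fin N) :
    ((List.range N).any fun u => decide ((i : ℕ) = u) && w u) = w i := by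
  rw [Bool.eq_iff_iff]
  simp only [List.any_eq_true, List.mem_range, Bool.and_eq_true, decide_eq_true_eq]
  constructor
  · rintro ⟨u, -, rfl, h⟩; exact h
  · exact fun h => ⟨i, i.2, rfl, h⟩

lemma any_range_eq_or_and {N : ℕ} (w : ℕ → Bool) (i j : Fin N) :
    ((List.range N).any fun u => (decide ((i : ℕ) = u) || decide ((j : ℕ) = u)) && w u) =
      (w i || w j) := by
  rw [Bool.eq_iff_iff]
  simp only [List.any_eq_true, List.mem_range, Bool.and_eq_true, Bool.or_eq_true,
    decide_eq_true_eq]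
  constructor
  · rintro ⟨u, -, rfl | rfl, h⟩
    · exact Or.inl h
    · exact Or.inr h
  · rintro (h | h)
    · exact ⟨i, i.2, Or.inl rfl, h⟩
    · exact ⟨j, j.2, Or.inr rfl, h⟩

/-- The adjacency matrix records only the set of operands, without order or multiplicity. This
suffices, as conjunction and disjunction are symmetric and idempotent. -/
lemma gateVal_eq_eval {N : ℕ} (g : BGate N) (w : ℕ → Bool) :
    gateVal (fun u => g.reads u) g.label w N = g.eval fun i => w i := by
  cases g with
  | and i j =>
    have := any_range_eq_or_and (fun u => !(w u)) i j
    simp only [gateVal, BGate.label, BGate.reads, BGate.eval, this]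
    simp
  | or i j => simp [gateVal, BGate.label, BGate.reads, BGate.eval, any_range_eq_or_and w i j]
  | not i => simp [gateVal, BGate.label, BGate.reads, BGate.eval, any_range_eq_and w i]

lemma nodeVal_snoc {n m : ℕ} (C : BCircuit n m) (g : BGate (n + m)) (x : ℕ → Bool) :
    nodeVal (fun u w => (C.snoc g).hasEdge u w) (fun j => (C.snoc g).gateLabel j) n x (m + 1) =
      Function.update (nodeVal (fun u w => C.hasEdge u w) (fun j => C.gateLabel j) n x m) (n + m)
        (g.eval fun i => nodeVal (fun u w => C.hasEdge u w) (fun j => C.gateLabel j) n x m i) := by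
  rw [nodeVal, nodeVal_congr (E' := fun u w => C.hasEdge u w) (lab' := fun j => C.gateLabel j)]
  · rw [← gateVal_eq_eval]
    simp [BCircuit.hasEdge, BCircuit.gateLabel]
  · intro j hj u
    simp [BCircuit.hasEdge, hj.ne]
  · intro j hj
    simp [BCircuit.gateLabel, hj.ne]

lemma nodes_eq_nodeVal {n m : ℕ} (C : BCircuit n m) (x : Fin n → Bool) {X : ℕ → Bool}
    (hX : ∀ i : Fin n, X i = x i) (i : Fin (n + m)) :
    C.nodes x i = nodeVal (fun u w => C.hasEdge u w) (fun j => C.gateLabel j) n X m i := by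
  induction C with
  | nil => exact (hX i).symm
  | @snoc m C g ih =>
    rw [nodeVal_snoc, BCircuit.nodes]
    have hw : C.nodes x =
        fun i : Fin (n + m) =>
          nodeVal (fun u w => C.hasEdge u w) (fun j => C.gateLabel j) n X m i := funext ih
    refine Fin.lastCases (n := n + m) ?_ (fun (i : Fin (n + m)) => ?_) i
    · refine (Fin.snoc_last (α := fun _ => Bool) _ _).trans ?_
      rw [Fin.val_last, Function.update_self, hw]
    · refine (Fin.snoc_castSucc (α := fun _ => Bool) _ _ _).trans ?_
      rw [Fin.val_castSucc, Function.update_of_ne i.2.ne, ih]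

lemma output_eq_nodeVal {n m : ℕ} (hm : 1 ≤ m) (C : BCircuit n m) (x : Fin n → Bool) {X : ℕ → Bool}
    (hX : ∀ i : Fin n, X i = x i) :
    C.output x =
      nodeVal (fun u w => C.hasEdge u w) (fun j => C.gateLabel j) n X m (n + m - 1) := by
  cases C with
  | nil => omega
  | @snoc m C g =>
    rw [nodeVal_snoc, show n + (m + 1) - 1 = n + m by omega, Function.update_self,
      BCircuit.output]
    congr 1
    exact funext fun i => nodes_eq_nodeVal C x hX i

lemma nodeVal_of_lt {E : ℕ → ℕ → Bool} {lab : ℕ → Bool × Bool} {n : ℕ} {x : ℕ → Bool} (j : ℕ)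
    {u : ℕ} (hu : u < n) : nodeVal E lab n x j u = x u := by
  induction j with
  | zero => rfl
  | succ j ih => rw [nodeVal, Function.update_of_ne (by omega), ih]

/-- A gate only sees nodes with an edge into it, so by induction the gate values depend on the read
inputs alone. For input nodes themselves this would fail, hence `n ≤ i`. -/
lemma nodeVal_congr_input {E : ℕ → ℕ → Bool} {lab : ℕ → Bool × Bool} {n m : ℕ} {x x' : ℕ → Bool}
    (hx : ∀ u < n, isRead E (n + m) u = true → x u = x' u) {j : ℕ} (hj : j ≤ m) {i : ℕ}
    (hi : n ≤ i) (hij : i < n + j) : nodeVal E lab n x j i = nodeVal E lab n x' j i := by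
  induction j generalizing i with
  | zero => omega
  | succ j ih =>
    have hval : ∀ u < n + j, E u (n + j) = true →
        nodeVal E lab n x j u = nodeVal E lab n x' j u := by
      intro u hu hE
      by_cases hun : u < n
      · rw [nodeVal_of_lt j hun, nodeVal_of_lt j hun]
        refine hx u hun ?_
        simp only [isRead, List.any_eq_true, List.mem_range]
        exact ⟨n + j, by omega, hE⟩
      · exact ih (by omega) (by omega) hu
    simp only [nodeVal]
    by_cases hin : i = n + j
    · subst hin
      rw [Function.update_self, Function.update_self]
      unfold gateVal
      rw [any_range_congr (f := fun u => E u (n + j) && nodeVal E lab n x j u)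
        (g := fun u => E u (n + j) && nodeVal E lab n x' j u),
        any_range_congr (f := fun u => E u (n + j) && !(nodeVal E lab n x j u))
        (g := fun u => E u (n + j) && !(nodeVal E lab n x' j u))]
      all_goals
        intro u hu
        cases hE : E u (n + j)
        · rfl
        · simp only [hval u hu hE]
    · rw [Function.update_of_ne hin, Function.update_of_ne hin]
      exact ih (by omega) hi (by omega)

/-! ### Ranks of the read inputs, and compression of assignments -/

lemma readRank_mono (E : ℕ → ℕ → Bool) (N : ℕ) : Monotone (readRank E N) :=
  monotone_nat_of_le_succ fun u => by rw [readRank_succ]; omega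

lemma readRank_lt {E : ℕ → ℕ → Bool} {N u u' : ℕ} (hu : isRead E N u = true) (h : u < u') :
    readRank E N u < readRank E N u' := by
  have h1 : readRank E N (u + 1) ≤ readRank E N u' := readRank_mono E N h
  rw [readRank_succ, if_pos hu] at h1
  omega

lemma readRank_injective {E : ℕ → ℕ → Bool} {N u u' : ℕ} (hu : isRead E N u = true)
    (hu' : isRead E N u' = true) (h : readRank E N u = readRank E N u') : u = u' := by
  rcases lt_trichotomy u u' with h' | h' | h'
  · have := readRank_lt hu h'; omega
  · exact h'
  · have := readRank_lt hu' h'; omega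

lemma readRank_le (E : ℕ → ℕ → Bool) (N n : ℕ) : readRank E N n ≤ n :=
  List.countP_le_length.trans_eq List.length_range

lemma countP_or_le (p q : ℕ → Bool) (L : List ℕ) :
    L.countP (fun u => p u || q u) ≤ L.countP p + L.countP q := by
  induction L with
  | nil => simp
  | cons a L ih =>
    simp only [List.countP_cons]
    cases p a <;> cases q a <;> simp <;> omega

lemma countP_eq_le_one (i n : ℕ) : (List.range n).countP (fun u => decide (i = u)) ≤ 1 := by
  have h : (List.range n).countP (fun u => decide (i = u)) = (List.range n).count i := by
    rw [List.count]
    congr 1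
    funext u
    by_cases h : i = u
    · simp [h]
    · simp [h, Ne.symm h]
  rw [h]
  exact List.nodup_iff_count_le_one.mp List.nodup_range i

lemma countP_reads_le {N : ℕ} (g : BGate N) (n : ℕ) :
    (List.range n).countP (fun u => g.reads u) ≤ 2 := by
  cases g with
  | and i j =>
    have := countP_or_le (fun u => decide ((i : ℕ) = u)) (fun u => decide ((j : ℕ) = u))
      (List.range n)
    have := countP_eq_le_one i n
    have := countP_eq_le_one j n
    simp only [BGate.reads]; omega
  | or i j =>
    have := countP_or_le (fun u => decide ((i : ℕ) = u)) (fun u => decide ((j : ℕ) = u))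
      (List.range n)
    have := countP_eq_le_one i n
    have := countP_eq_le_one j n
    simp only [BGate.reads]; omega
  | not i =>
    have := countP_eq_le_one i n
    simp only [BGate.reads]; omega

/-- Each new gate has at most two operands, so it adds at most two read inputs. -/
lemma readRank_le_two_mul {n m : ℕ} (C : BCircuit n m) :
    readRank (fun u w => C.hasEdge u w) (n + m) n ≤ 2 * m := by
  induction C with
  | nil =>
    have : ∀ u, isRead (fun u w => (BCircuit.nil : BCircuit n 0).hasEdge u w) n u = false := by
      intro u; simp [isRead, BCircuit.hasEdge]
    simp [readRank, this]
  | @snoc m C g ih =>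
    have : ∀ u, isRead (fun u w => (C.snoc g).hasEdge u w) (n + (m + 1)) u =
        (isRead (fun u w => C.hasEdge u w) (n + m) u || g.reads u) := by
      intro u
      rw [isRead, isRead, ← Nat.add_assoc, List.range_succ, List.any_append]
      rw [any_range_congr (g := fun w => C.hasEdge u w)]
      · simp [BCircuit.hasEdge]
      · intro w hw
        simp [BCircuit.hasEdge, hw.ne]
    have h1 := countP_or_le (isRead (fun u w => C.hasEdge u w) (n + m)) (fun u => g.reads u)
      (List.range n)
    have h2 := countP_reads_le g n
    rw [readRank, List.countP_congr (q := fun u =>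
      (isRead (fun u w => C.hasEdge u w) (n + m) u || g.reads u)) (fun u _ => by rw [this])]
    rw [readRank] at ih
    omega

/-- The value of the circuit on the assignment given by the search bits `Y`. -/
def circuitVal {n m : ℕ} (C : BCircuit n m) (Y : ℕ → Bool) : Bool :=
  nodeVal (fun u w => C.hasEdge u w) (fun j => C.gateLabel j) n
    (spread (fun u w => C.hasEdge u w) (n + m) Y) m (n + m - 1)

/-- Read inputs have distinct ranks below `min n (2 * m)`, so their values can be prescribed freely
by the search bits, and the unread inputs do not matter. Conversely, any choice of search bits
spreads to an assignment. -/
lemma satisfiable_iff {n m : ℕ} (hm : 1 ≤ m) (C : BCircuit n m) :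
    C.Satisfiable ↔ ∃ Y : Fin (min n (2 * m)) → Bool, circuitVal C (extend Y) = true := by
  constructor
  · rintro ⟨x, hx⟩
    classical
    set E : ℕ → ℕ → Bool := fun u w => C.hasEdge u w with hE
    have hX : ∀ i : Fin n, extend x i = x i := extend_apply x
    rw [output_eq_nodeVal hm C x hX] at hx
    -- Search bit `i` is the value of the unique read input of rank `i`, and false if there is none.
    refine ⟨fun i => decide (∃ u < n, isRead E (n + m) u = true ∧ readRank E (n + m) u = i ∧
      extend x u = true), ?_⟩
    refine Eq.trans ?_ hx
    refine nodeVal_congr_input (m := m) (fun u hu hr => ?_) le_rfl (by omega) (by omega)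
    have hlt : readRank E (n + m) u < min n (2 * m) :=
      (readRank_lt hr hu).trans_le (le_min (readRank_le _ _ _) (readRank_le_two_mul C))
    rw [spread, ← hE]
    rw [show extend _ (readRank E (n + m) u) = _ from extend_apply _ ⟨_, hlt⟩]
    rw [Bool.eq_iff_iff, decide_eq_true_eq]
    constructor
    · rintro ⟨u', hu', hr', h, hx'⟩
      rwa [← readRank_injective hr' hr h]
    · exact fun h => ⟨u, hu, hr, rfl, h⟩
  · rintro ⟨Y, hY⟩
    refine ⟨fun i => spread (fun u w => C.hasEdge u w) (n + m) (extend Y) i, ?_⟩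
    rw [output_eq_nodeVal hm C _ (X := spread (fun u w => C.hasEdge u w) (n + m) (extend Y))
      fun i => rfl]
    exact hY

/-! ### The oracle program on encoded circuits -/

lemma encode_edge {n m : ℕ} (C : BCircuit n m) {u w : ℕ} (hu : u < n + m) (hw : w < n + m) :
    extend C.encode (u * (n + m) + w) = C.hasEdge u w := by
  have h : u * (n + m) + w < (n + m) * (n + m) := by
    calc u * (n + m) + w < u * (n + m) + (n + m) := by omega
      _ = (u + 1) * (n + m) := by ring
      _ ≤ (n + m) * (n + m) := Nat.mul_le_mul_right _ hu
  have h2 := extend_apply C.encode (Fin.castAdd (2 * m) ⟨u * (n + m) + w, h⟩)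
  rw [BCircuit.encode, Fin.append_left] at h2
  rw [show u * (n + m) + w = ((Fin.castAdd (2 * m) (⟨u * (n + m) + w, h⟩ :
    Fin ((n + m) * (n + m))) : Fin _) : ℕ) from rfl]
  refine h2.trans ?_
  have h0 : 0 < n + m := by omega
  simp only
  rw [show (u * (n + m) + w) / (n + m) = u by
      rw [mul_comm, Nat.mul_add_div h0, Nat.div_eq_of_lt hw, add_zero],
    show (u * (n + m) + w) % (n + m) = w by
      rw [mul_comm, Nat.mul_add_mod, Nat.mod_eq_of_lt hw]]

lemma encode_label {n m : ℕ} (C : BCircuit n m) {j : ℕ} (hj : j < 2 * m) :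
    extend C.encode ((n + m) * (n + m) + j) =
      if j % 2 = 0 then (C.gateLabel (j / 2)).1 else (C.gateLabel (j / 2)).2 := by
  have h2 := extend_apply C.encode (Fin.natAdd ((n + m) * (n + m)) ⟨j, hj⟩)
  rw [BCircuit.encode, Fin.append_right] at h2
  exact h2

end Prog


/-! ### Amplitude amplification -/

section Amplify

variable {d : ℕ}

/-- Apply a reflection gate with parameter `p i` to qubit `i`. -/
noncomputable def reflAt (p : Fin d → ℝ) (i : Fin d) (v : (Fin d → Bool) → ℝ) :
    (Fin d → Bool) → ℝ :=
  fun x => ∑ b : Bool, reflEntry (p i) (x i) b * v (Function.update x i b)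

/-- Apply the reflection gates of a list of qubits. -/
noncomputable def reflList (p : Fin d → ℝ) (L : List (Fin d)) (v : (Fin d → Bool) → ℝ) :
    (Fin d → Bool) → ℝ :=
  L.foldl (fun v i => reflAt p i v) v

/-- The zero basis vector. -/
noncomputable def zeroState : (Fin d → Bool) → ℝ := fun x => if x = fun _ => false then 1 else 0

/-- The prepared state. -/
noncomputable def prepared (p : Fin d → ℝ) : (Fin d → Bool) → ℝ :=
  reflList p (List.finRange d) zeroState

lemma reflEntry_symm (x : ℝ) (r s : Bool) : reflEntry x r s = reflEntry x s r := by
  cases r <;> cases s <;> rfl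

lemma reflEntry_mul {x : ℝ} (h0 : 0 ≤ x) (h1 : x ≤ 1) (r s : Bool) :
    ∑ b : Bool, reflEntry x r b * reflEntry x b s = if r = s then 1 else 0 := by
  have h2 : √(1 - x) * √(1 - x) = 1 - x := Real.mul_self_sqrt (by linarith)
  have h3 : √x * √x = x := Real.mul_self_sqrt h0
  cases r <;> cases s <;> simp [reflEntry, h2, h3, mul_comm]

lemma reflAt_reflAt {p : Fin d → ℝ} {i : Fin d} (h0 : 0 ≤ p i) (h1 : p i ≤ 1)
    (v : (Fin d → Bool) → ℝ) : reflAt p i (reflAt p i v) = v := by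
  funext x
  simp only [reflAt, Function.update_self, Function.update_idem, Finset.mul_sum]
  rw [Finset.sum_comm]
  simp only [← mul_assoc, ← Finset.sum_mul, reflEntry_mul h0 h1]
  simp

lemma reflAt_linear (p : Fin d → ℝ) (i : Fin d) (a b : ℝ) (v w : (Fin d → Bool) → ℝ) :
    reflAt p i (fun x => a * v x + b * w x) = fun x => a * reflAt p i v x + b * reflAt p i w x := by
  funext x
  simp only [reflAt, Finset.mul_sum, ← Finset.sum_add_distrib]
  refine Finset.sum_congr rfl fun b _ => ?_
  ring

lemma reflList_linear (p : Fin d → ℝ) (L : List (Fin d)) (a b : ℝ) (v w : (Fin d → Bool) → ℝ) :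
    reflList p L (fun x => a * v x + b * w x) =
      fun x => a * reflList p L v x + b * reflList p L w x := by
  induction L generalizing v w with
  | nil => rfl
  | cons i L ih =>
    simp only [reflList, List.foldl_cons] at ih ⊢
    rw [reflAt_linear, ih]

lemma reflList_reverse {p : Fin d → ℝ} (h : ∀ i, 0 ≤ p i ∧ p i ≤ 1) (L : List (Fin d))
    (v : (Fin d → Bool) → ℝ) : reflList p L (reflList p L.reverse v) = v := by
  induction L generalizing v with
  | nil => rfl
  | cons i L ih =>
    simp only [reflList, List.reverse_cons, List.foldl_append, List.foldl_cons,
      List.foldl_nil] at ih ⊢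
    rw [reflAt_reflAt (h i).1 (h i).2, ih]

lemma sum_mul_reflAt (p : Fin d → ℝ) (i : Fin d) (v w : (Fin d → Bool) → ℝ) :
    ∑ x, w x * reflAt p i v x = ∑ x, reflAt p i w x * v x := by
  rw [sum_eq_half_sum_update i, sum_eq_half_sum_update i (fun x => reflAt p i w x * v x)]
  congr 1
  refine Finset.sum_congr rfl fun x _ => ?_
  simp only [reflAt, Function.update_self, Function.update_idem, Fintype.sum_bool]
  rw [reflEntry_symm (p i) false true]
  ring

lemma sum_mul_reflList (p : Fin d → ℝ) (L : List (Fin d)) (v w : (Fin d → Bool) → ℝ) :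
    ∑ x, w x * reflList p L v x = ∑ x, reflList p L.reverse w x * v x := by
  induction L generalizing v with
  | nil => rfl
  | cons i L ih =>
    have := ih (reflAt p i v)
    simp only [reflList, List.reverse_cons, List.foldl_append, List.foldl_cons,
      List.foldl_nil] at this ⊢
    rw [this, sum_mul_reflAt]

/-- The sign flip on the set of marked configurations. -/
def signFlip (f : (Fin d → Bool) → Bool) (v : (Fin d → Bool) → ℝ) : (Fin d → Bool) → ℝ :=
  fun x => (if f x then -1 else 1) * v x

/-- Whether a configuration is nonzero. -/
def nonzero (x : Fin d → Bool) : Bool := decide (x ≠ fun _ => false)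

/-- One round of amplitude amplification. -/
noncomputable def amplify (p : Fin d → ℝ) (f : (Fin d → Bool) → Bool) (v : (Fin d → Bool) → ℝ) :
    (Fin d → Bool) → ℝ :=
  reflList p (List.finRange d) (signFlip nonzero (reflList p (List.finRange d).reverse
    (signFlip f v)))

/-- The sign flip on nonzero configurations is twice the projection to the zero vector minus the
identity. The reversed list inverts the preparation, as each gate is an involution, so conjugation
gives the reflection about the prepared state. -/
lemma amplify_eq {p : Fin d → ℝ} (h : ∀ i, 0 ≤ p i ∧ p i ≤ 1) (f : (Fin d → Bool) → Bool)
    (v : (Fin d → Bool) → ℝ) :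
    amplify p f v = fun x => 2 * (∑ y, prepared p y * signFlip f v y) * prepared p x
      - signFlip f v x := by
  set w := signFlip f v
  set w' := reflList p (List.finRange d).reverse w with hw'
  have h1 : signFlip nonzero w' =
      fun x => (2 * w' fun _ => false) * zeroState x + (-1) * w' x := by
    funext x
    by_cases hx : x = fun _ => false
    · subst hx; simp [signFlip, nonzero, zeroState]; ring
    · simp [signFlip, nonzero, zeroState, hx]
  have h2 : (w' fun _ => false) = ∑ y, prepared p y * w y := by
    have : (w' fun _ => false) = ∑ y, zeroState y * w' y := by
      simp [zeroState]
    rw [this, hw', sum_mul_reflList, List.reverse_reverse]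
    rfl
  funext x
  rw [amplify, ← hw', h1, reflList_linear, hw', reflList_reverse h, ← hw', h2]
  simp only [prepared]
  ring

/-- The unmarked part of a vector. -/
def unmarked (f : (Fin d → Bool) → Bool) (v : (Fin d → Bool) → ℝ) : (Fin d → Bool) → ℝ :=
  fun x => if f x then 0 else v x

/-- Each round is a rotation by `2θ` in the plane of the marked and unmarked parts of the prepared
state. The start is on the unmarked axis, as after an unsuccessful detection, hence the angle `2iθ`
instead of the usual `(2i + 1)θ`. -/
lemma amplify_iterate {p : Fin d → ℝ} (h : ∀ i, 0 ≤ p i ∧ p i ≤ 1) (f : (Fin d → Bool) → Bool)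
    {θ : ℝ} (hs : ∑ x, (if f x then prepared p x ^ 2 else 0) = Real.sin θ ^ 2)
    (hc : ∑ x, (if f x then 0 else prepared p x ^ 2) = Real.cos θ ^ 2) (κ : ℝ) (i : ℕ) :
    unmarked f ((amplify p f)^[i] (fun x => κ * unmarked f (prepared p) x)) =
      fun x => (κ * Real.cos (2 * i * θ)) * unmarked f (prepared p) x := by
  -- The marked coefficient `q` is only described after multiplication by `sin θ`, which covers the
  -- case without marked configurations, where `sin θ = 0`.
  suffices H : ∃ q : ℝ, Real.sin θ * q = Real.cos θ * (κ * Real.sin (2 * i * θ)) ∧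
      (amplify p f)^[i] (fun x => κ * unmarked f (prepared p) x) =
        fun x => (if f x then q else κ * Real.cos (2 * i * θ)) * prepared p x by
    obtain ⟨q, -, hq⟩ := H
    rw [hq]
    funext x
    simp only [unmarked]
    split_ifs <;> simp
  induction i with
  | zero =>
    refine ⟨0, by simp, ?_⟩
    funext x
    simp only [Function.iterate_zero, id, unmarked]
    split_ifs <;> simp
  | succ i ih =>
    obtain ⟨q, hq, hv⟩ := ih
    have hsc := Real.sin_sq_add_cos_sq θ
    have e : 2 * ((i + 1 : ℕ) : ℝ) * θ = 2 * i * θ + 2 * θ := by push_cast; ring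
    set P := κ * Real.cos (2 * i * θ) with hP
    have hsum : ∑ y, prepared p y * signFlip f (fun x => (if f x then q else P) * prepared p x) y
        = P * Real.cos θ ^ 2 - q * Real.sin θ ^ 2 := by
      rw [← hs, ← hc, Finset.mul_sum, Finset.mul_sum, ← Finset.sum_sub_distrib]
      refine Finset.sum_congr rfl fun y _ => ?_
      simp only [signFlip]
      split_ifs <;> ring
    refine ⟨2 * (P * Real.cos θ ^ 2 - q * Real.sin θ ^ 2) + q, ?_, ?_⟩
    · rw [e, Real.sin_add, Real.sin_two_mul, Real.cos_two_mul]
      linear_combination (1 - 2 * Real.sin θ ^ 2) * hq + 2 * Real.cos θ * κ *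
        Real.sin (2 * i * θ) * (hsc) * (-1)
    · rw [Function.iterate_succ_apply', hv, amplify_eq h, hsum]
      funext x
      simp only [signFlip]
      split_ifs with hf
      · ring
      · rw [e, Real.cos_add, Real.sin_two_mul, Real.cos_two_mul]
        have : κ * (Real.cos (2 * i * θ) * (2 * Real.cos θ ^ 2 - 1) -
            Real.sin (2 * i * θ) * (2 * Real.sin θ * Real.cos θ)) =
            2 * (P * Real.cos θ ^ 2 - q * Real.sin θ ^ 2) - P := by
          rw [hP]
          linear_combination 2 * Real.sin θ * hq
        rw [this]; ring

/-- Each qubit is acted on at most once and starts at zero, so the state remains a product with the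
first column of the reflection at every visited qubit. -/
lemma reflList_zeroState (p : Fin d → ℝ) (L : List (Fin d)) (hL : L.Nodup) :
    reflList p L zeroState = fun x => ∏ i, if i ∈ L then reflEntry (p i) (x i) false else
      if x i then 0 else 1 := by
  induction L using List.reverseRecOn with
  | nil =>
    funext x
    simp only [reflList, List.foldl_nil, zeroState, List.not_mem_nil, if_false]
    split_ifs with h
    · subst h; simp
    · obtain ⟨i, hi⟩ : ∃ i, x i = true := by
        by_contra h'
        push Not at h'
        exact h (funext fun i => by simpa using h' i)
      rw [Finset.prod_eq_zero (Finset.mem_univ i)]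
      simp [hi]
  | append_singleton L i ih =>
    have hi : i ∉ L := by
      rw [List.nodup_append] at hL
      intro h
      exact hL.2.2 i h i (by simp) rfl
    have ih := ih (List.Nodup.of_append_left hL)
    have e : reflList p (L ++ [i]) zeroState = reflAt p i (reflList p L zeroState) := by
      simp [reflList]
    rw [e, ih]
    funext x
    rw [reflAt, Finset.sum_eq_single false]
    · simp only [← Finset.mul_prod_erase _ _ (Finset.mem_univ i), hi, if_false,
        Function.update_self, List.mem_append, List.mem_singleton, or_true, if_true]
      rw [show (if (false : Bool) = true then (0 : ℝ) else 1) = 1 from rfl, one_mul]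
      congr 1
      refine Finset.prod_congr rfl fun k hk => ?_
      have hk : k ≠ i := Finset.ne_of_mem_erase hk
      simp [hk]
    · intro b _ hb
      have hb : b = true := by simpa using hb
      subst hb
      rw [Finset.prod_eq_zero (Finset.mem_univ i), mul_zero]
      simp [hi]
    · simp

lemma prepared_apply (p : Fin d → ℝ) (x : Fin d → Bool) :
    prepared p x = ∏ i, reflEntry (p i) (x i) false := by
  rw [prepared, reflList_zeroState p _ (List.nodup_finRange d)]
  simp

end Amplify

/-! ### The tuned search: surviving weight after repeated detections -/

/-- The parameters of the preparation: `a` for the auxiliary qubit, which comes first, and `1 / 2`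
for the search qubits. -/
noncomputable def searchParam (s : ℕ) (a : ℝ) : Fin (s + 1) → ℝ := Fin.cons a fun _ => 1 / 2

lemma searchParam_mem {s : ℕ} {a : ℝ} (h0 : 0 ≤ a) (h1 : a ≤ 1) (i : Fin (s + 1)) :
    0 ≤ searchParam s a i ∧ searchParam s a i ≤ 1 := by
  refine Fin.cases ?_ (fun i => ?_) i
  · exact ⟨h0, h1⟩
  · simp only [searchParam, Fin.cons_succ]; norm_num

/-- The marked configurations: those whose auxiliary bit is set and whose search bits satisfy `g`. -/
def marked {s : ℕ} (g : (Fin s → Bool) → Bool) (x : Fin (s + 1) → Bool) : Bool :=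
  g (fun i => x i.succ) && x 0

lemma prepared_cons_sq {s : ℕ} {a : ℝ} (h0 : 0 ≤ a) (h1 : a ≤ 1) (b : Bool) (y : Fin s → Bool) :
    prepared (searchParam s a) (Fin.cons b y) ^ 2 = (if b then a else 1 - a) * (1 / 2) ^ s := by
  rw [prepared_apply, Fin.prod_univ_succ, mul_pow, ← Finset.prod_pow]
  congr 1
  · cases b
    · simp [searchParam, reflEntry, Real.sq_sqrt (sub_nonneg.mpr h1)]
    · simp [searchParam, reflEntry, Real.sq_sqrt h0]
  · rw [Finset.prod_congr rfl (g := fun _ => (1 / 2 : ℝ))]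
    · simp
    · intro i _
      simp only [searchParam, Fin.cons_succ, reflEntry]
      split_ifs
      · rw [neg_sq, Real.sq_sqrt] <;> norm_num
      · rw [Real.sq_sqrt] <;> norm_num
      · rw [Real.sq_sqrt]; norm_num

lemma sum_cons {s : ℕ} (F : (Fin (s + 1) → Bool) → ℝ) :
    ∑ x, F x = ∑ y : Fin s → Bool, (F (Fin.cons true y) + F (Fin.cons false y)) := by
  rw [← (Fin.consEquiv fun _ : Fin (s + 1) => Bool).sum_comp, Fintype.sum_prod_type_right]
  refine Finset.sum_congr rfl fun y _ => ?_
  rw [Fintype.sum_bool]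
  rfl

/-- The number of solutions. -/
def solutionCount {s : ℕ} (g : (Fin s → Bool) → Bool) : ℕ :=
  (Finset.univ.filter fun y => g y = true).card

lemma sum_marked {s : ℕ} {a : ℝ} (h0 : 0 ≤ a) (h1 : a ≤ 1) (g : (Fin s → Bool) → Bool) :
    ∑ x, (if marked g x then prepared (searchParam s a) x ^ 2 else 0) =
      solutionCount g / 2 ^ s * a := by
  rw [sum_cons]
  simp only [marked, Fin.cons_succ, Fin.cons_zero, Bool.and_true, Bool.and_false,
    prepared_cons_sq h0 h1, if_true, solutionCount]
  rw [Finset.card_filter]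
  push_cast
  rw [Finset.sum_div, Finset.sum_mul]
  refine Finset.sum_congr rfl fun y _ => ?_
  split_ifs <;> simp
  ring

lemma sum_prepared_sq {s : ℕ} {a : ℝ} (h0 : 0 ≤ a) (h1 : a ≤ 1) :
    ∑ x, prepared (searchParam s a) x ^ 2 = 1 := by
  rw [sum_cons]
  simp only [prepared_cons_sq h0 h1, if_true, Bool.false_eq_true, if_false, ← add_mul]
  simp

lemma sum_unmarked {s : ℕ} {a : ℝ} (h0 : 0 ≤ a) (h1 : a ≤ 1) (g : (Fin s → Bool) → Bool) :
    ∑ x, (if marked g x then 0 else prepared (searchParam s a) x ^ 2) =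
      1 - solutionCount g / 2 ^ s * a := by
  rw [← sum_marked h0 h1 g, ← sum_prepared_sq h0 h1, ← Finset.sum_sub_distrib]
  refine Finset.sum_congr rfl fun y _ => ?_
  split_ifs <;> simp

lemma solutionCount_le {s : ℕ} (g : (Fin s → Bool) → Bool) : solutionCount g ≤ 2 ^ s := by
  refine (Finset.card_filter_le _ _).trans_eq ?_
  simp

/-- The angle of the amplification. -/
noncomputable def searchAngle {s : ℕ} (a : ℝ) (g : (Fin s → Bool) → Bool) : ℝ :=
  Real.arcsin √(solutionCount g / 2 ^ s * a)

lemma sin_searchAngle {s : ℕ} {a : ℝ} (h0 : 0 ≤ a) (h1 : a ≤ 1) (g : (Fin s → Bool) → Bool) :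
    Real.sin (searchAngle a g) = √(solutionCount g / 2 ^ s * a) := by
  refine Real.sin_arcsin ?_ ?_
  · linarith [Real.sqrt_nonneg (solutionCount g / 2 ^ s * a)]
  · rw [Real.sqrt_le_one]
    have : (solutionCount g : ℝ) / 2 ^ s ≤ 1 := by
      rw [div_le_one (by positivity)]
      exact_mod_cast solutionCount_le g
    exact mul_le_one₀ this h0 h1

lemma sin_sq_searchAngle {s : ℕ} {a : ℝ} (h0 : 0 ≤ a) (h1 : a ≤ 1) (g : (Fin s → Bool) → Bool) :
    Real.sin (searchAngle a g) ^ 2 = solutionCount g / 2 ^ s * a := by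
  rw [sin_searchAngle h0 h1, Real.sq_sqrt (by positivity)]

lemma cos_sq_searchAngle {s : ℕ} {a : ℝ} (h0 : 0 ≤ a) (h1 : a ≤ 1) (g : (Fin s → Bool) → Bool) :
    Real.cos (searchAngle a g) ^ 2 = 1 - solutionCount g / 2 ^ s * a := by
  rw [← sin_sq_searchAngle h0 h1, ← Real.sin_sq_add_cos_sq (searchAngle a g)]; ring

/-- The part of the state that survives rounds of `1, 2, 4, …` amplifications without detection of
a marked configuration. -/
noncomputable def survivor {s : ℕ} (a : ℝ) (g : (Fin s → Bool) → Bool) :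
    ℕ → (Fin (s + 1) → Bool) → ℝ
  | 0 => unmarked (marked g) (prepared (searchParam s a))
  | r + 1 => unmarked (marked g) ((amplify (searchParam s a) (marked g))^[2 ^ r] (survivor a g r))

/-- Projection to the unmarked part resets the angle to zero, so batches do not interfere: `2 ^ r`
rounds rotate by `2 ^ (r + 1) * θ` and contribute one cosine. -/
lemma survivor_eq {s : ℕ} {a : ℝ} (h0 : 0 ≤ a) (h1 : a ≤ 1) (g : (Fin s → Bool) → Bool) (r : ℕ) :
    survivor a g r = fun x => (∏ i ∈ Finset.range r, Real.cos (2 ^ (i + 1) * searchAngle a g)) *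
      unmarked (marked g) (prepared (searchParam s a)) x := by
  induction r with
  | zero => funext x; simp [survivor]
  | succ r ih =>
    rw [survivor, ih, amplify_iterate (searchParam_mem h0 h1) (marked g)
      (θ := searchAngle a g)]
    · rw [Finset.prod_range_succ]
      push_cast
      simp only [pow_succ' (2 : ℝ) r]
    · rw [sum_marked h0 h1, sin_sq_searchAngle h0 h1]
    · rw [sum_unmarked h0 h1, cos_sq_searchAngle h0 h1]

/-- The factor for `i = 0` is the norm `cos θ` left by the detection that precedes all
amplification. -/
lemma sum_survivor_sq {s : ℕ} {a : ℝ} (h0 : 0 ≤ a) (h1 : a ≤ 1) (g : (Fin s → Bool) → Bool)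
    (r : ℕ) : ∑ x, survivor a g r x ^ 2 =
      (∏ i ∈ Finset.range (r + 1), Real.cos (2 ^ i * searchAngle a g)) ^ 2 := by
  rw [survivor_eq h0 h1, Finset.prod_range_succ', mul_pow, pow_zero, one_mul,
    cos_sq_searchAngle h0 h1, ← sum_unmarked h0 h1 g, Finset.mul_sum]
  refine Finset.sum_congr rfl fun x _ => ?_
  rw [mul_pow]
  congr 1
  unfold unmarked
  split_ifs <;> simp

lemma prod_cos_mul_sin (θ : ℝ) (r : ℕ) :
    (2 ^ r * Real.sin θ) * ∏ i ∈ Finset.range r, Real.cos (2 ^ i * θ) = Real.sin (2 ^ r * θ) := by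
  induction r with
  | zero => simp
  | succ r ih =>
    rw [Finset.prod_range_succ, pow_succ', show (2 : ℝ) * 2 ^ r * θ = 2 * (2 ^ r * θ) by ring,
      Real.sin_two_mul, ← ih]
    ring

/-- Without solutions the whole state survives. -/
lemma survivor_of_no_solution {s : ℕ} {a : ℝ} (h0 : 0 ≤ a) (h1 : a ≤ 1)
    {g : (Fin s → Bool) → Bool} (hg : solutionCount g = 0) (r : ℕ) :
    ∑ x, survivor a g r x ^ 2 = 1 := by
  rw [sum_survivor_sq h0 h1]
  simp [searchAngle, hg]

/-- Since `π ≤ 4`, the sine is at most `2 ^ (-r)`, and the assumption on `r` keeps the quantity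
below the cap. This is what determines how many doublings a run for `j` solutions needs. -/
lemma rotParam_eq {r s j : ℕ} (hj : 2 ^ s ≤ 4 ^ r * j) :
    rotParam r s j = 2 ^ s / j * Real.sin (Real.pi / 2 ^ (r + 2)) ^ 2 := by
  refine min_eq_right ?_
  have hj0 : (0 : ℝ) < j := by
    rcases Nat.eq_zero_or_pos j with h | h
    · subst h; simp at hj
    · exact_mod_cast h
  have hj' : (2 : ℝ) ^ s ≤ 4 ^ r * j := by exact_mod_cast hj
  have h1 : Real.sin (Real.pi / 2 ^ (r + 2)) ≤ 1 / 2 ^ r := by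
    refine (Real.sin_le (by positivity)).trans ?_
    rw [div_le_div_iff₀ (by positivity) (by positivity), pow_add]
    have := Real.pi_le_four
    have h2 : (0 : ℝ) < 2 ^ r := by positivity
    nlinarith
  have h2 : 0 ≤ Real.sin (Real.pi / 2 ^ (r + 2)) := by
    refine Real.sin_nonneg_of_nonneg_of_le_pi (by positivity) (div_le_self Real.pi_pos.le ?_)
    exact one_le_pow₀ (by norm_num)
  calc 2 ^ s / j * Real.sin (Real.pi / 2 ^ (r + 2)) ^ 2
      ≤ (4 ^ r * j) / j * (1 / 2 ^ r) ^ 2 := by gcongr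
    _ = 1 := by
      rw [mul_div_assoc, div_self hj0.ne', mul_one, div_pow, one_pow, ← pow_mul, mul_comm r 2,
        pow_mul]
      norm_num

/-- The marked weight is the fraction of solutions times the weight of the auxiliary bit, and the
latter is chosen so that `2 ^ s` cancels. -/
lemma sin_searchAngle_rotParam {r s j : ℕ} (hj : 2 ^ s ≤ 4 ^ r * j) (g : (Fin s → Bool) → Bool) :
    Real.sin (searchAngle (rotParam r s j) g) =
      √(solutionCount g / j) * Real.sin (Real.pi / 2 ^ (r + 2)) := by
  have h2 : 0 ≤ Real.sin (Real.pi / 2 ^ (r + 2)) := by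
    refine Real.sin_nonneg_of_nonneg_of_le_pi (by positivity) (div_le_self Real.pi_pos.le ?_)
    exact one_le_pow₀ (by norm_num)
  rw [sin_searchAngle (rotParam_nonneg _ _ _) (rotParam_le_one _ _ _), rotParam_eq hj,
    ← Real.sqrt_sq h2, ← Real.sqrt_mul (by positivity)]
  congr 1
  rw [Real.sq_sqrt (by positivity)]
  field_simp

/-- With exactly `j` solutions, nothing survives. -/
lemma survivor_of_exact {r s j : ℕ} (hj : 2 ^ s ≤ 4 ^ r * j) (hj0 : 1 ≤ j)
    {g : (Fin s → Bool) → Bool} (hg : solutionCount g = j) :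
    ∑ x, survivor (rotParam r s j) g (r + 1) x ^ 2 = 0 := by
  have hs := sin_searchAngle_rotParam hj g
  have h1 : (solutionCount g : ℝ) / j = 1 := by
    rw [hg]; exact div_self (by positivity)
  rw [h1, Real.sqrt_one, one_mul] at hs
  have hθ : searchAngle (rotParam r s j) g = Real.pi / 2 ^ (r + 2) := by
    have h4 : (4 : ℝ) ≤ 2 ^ (r + 2) := by
      rw [pow_add]; have : (1 : ℝ) ≤ 2 ^ r := one_le_pow₀ (by norm_num)
      linarith
    have hle : Real.pi / 2 ^ (r + 2) ≤ Real.pi / 2 :=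
      div_le_div_of_nonneg_left Real.pi_pos.le (by norm_num) (by linarith)
    refine Real.injOn_sin ⟨Real.neg_pi_div_two_le_arcsin _, Real.arcsin_le_pi_div_two _⟩
      ⟨?_, hle⟩ hs
    have : 0 ≤ Real.pi / 2 ^ (r + 2) := by positivity
    linarith [Real.pi_pos]
  -- The last factor of the product is `cos (2 ^ (r + 1) * π / 2 ^ (r + 2)) = cos (π / 2)`.
  rw [sum_survivor_sq (rotParam_nonneg _ _ _) (rotParam_le_one _ _ _), hθ,
    Finset.prod_eq_zero (i := r + 1) (by simp), zero_pow two_ne_zero]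
  rw [← Real.cos_pi_div_two]
  congr 1
  rw [pow_succ (2 : ℝ) (r + 1)]
  field_simp

/-- With at least `j` solutions, at most a quarter survives. -/
lemma survivor_le_quarter {r s j : ℕ} (hj : 2 ^ s ≤ 4 ^ r * j) (hj0 : 1 ≤ j)
    {g : (Fin s → Bool) → Bool} (hg : j ≤ solutionCount g) :
    ∑ x, survivor (rotParam r s j) g (r + 1) x ^ 2 ≤ 1 / 4 := by
  have hs := sin_searchAngle_rotParam hj g
  rw [sum_survivor_sq (rotParam_nonneg _ _ _) (rotParam_le_one _ _ _)]
  have key := prod_cos_mul_sin (searchAngle (rotParam r s j) g) (r + 2)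
  have hj' : (0 : ℝ) < j := by exact_mod_cast hj0
  have h1 : 1 ≤ √((solutionCount g : ℝ) / j) := by
    rw [Real.one_le_sqrt, one_le_div hj']
    exact_mod_cast hg
  have h4 : (4 : ℝ) ≤ 2 ^ (r + 2) := by
    rw [pow_add]; have : (1 : ℝ) ≤ 2 ^ r := one_le_pow₀ (by norm_num)
    linarith
  -- Jordan's inequality bounds the sine below by `2 / 2 ^ (r + 2)`, so the multiplier in `key` is
  -- at least 2 while the right-hand side of `key` is at most 1 in absolute value.
  have h2 : 2 / Real.pi * (Real.pi / 2 ^ (r + 2)) ≤ Real.sin (Real.pi / 2 ^ (r + 2)) :=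
    Real.mul_le_sin (by positivity)
      (div_le_div_of_nonneg_left Real.pi_pos.le (by norm_num) (by linarith))
  have h3 : 2 / Real.pi * (Real.pi / 2 ^ (r + 2)) = 2 / 2 ^ (r + 2) := by
    have := Real.pi_pos.ne'
    field_simp
  rw [h3] at h2
  have h5 : 2 ≤ 2 ^ (r + 2) * Real.sin (searchAngle (rotParam r s j) g) := by
    rw [hs]
    rw [div_le_iff₀ (by positivity)] at h2
    have h0 : 0 ≤ Real.sin (Real.pi / 2 ^ (r + 2)) * 2 ^ (r + 2) := by linarith
    nlinarith
  generalize ∏ i ∈ Finset.range (r + 2), Real.cos (2 ^ i * searchAngle (rotParam r s j) g) = T at *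
  generalize 2 ^ (r + 2) * Real.sin (searchAngle (rotParam r s j) g) = c at *
  have h6 : (c * T) ^ 2 ≤ 1 := by
    rw [key]; exact Real.sin_sq_le_one _
  rw [mul_pow] at h6
  have h7 : 4 ≤ c ^ 2 := by nlinarith
  nlinarith [sq_nonneg T]


/-! ### Layout of the qubits -/

/-- Qubit `i` of search register `j`. -/
def xAddr (l s j i : ℕ) : ℕ := l + 4 * (j * (s + 1) + i)

/-- Flag `i`. -/
def flagAddr (l i : ℕ) : ℕ := l + 4 * i + 1

/-- Qubit `t` of the workspace. -/
def workAddr (l t : ℕ) : ℕ := l + 4 * t + 2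

/-- The output qubit. -/
def outAddr (l : ℕ) : ℕ := l + 3

/-- Where the nodes of the programs on search register `j` are kept. -/
def searchMap (l s j i : ℕ) : ℕ :=
  if i < l then i else if i < l + 1 + s then xAddr l s j (i - l) else workAddr l (i - (l + 1 + s))

/-- Where the nodes of the program on the first `k` flags are kept. -/
def flagMap (l k i : ℕ) : ℕ := if i < k then flagAddr l i else workAddr l (i - k)

/-- Above the input, the address minus `l` has residue 0, 1, 2 or 3 modulo 4 for registers, flags,
workspace and output. All disjointness facts follow from this, and each kind has an unlimited
supply. -/
lemma searchMap_injective (l s j : ℕ) : Function.Injective (searchMap l s j) := by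
  intro a b h
  simp only [searchMap, xAddr, workAddr] at h
  generalize j * (s + 1) = t at h
  split_ifs at h <;> omega

lemma flagMap_injective (l k : ℕ) : Function.Injective (flagMap l k) := by
  intro a b h
  simp only [flagMap, flagAddr, workAddr] at h
  split_ifs at h <;> omega

lemma searchMap_ne_flagAddr (l s j i c : ℕ) : searchMap l s j i ≠ flagAddr l c := by
  simp only [searchMap, xAddr, workAddr, flagAddr]
  generalize j * (s + 1) = t
  split_ifs <;> omega

lemma flagMap_ne_outAddr (l k i : ℕ) : flagMap l k i ≠ outAddr l := by
  simp only [flagMap, workAddr, flagAddr, outAddr]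
  split_ifs <;> omega

lemma xAddr_ne_flagAddr (l s j i c : ℕ) : xAddr l s j i ≠ flagAddr l c := by
  simp only [xAddr, flagAddr]; omega

lemma xAddr_ne_workAddr (l s j i c : ℕ) : xAddr l s j i ≠ workAddr l c := by
  simp only [xAddr, workAddr]; omega

lemma xAddr_ne_outAddr (l s j i : ℕ) : xAddr l s j i ≠ outAddr l := by
  simp only [xAddr, outAddr]; omega

lemma flagAddr_ne_workAddr (l i c : ℕ) : flagAddr l i ≠ workAddr l c := by
  simp only [flagAddr, workAddr]; omega

lemma flagAddr_ne_outAddr (l i : ℕ) : flagAddr l i ≠ outAddr l := by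
  simp only [flagAddr, outAddr]; omega

lemma flagAddr_injective (l : ℕ) : Function.Injective (flagAddr l) := by
  intro a b h
  simp only [flagAddr] at h; omega

lemma xAddr_inj {l s j i j' i' : ℕ} (hi : i < s + 1) (hi' : i' < s + 1)
    (h : xAddr l s j i = xAddr l s j' i') : j = j' ∧ i = i' := by
  have h' : i + (s + 1) * j = i' + (s + 1) * j' := by
    simp only [xAddr] at h
    rw [mul_comm, mul_comm (s + 1) j']
    omega
  have h1 := congrArg (· / (s + 1)) h'
  have h2 := congrArg (· % (s + 1)) h'
  simp only [Nat.add_mul_div_left _ _ (Nat.succ_pos s), Nat.div_eq_of_lt hi, Nat.div_eq_of_lt hi',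
    zero_add, Nat.add_mul_mod_self_left, Nat.mod_eq_of_lt hi, Nat.mod_eq_of_lt hi'] at h1 h2
  exact ⟨h1, h2⟩

/-! ### The gates of the search -/

/-- The code of the preparation gate of qubit `i` in the run for `j + 1` solutions. -/
def prepCode (s j r i : ℕ) : ℕ × ℕ × ℕ := if i = 0 then (r + 1, s, j + 1) else (1, 0, 1)

/-- The preparation of search register `j`. -/
def prepList (l s j r : ℕ) : List RawGate :=
  (List.range (s + 1)).map fun i => Sum.inl (xAddr l s j i, prepCode s j r i)

/-- The program that tests whether a search register is nonzero. -/
def nonzeroProg (l s : ℕ) : Prog × ℕ := Prog.anyProg (l + 1 + s + 1) (l + 1 + s) l (s + 1)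

/-- One round of amplitude amplification, with the oracle `p`. -/
def amplifyList (p : Prog × ℕ) (l s j r : ℕ) : List RawGate :=
  Prog.signList (l + 1 + s + 1) (searchMap l s j) p.1 p.2 ++
    ((prepList l s j r).reverse ++
      (Prog.signList (l + 1 + s + 1) (searchMap l s j) (nonzeroProg l s).1 (nonzeroProg l s).2 ++
        prepList l s j r))

/-- Record in a flag whether the configuration of the search register is marked. -/
def detectList (p : Prog × ℕ) (l s j c : ℕ) : List RawGate :=
  Prog.copyList (l + 1 + s + 1) (searchMap l s j) p.1 p.2 (flagAddr l c)

/-- Rounds of `1, 2, …, 2 ^ (r + 1)` amplifications, each followed by detection. -/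
def searchList (p : Prog × ℕ) (l s j r : ℕ) : List RawGate :=
  prepList l s j r ++ detectList p l s j (j * (s + 3)) ++
    (List.range (r + 1)).flatMap fun i =>
      (List.range (2 ^ i)).flatMap (fun _ => amplifyList p l s j r) ++
        detectList p l s j (j * (s + 3) + i + 1)

/-- The searches for `1, …, K` solutions, followed by the disjunction of all flags. -/
def satList (p : Prog × ℕ) (l s K : ℕ) (ρ : ℕ → ℕ) : List RawGate :=
  (List.range K).flatMap (fun j => searchList p l s j (ρ j)) ++
    Prog.copyList (K * (s + 3) + 1) (flagMap l (K * (s + 3)))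
      (Prog.anyProg (K * (s + 3) + 1) (K * (s + 3)) 0 (K * (s + 3))).1
      (Prog.anyProg (K * (s + 3) + 1) (K * (s + 3)) 0 (K * (s + 3))).2 (outAddr l)

/-! ### Evolution of the state -/

/-- The workspace and the output qubit are zero. -/
def Clean (l : ℕ) (y : Config) : Prop := (∀ t, y (workAddr l t) = false) ∧ y (outAddr l) = false

/-- The first `c` flags are zero. -/
def FlagsZero (l c : ℕ) (y : Config) : Prop := ∀ i < c, y (flagAddr l i) = false

/-- The contents of search register `j`. -/
def register (l s j : ℕ) (y : Config) : Fin (s + 1) → Bool := fun i => y (xAddr l s j i)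

/-- As long as the first `c` flags are zero, the state is the product of `F` and of the state `v` of
search register `j`. -/
structure Tracks (l s j : ℕ) (F : Config → ℂ) (c : ℕ) (v : (Fin (s + 1) → Bool) → ℝ)
    (ψ : Config → ℂ) : Prop where
  clean : ∀ y, ψ y ≠ 0 → Clean l y
  agree : ∀ y, FlagsZero l c y → ψ y = F y * (v (register l s j y) : ℝ)

/-- The factor `F` does not depend on search register `j`, and it vanishes unless the input is `z`
and the workspace and the flags are zero. -/
structure Frame (l s j : ℕ) (z : Config) (F : Config → ℂ) : Prop where
  update : ∀ y (i : Fin (s + 1)) b, F (Function.update y (xAddr l s j i) b) = F y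
  input : ∀ y, F y ≠ 0 → ∀ q < l, y q = z q
  work : ∀ y, F y ≠ 0 → ∀ t, y (workAddr l t) = false
  flag : ∀ y, F y ≠ 0 → ∀ i, y (flagAddr l i) = false

section Track

variable {l s j : ℕ} {z : Config} {F : Config → ℂ} {c : ℕ} {v : (Fin (s + 1) → Bool) → ℝ}
  {ψ : Config → ℂ}

lemma Clean.of_update {y : Config} {q : ℕ} {b : Bool} (hw : ∀ t, q ≠ workAddr l t)
    (ho : q ≠ outAddr l) (h : Clean l (Function.update y q b)) : Clean l y := by
  refine ⟨fun t => ?_, ?_⟩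
  · rw [← h.1 t, Function.update_of_ne (hw t).symm]
  · rw [← h.2, Function.update_of_ne ho.symm]

lemma FlagsZero.update {y : Config} {q : ℕ} {b : Bool} (hq : ∀ i < c, q ≠ flagAddr l i)
    (h : FlagsZero l c y) : FlagsZero l c (Function.update y q b) := by
  intro i hi
  rw [Function.update_of_ne (hq i hi).symm, h i hi]

lemma register_update (y : Config) (i : Fin (s + 1)) (b : Bool) :
    register l s j (Function.update y (xAddr l s j i) b) =
      Function.update (register l s j y) i b := by
  funext k
  by_cases hk : k = i
  · subst hk; simp [register]
  · rw [Function.update_of_ne hk, register, register, Function.update_of_ne]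
    intro h
    exact hk (Fin.ext (xAddr_inj k.2 i.2 h).2)

/-- The gate touches no flag, workspace or output qubit, and `F` does not depend on the register, so
the gate acts on the factor `v` alone. -/
lemma Tracks.refl (hF : Frame l s j z F) (h : Tracks l s j F c v ψ) (i : Fin (s + 1))
    (r t k : ℕ) {p : Fin (s + 1) → ℝ} (hp : p i = rotParam r t k) :
    Tracks l s j F c (reflAt p i v)
      (RawGate.act ψ (Sum.inl (xAddr l s j i, r + 1, t, k))) := by
  constructor
  · intro y hy
    rw [act_refl] at hy
    obtain ⟨b, -, hb⟩ := Finset.exists_ne_zero_of_sum_ne_zero hy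
    exact (h.clean _ (right_ne_zero_of_mul hb)).of_update (xAddr_ne_workAddr l s j i)
      (xAddr_ne_outAddr l s j i)
  · intro y hy
    simp only [act_refl, reflAt, Complex.ofReal_sum, Complex.ofReal_mul, Finset.mul_sum]
    refine Finset.sum_congr rfl fun b _ => ?_
    rw [h.agree _ (hy.update fun k _ => xAddr_ne_flagAddr l s j i k), hF.update, register_update, hp]
    simp only [register]
    ring

lemma Tracks.reflList (hF : Frame l s j z F) {code : ℕ → ℕ × ℕ × ℕ} {p : Fin (s + 1) → ℝ}
    (hp : ∀ i : Fin (s + 1), ∃ r t k, code i = (r + 1, t, k) ∧ p i = rotParam r t k)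
    (L : List (Fin (s + 1))) (h : Tracks l s j F c v ψ) :
    Tracks l s j F c (reflList p L v)
      (runRaw (L.map fun i : Fin (s + 1) => Sum.inl (xAddr l s j i, code i)) ψ) := by
  induction L generalizing v ψ with
  | nil => exact h
  | cons i L ih =>
    obtain ⟨r, t, k, hc, hpi⟩ := hp i
    rw [List.map_cons, runRaw_cons, hc]
    exact ih (Tracks.refl hF h i r t k hpi)

lemma prepCode_spec (s j r : ℕ) (i : Fin (s + 1)) : ∃ r' t k, prepCode s j r i = (r' + 1, t, k) ∧
    searchParam s (rotParam r s (j + 1)) i = rotParam r' t k := by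
  refine Fin.cases ?_ (fun i => ?_) i
  · exact ⟨r, s, j + 1, by simp [prepCode], rfl⟩
  · refine ⟨0, 0, 1, by simp [prepCode], ?_⟩
    rw [rotParam_hadamard]; simp [searchParam]

lemma prepList_eq (l s j r : ℕ) : prepList l s j r =
    (List.finRange (s + 1)).map fun i : Fin (s + 1) =>
      (Sum.inl (xAddr l s j i, prepCode s j r i) : RawGate) := by
  rw [prepList, ← List.map_coe_finRange_eq_range, List.map_map]
  rfl

lemma Tracks.prep (hF : Frame l s j z F) (r : ℕ) (h : Tracks l s j F c v ψ) :
    Tracks l s j F c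
      (SatSearch.reflList (searchParam s (rotParam r s (j + 1))) (List.finRange (s + 1)) v)
      (runRaw (prepList l s j r) ψ) := by
  rw [prepList_eq]
  exact h.reflList hF (prepCode_spec s j r) _

lemma Tracks.unprep (hF : Frame l s j z F) (r : ℕ) (h : Tracks l s j F c v ψ) :
    Tracks l s j F c
      (SatSearch.reflList (searchParam s (rotParam r s (j + 1))) (List.finRange (s + 1)).reverse v)
      (runRaw (prepList l s j r).reverse ψ) := by
  rw [prepList_eq, ← List.map_reverse]
  exact h.reflList hF (prepCode_spec s j r) _

/-- On all configurations where `F` does not vanish, the program `p` computes `f`. -/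
def Computes (l s j : ℕ) (F : Config → ℂ) (p : Prog × ℕ) (f : (Fin (s + 1) → Bool) → Bool) : Prop :=
  ∀ y, F y ≠ 0 →
    Prog.exec (l + 1 + s + 1) (searchMap l s j) p.1 y (searchMap l s j p.2) = f (register l s j y)

/-- Where the workspace is not clean the program may compute something else, but there `F` vanishes
and the sign is irrelevant. -/
lemma Tracks.sign {p : Prog × ℕ} {f : (Fin (s + 1) → Bool) → Bool} (hp : Computes l s j F p f)
    (h : Tracks l s j F c v ψ) :
    Tracks l s j F c (signFlip f v)
      (runRaw (Prog.signList (l + 1 + s + 1) (searchMap l s j) p.1 p.2) ψ) := by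
  rw [Prog.runRaw_signList (searchMap_injective l s j)]
  constructor
  · intro y hy
    exact h.clean y (right_ne_zero_of_mul hy)
  · intro y hy
    simp only [h.agree y hy]
    by_cases hFy : F y = 0
    · simp [hFy]
    · rw [hp y hFy, signFlip]
      split_ifs <;> push_cast <;> ring

/-- Deferred measurement: a marked configuration moves to the branch where the new flag is set, so
the branch with flag zero keeps exactly the unmarked part. -/
lemma Tracks.detect (hF : Frame l s j z F) {p : Prog × ℕ} {f : (Fin (s + 1) → Bool) → Bool}
    (hp : Computes l s j F p f) (h : Tracks l s j F c v ψ) {c' : ℕ} (hc : c ≤ c') :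
    Tracks l s j F (c' + 1) (unmarked f v) (runRaw (detectList p l s j c') ψ) := by
  rw [detectList, Prog.runRaw_copyList (searchMap_injective l s j) _ _
    fun i => searchMap_ne_flagAddr l s j i c']
  constructor
  · intro y hy
    exact (h.clean _ hy).of_update (flagAddr_ne_workAddr l c') (flagAddr_ne_outAddr l c')
  · intro y hy
    have hyc : y (flagAddr l c') = false := hy c' (Nat.lt_succ_self _)
    have hz : FlagsZero l c y := fun i hi => hy i (by omega)
    -- The flag was unused before, so nothing with this flag set can flow back into the branch where
    -- it is zero.
    have hcancel : F (Function.update y (flagAddr l c') true) = 0 := by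
      by_contra hne
      have := hF.flag _ hne c'
      rw [Function.update_self] at this
      exact Bool.noConfusion this
    have htrue : ψ (Function.update y (flagAddr l c') true) = 0 := by
      rw [h.agree _ (hz.update fun i hi => (flagAddr_injective l).ne (by omega)), hcancel, zero_mul]
    simp only [hyc, Bool.false_xor]
    by_cases hFy : F y = 0
    · cases Prog.exec (l + 1 + s + 1) (searchMap l s j) p.1 y (searchMap l s j p.2)
      · have : Function.update y (flagAddr l c') false = y := by
          rw [← hyc, Function.update_eq_self]
        rw [this, h.agree y hz, hFy, zero_mul, zero_mul]
      · rw [htrue, hFy, zero_mul]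
    · rw [hp y hFy, unmarked]
      cases f (register l s j y)
      · have : Function.update y (flagAddr l c') false = y := by
          rw [← hyc, Function.update_eq_self]
        rw [this, h.agree y hz]
        simp
      · rw [htrue]; simp

lemma computes_nonzero (hF : Frame l s j z F) : Computes l s j F (nonzeroProg l s) nonzero := by
  intro y hy
  rw [Prog.exec_apply (searchMap_injective l s j)]
  · have h := (Prog.anyProg_spec (ι := l + 1 + s + 1) (z := l + 1 + s) (i := l) (k := s + 1)
      (v := fun i => y (searchMap l s j i)) (by omega) ?_ (by omega)).good.2
    · rw [nonzeroProg, h, Bool.eq_iff_iff, nonzero, decide_eq_true_eq, List.any_eq_true]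
      simp only [List.mem_range]
      constructor
      · rintro ⟨i, hi, hy⟩ h0
        have := congrFun h0 ⟨i, hi⟩
        simp only [register] at this
        simp only [searchMap, if_neg (show ¬ l + i < l by omega),
          if_pos (show l + i < l + 1 + s by omega), Nat.add_sub_cancel_left, this] at hy
        exact Bool.noConfusion hy
      · intro h0
        by_contra hne
        push Not at hne
        refine h0 (funext fun i => ?_)
        have := hne i i.2
        simp only [searchMap, if_neg (show ¬ l + (i : ℕ) < l by omega),
          if_pos (show l + (i : ℕ) < l + 1 + s by omega), Nat.add_sub_cancel_left] at this
        simpa [register] using this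
    · simp only [searchMap, if_neg (show ¬ l + 1 + s < l by omega), lt_irrefl, if_false]
      exact hF.work y hy _
  · intro i hi
    simp only [searchMap, if_neg (show ¬ i < l by omega), if_neg (show ¬ i < l + 1 + s by omega)]
    exact hF.work y hy _

lemma Tracks.amplify (hF : Frame l s j z F) {p : Prog × ℕ} {f : (Fin (s + 1) → Bool) → Bool}
    (hp : Computes l s j F p f) (r : ℕ) (h : Tracks l s j F c v ψ) :
    Tracks l s j F c (SatSearch.amplify (searchParam s (rotParam r s (j + 1))) f v)
      (runRaw (amplifyList p l s j r) ψ) := by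
  simp only [amplifyList, runRaw_append]
  exact (((h.sign hp).unprep hF r).sign (computes_nonzero hF)).prep hF r

lemma Tracks.amplify_iterate (hF : Frame l s j z F) {p : Prog × ℕ}
    {f : (Fin (s + 1) → Bool) → Bool} (hp : Computes l s j F p f) (r k : ℕ)
    (h : Tracks l s j F c v ψ) :
    Tracks l s j F c ((SatSearch.amplify (searchParam s (rotParam r s (j + 1))) f)^[k] v)
      (runRaw ((List.range k).flatMap fun _ => amplifyList p l s j r) ψ) := by
  induction k with
  | zero => exact h
  | succ k ih =>
    rw [List.range_succ, List.flatMap_append, runRaw_append, Function.iterate_succ_apply']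
    simpa using ih.amplify hF hp r

lemma Tracks.search (hF : Frame l s j z F) {p : Prog × ℕ} {g : (Fin s → Bool) → Bool}
    (hp : Computes l s j F p (marked g)) {r : ℕ} (h : Tracks l s j F (j * (s + 3)) zeroState ψ) :
    Tracks l s j F (j * (s + 3) + r + 2) (survivor (rotParam r s (j + 1)) g (r + 1))
      (runRaw (searchList p l s j r) ψ) := by
  simp only [searchList, runRaw_append]
  have h0 := (h.prep hF r).detect hF hp le_rfl
  generalize runRaw (detectList p l s j (j * (s + 3))) (runRaw (prepList l s j r) ψ) = ψ' at *
  have key : ∀ k, Tracks l s j F (j * (s + 3) + k + 1) (survivor (rotParam r s (j + 1)) g k)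
      (runRaw ((List.range k).flatMap fun i =>
      (List.range (2 ^ i)).flatMap (fun _ => amplifyList p l s j r) ++
        detectList p l s j (j * (s + 3) + i + 1)) ψ') := by
    intro k
    induction k with
    | zero => exact h0
    | succ k ih =>
      rw [List.range_succ, List.flatMap_append, runRaw_append, List.flatMap_singleton,
        runRaw_append]
      exact (ih.amplify_iterate hF hp r (2 ^ k)).detect hF hp (by omega)
  exact key (r + 1)

end Track

/-! ### The whole search -/

/-- The configuration agrees with `z` outside the first `J` search registers. -/
def Rest (l s : ℕ) (z : Config) (J : ℕ) (y : Config) : Prop :=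
  ∀ q, (∀ j < J, ∀ i < s + 1, xAddr l s j i ≠ q) → y q = z q

open Classical in
/-- The indicator of `Rest`. -/
noncomputable def restInd (l s : ℕ) (z : Config) (J : ℕ) (y : Config) : ℂ :=
  if Rest l s z J y then 1 else 0

/-- The product of states of the first `J` search registers. -/
noncomputable def productState (l s : ℕ) (z : Config) (vs : ℕ → (Fin (s + 1) → Bool) → ℝ) (J : ℕ)
    (y : Config) : ℂ :=
  restInd l s z J y * ∏ j ∈ Finset.range J, (vs j (register l s j y) : ℂ)

section Whole

variable {l s : ℕ} {z : Config}

lemma Rest.of_ne_zero {J : ℕ} {y : Config} (h : restInd l s z J y ≠ 0) : Rest l s z J y := by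
  by_contra hn
  exact h (if_neg hn)

lemma restInd_of {J : ℕ} {y : Config} (h : Rest l s z J y) : restInd l s z J y = 1 := if_pos h

lemma restInd_of_not {J : ℕ} {y : Config} (h : ¬ Rest l s z J y) : restInd l s z J y = 0 :=
  if_neg h

lemma Rest.work (hz : ∀ q, l ≤ q → z q = false) {J : ℕ} {y : Config} (h : Rest l s z J y) (t : ℕ) :
    y (workAddr l t) = false := by
  rw [h _ fun j _ i _ => xAddr_ne_workAddr l s j i t]
  exact hz _ (by unfold workAddr; omega)

lemma Rest.flag (hz : ∀ q, l ≤ q → z q = false) {J : ℕ} {y : Config} (h : Rest l s z J y) (t : ℕ) :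
    y (flagAddr l t) = false := by
  rw [h _ fun j _ i _ => xAddr_ne_flagAddr l s j i t]
  exact hz _ (by unfold flagAddr; omega)

lemma Rest.out (hz : ∀ q, l ≤ q → z q = false) {J : ℕ} {y : Config} (h : Rest l s z J y) :
    y (outAddr l) = false := by
  rw [h _ fun j _ i _ => xAddr_ne_outAddr l s j i]
  exact hz _ (by unfold outAddr; omega)

lemma rest_update {J j : ℕ} (hj : j < J) (y : Config) (i : Fin (s + 1)) (b : Bool) :
    Rest l s z J (Function.update y (xAddr l s j i) b) ↔ Rest l s z J y := by
  refine forall_congr' fun q => forall_congr' fun hq => ?_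
  rw [Function.update_of_ne (hq j hj i i.2).symm]

/-- This is the factor used during search `j`: it contains the finished registers, and it leaves
register `j` free by using the indicator for `j + 1` registers. -/
lemma frame_product (hz : ∀ q, l ≤ q → z q = false) (vs : ℕ → (Fin (s + 1) → Bool) → ℝ) (j : ℕ) :
    Frame l s j z fun y =>
      restInd l s z (j + 1) y * ∏ j' ∈ Finset.range j, (vs j' (register l s j' y) : ℂ) := by
  have hne : ∀ y, restInd l s z (j + 1) y *
      ∏ j' ∈ Finset.range j, (vs j' (register l s j' y) : ℂ) ≠ 0 → Rest l s z (j + 1) y :=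
    fun y hy => Rest.of_ne_zero (left_ne_zero_of_mul hy)
  refine ⟨fun y i b => ?_, fun y hy q hq => ?_, fun y hy => (hne y hy).work hz,
    fun y hy => (hne y hy).flag hz⟩
  · congr 1
    · by_cases h : Rest l s z (j + 1) y
      · rw [restInd_of h, restInd_of ((rest_update (Nat.lt_succ_self j) y i b).mpr h)]
      · rw [restInd_of_not h,
          restInd_of_not (mt (rest_update (Nat.lt_succ_self j) y i b).mp h)]
    · refine Finset.prod_congr rfl fun j' hj' => ?_
      congr 2
      funext k
      simp only [register]
      rw [Function.update_of_ne]
      intro h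
      have := (xAddr_inj k.2 i.2 h).1
      have := Finset.mem_range.mp hj'
      omega
  · exact hne y hy q fun j' _ i _ => by unfold xAddr; omega

/-- This splits off the zero state of the next register, which is the initial state of the next
search. -/
lemma rest_succ (hz : ∀ q, l ≤ q → z q = false) (J : ℕ) (y : Config) :
    Rest l s z J y ↔ Rest l s z (J + 1) y ∧ register l s J y = fun _ => false := by
  constructor
  · refine fun h => ⟨fun q hq => h q fun j hj => hq j (by omega), funext fun i => ?_⟩
    rw [register, h _ fun j hj i' hi' h' => ?_]
    · exact hz _ (by unfold xAddr; omega)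
    · have := (xAddr_inj hi' i.2 h').1; omega
  · rintro ⟨h, hr⟩ q hq
    by_cases hJ : ∃ i : Fin (s + 1), xAddr l s J i = q
    · obtain ⟨i, rfl⟩ := hJ
      have := congrFun hr i
      simp only [register] at this
      rw [this, hz _ (by unfold xAddr; omega)]
    · refine h q fun j hj i hi h' => ?_
      rcases Nat.lt_succ_iff_lt_or_eq.mp hj with hj | rfl
      · exact hq j hj i hi h'
      · exact hJ ⟨⟨i, hi⟩, h'⟩

lemma basisState_eq (z : Config) (vs : ℕ → (Fin (s + 1) → Bool) → ℝ) :
    basisState z = productState l s z vs 0 := by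
  funext y
  simp only [basisState, productState, restInd, Finset.range_zero, Finset.prod_empty, mul_one]
  congr 1
  refine propext ⟨?_, fun h => funext fun q => h q (by simp)⟩
  rintro rfl
  exact fun _ _ => rfl

/-- The state after all searches, on the configurations whose flags are zero. -/
lemma search_state (hz : ∀ q, l ≤ q → z q = false) {p : Prog × ℕ} {g : (Fin s → Bool) → Bool}
    (hp : ∀ j F, Frame l s j z F → Computes l s j F p (marked g)) {ρ : ℕ → ℕ} {K : ℕ}
    (hρ : ∀ j < K, ρ j ≤ s) :
    let ψ := runRaw ((List.range K).flatMap fun j => searchList p l s j (ρ j)) (basisState z)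
    (∀ y, ψ y ≠ 0 → Clean l y) ∧ ∀ y, FlagsZero l (K * (s + 3)) y →
      ψ y = productState l s z
        (fun j => survivor (rotParam (ρ j) s (j + 1)) g (ρ j + 1)) K y := by
  set vs : ℕ → (Fin (s + 1) → Bool) → ℝ :=
    fun j => survivor (rotParam (ρ j) s (j + 1)) g (ρ j + 1) with hvs
  induction K with
  | zero =>
    simp only [List.range_zero, List.flatMap_nil, runRaw_nil]
    rw [basisState_eq (l := l) z vs]
    refine ⟨fun y hy => ?_, fun y _ => rfl⟩
    have h := Rest.of_ne_zero (left_ne_zero_of_mul hy)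
    exact ⟨h.work hz, h.out hz⟩
  | succ K ih =>
    obtain ⟨h1, h2⟩ := ih fun j hj => hρ j (by omega)
    simp only [List.range_succ, List.flatMap_append, List.flatMap_singleton, runRaw_append]
    generalize runRaw ((List.range K).flatMap fun j => searchList p l s j (ρ j)) (basisState z) = ψ
      at *
    have hF := frame_product hz vs K
    have h3 : Tracks l s K (fun y =>
        restInd l s z (K + 1) y * ∏ j' ∈ Finset.range K, (vs j' (register l s j' y) : ℂ))
        (K * (s + 3)) zeroState ψ := by
      refine ⟨h1, fun y hy => ?_⟩
      rw [h2 y hy, productState]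
      have e : restInd l s z K y = restInd l s z (K + 1) y * (zeroState (register l s K y) : ℝ) := by
        by_cases hr : Rest l s z K y
        · obtain ⟨hr', h0⟩ := (rest_succ hz K y).mp hr
          rw [restInd_of hr, restInd_of hr', zeroState, if_pos h0]
          simp
        · rw [restInd_of_not hr, zeroState]
          by_cases h0 : register l s K y = fun _ => false
          · rw [restInd_of_not fun h => hr ((rest_succ hz K y).mpr ⟨h, h0⟩), zero_mul]
          · simp [h0]
      rw [e]
      ring
    have h4 := h3.search hF (hp K _ hF) (r := ρ K)
    refine ⟨h4.clean, fun y hy => ?_⟩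
    rw [h4.agree y fun i hi => hy i ?_]
    · rw [productState, Finset.prod_range_succ]
      ring
    -- A search uses `ρ K + 2 ≤ s + 2` flags, within the block of `s + 3` reserved for it.
    · have := hρ K (by omega)
      rw [add_mul]; omega

lemma exec_anyFlag {k : ℕ} {y : Config} (hy : ∀ t, y (workAddr l t) = false) :
    Prog.exec (k + 1) (flagMap l k) (Prog.anyProg (k + 1) k 0 k).1 y
      (flagMap l k (Prog.anyProg (k + 1) k 0 k).2) =
      (List.range k).any fun i => y (flagAddr l i) := by
  rw [Prog.exec_apply (flagMap_injective l k)]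
  · rw [(Prog.anyProg_spec (ι := k + 1) (z := k) (i := 0) (k := k)
      (v := fun i => y (flagMap l k i)) (by omega) ?_ (by omega)).good.2]
    · refine Prog.any_range_congr fun i hi => ?_
      simp [flagMap, hi]
    · simp only [flagMap, lt_irrefl, if_false]
      exact hy _
  · intro i hi
    simp only [flagMap, if_neg (show ¬ i < k by omega)]
    exact hy _

/-- The final state on the configurations whose output is zero. -/
lemma satList_state (hz : ∀ q, l ≤ q → z q = false) {p : Prog × ℕ} {g : (Fin s → Bool) → Bool}
    (hp : ∀ j F, Frame l s j z F → Computes l s j F p (marked g)) {ρ : ℕ → ℕ} {K : ℕ}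
    (hρ : ∀ j < K, ρ j ≤ s) (y : Config) :
    (if y (outAddr l) = false then runRaw (satList p l s K ρ) (basisState z) y else 0) =
      productState l s z (fun j => survivor (rotParam (ρ j) s (j + 1)) g (ρ j + 1)) K y := by
  obtain ⟨h1, h2⟩ := search_state hz hp hρ
  set vs : ℕ → (Fin (s + 1) → Bool) → ℝ :=
    fun j => survivor (rotParam (ρ j) s (j + 1)) g (ρ j + 1)
  have h0 : ∀ y, ¬ Rest l s z K y → productState l s z vs K y = 0 := by
    intro y hy
    rw [productState, restInd_of_not hy, zero_mul]
  rw [satList, runRaw_append, Prog.runRaw_copyList (flagMap_injective l _) _ _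
    (flagMap_ne_outAddr l _)]
  split_ifs with hout
  · generalize runRaw ((List.range K).flatMap fun j => searchList p l s j (ρ j)) (basisState z) = ψ
      at *
    simp only [hout, Bool.false_xor]
    by_cases hw : ∀ t, y (workAddr l t) = false
    · rw [exec_anyFlag hw]
      by_cases hfl : FlagsZero l (K * (s + 3)) y
      · rw [← h2 y hfl]
        congr 1
        have : ((List.range (K * (s + 3))).any fun i => y (flagAddr l i)) = false := by
          rw [List.any_eq_false]
          intro i hi
          rw [hfl i (List.mem_range.mp hi)]
          simp
        rw [this, ← hout, Function.update_eq_self]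
      · have : ((List.range (K * (s + 3))).any fun i => y (flagAddr l i)) = true := by
          unfold FlagsZero at hfl
          push Not at hfl
          obtain ⟨i, hi, hy⟩ := hfl
          rw [List.any_eq_true]
          exact ⟨i, List.mem_range.mpr hi, by simpa using hy⟩
        rw [this, h0 y fun h => hfl fun i _ => h.flag hz i]
        -- With a flag set, the amplitude comes from a configuration whose output qubit was already
        -- 1 before the final disjunction, and such configurations have amplitude zero.
        by_contra hne
        have := (h1 _ hne).2
        rw [Function.update_self] at this
        exact Bool.noConfusion this
    · rw [h0 y fun h => hw (h.work hz)]
      by_contra hne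
      refine hw fun t => ?_
      rw [← (h1 _ hne).1 t, Function.update_of_ne]
      simp only [workAddr, outAddr]; omega
  · exact (h0 y fun h => hout (h.out hz)).symm

/-- The norm of a product state. -/
lemma sum_productState {w K : ℕ} (hw : l + 4 * (K * (s + 1)) ≤ w) (hz : ∀ q, w ≤ q → z q = false)
    (vs : ℕ → (Fin (s + 1) → Bool) → ℝ) :
    ∑ y : Fin w → Bool, ‖productState l s z vs K (extend y)‖ ^ 2 =
      ∏ j ∈ Finset.range K, ∑ x, vs j x ^ 2 := by
  have hA : ∀ p : Fin K × Fin (s + 1), xAddr l s p.1 p.2 < w := by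
    rintro ⟨j, i⟩
    refine lt_of_lt_of_le ?_ hw
    have : (j : ℕ) * (s + 1) + (s + 1) ≤ K * (s + 1) := by
      calc (j : ℕ) * (s + 1) + (s + 1) = (j + 1) * (s + 1) := by ring
        _ ≤ K * (s + 1) := Nat.mul_le_mul_right _ j.2
    have := i.2
    simp only [xAddr]
    omega
  set A : Fin K × Fin (s + 1) → Fin w := fun p => ⟨xAddr l s p.1 p.2, hA p⟩ with hAdef
  have hAinj : Function.Injective A := by
    rintro ⟨j, i⟩ ⟨j', i'⟩ h
    have := xAddr_inj i.2 i'.2 (congrArg Fin.val h)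
    exact Prod.ext (Fin.ext this.1) (Fin.ext this.2)
  -- Only configurations determined by the contents of the `K` registers contribute. Indexing by
  -- these contents turns the sum of products into a product of sums.
  set e : (Fin K → Fin (s + 1) → Bool) → Fin w → Bool :=
    fun x => Function.extend A (fun p => x p.1 p.2) (fun q => z q) with he
  have heA : ∀ x p, e x (A p) = x p.1 p.2 := fun x p => hAinj.extend_apply _ _ p
  have heinj : Function.Injective e := by
    intro x x' h
    funext j i
    rw [← heA x (j, i), h, heA]
  have hrest : ∀ x, Rest l s z K (extend (e x)) := by
    intro x q hq
    by_cases hqw : q < w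
    · rw [show extend (e x) q = e x ⟨q, hqw⟩ from extend_apply _ ⟨q, hqw⟩]
      refine Function.extend_apply' _ _ _ ?_
      rintro ⟨⟨j, i⟩, h⟩
      exact hq j j.2 i i.2 (congrArg Fin.val h)
    · rw [extend_of_le _ (by omega), hz q (by omega)]
  rw [← Fintype.sum_of_injective e heinj
    (fun x => ∏ j : Fin K, vs j (x j) ^ 2)]
  · rw [Finset.prod_range, Finset.prod_univ_sum, Fintype.piFinset_univ]
  · intro y hy
    rw [productState, restInd_of_not, zero_mul, norm_zero, zero_pow two_ne_zero]
    intro hr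
    refine hy ⟨fun j i => y (A (j, i)), funext fun q => ?_⟩
    by_cases hq : ∃ p, A p = q
    · obtain ⟨p, rfl⟩ := hq
      exact heA (fun j i => y (A (j, i))) p
    · rw [he]
      simp only
      rw [Function.extend_apply' _ _ _ hq, ← extend_apply y q, hr]
      intro j hj i hi h
      exact hq ⟨(⟨j, hj⟩, ⟨i, hi⟩), Fin.ext h⟩
  · intro x
    rw [productState, restInd_of (hrest x), one_mul, ← Complex.ofReal_prod, Complex.norm_real,
      Real.norm_eq_abs, sq_abs, Finset.prod_range, ← Finset.prod_pow]
    refine Finset.prod_congr rfl fun j _ => ?_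
    congr 2
    funext i
    rw [register, ← heA x (j, i)]
    exact (extend_apply (e x) (A (j, i))).symm

end Whole


/-! ### The family of circuits -/

/-- The number of doublings for `j` solutions among `2 ^ s`: a search for the least `r` with
`2 ^ s ≤ 4 ^ r * j`. -/
def roundsAux (s j : ℕ) : ℕ → ℕ
  | 0 => 0
  | i + 1 => if 4 ^ roundsAux s j i * j < 2 ^ s then roundsAux s j i + 1 else roundsAux s j i

/-- The least `r` with `2 ^ s ≤ 4 ^ r * j`. -/
def rounds (s j : ℕ) : ℕ := roundsAux s j s

/-- The first clause is minimality, used for the size; the second says that the search has stopped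
or has counted up to `i`, and for `i = s` either alternative suffices. -/
lemma roundsAux_spec (s j i : ℕ) :
    (roundsAux s j i = 0 ∨ ∃ r, roundsAux s j i = r + 1 ∧ 4 ^ r * j < 2 ^ s) ∧
      (2 ^ s ≤ 4 ^ roundsAux s j i * j ∨ roundsAux s j i = i) ∧ roundsAux s j i ≤ i := by
  induction i with
  | zero => simp [roundsAux]
  | succ i ih =>
    obtain ⟨h1, h2, h3⟩ := ih
    rw [roundsAux]
    split_ifs with h
    · exact ⟨Or.inr ⟨_, rfl, h⟩, Or.inr (by omega), by omega⟩
    · exact ⟨h1, Or.inl (not_lt.mp h), by omega⟩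

lemma rounds_le (s j : ℕ) : rounds s j ≤ s := (roundsAux_spec s j s).2.2

lemma le_four_pow_rounds {j : ℕ} (s : ℕ) (hj : 1 ≤ j) : 2 ^ s ≤ 4 ^ rounds s j * j := by
  rcases (roundsAux_spec s j s).2.1 with h | h
  · exact h
  · rw [rounds, h]
    calc 2 ^ s ≤ 4 ^ s := Nat.pow_le_pow_left (by norm_num) s
      _ ≤ 4 ^ s * j := Nat.le_mul_of_pos_right _ hj

/-- If `r + 1` is the number of doublings, then `r` was too small, so `2 ^ r ≤ √(2 ^ s / j)`. With
no doubling at all, `j ≤ 2 ^ s` is needed. -/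
lemma two_pow_rounds_le {s j : ℕ} (hj : 1 ≤ j) (hjs : j ≤ 2 ^ s) :
    (2 : ℝ) ^ rounds s j ≤ 2 * (√(2 ^ s) * (1 / √j)) := by
  have hj0 : (0 : ℝ) < j := by exact_mod_cast hj
  rw [show √((2 : ℝ) ^ s) * (1 / √j) = √(2 ^ s / j) by
    rw [Real.sqrt_div (by positivity)]; ring]
  rcases (roundsAux_spec s j s).1 with h | ⟨r, h, hr⟩
  · rw [rounds, h, pow_zero]
    have : 1 ≤ √((2 : ℝ) ^ s / j) := by
      rw [Real.one_le_sqrt, one_le_div hj0]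
      exact_mod_cast hjs
    linarith
  · rw [rounds, h, pow_succ, mul_comm]
    refine mul_le_mul_of_nonneg_left (Real.le_sqrt_of_sq_le ?_) (by norm_num)
    rw [le_div_iff₀ hj0, ← pow_mul, mul_comm r 2, pow_mul]
    norm_num
    exact_mod_cast hr.le

/-- The number of search bits. -/
def searchBits (n m : ℕ) : ℕ := min n (2 * m)

/-- The number of searches. -/
def runCount (n m k : ℕ) : ℕ := min k (2 ^ searchBits n m)

/-- The raw gates of the circuit for parameters `n`, `m` and `k`. -/
def satRaw (n m k : ℕ) : List RawGate :=
  satList (Prog.oracleProg n m (searchBits n m)) (BCircuit.encLen n m) (searchBits n m)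
    (runCount n m k) fun j => rounds (searchBits n m) (j + 1)

/-- The quantum circuit for parameters `n`, `m` and `k`. -/
noncomputable def satCircuit (n m k : ℕ) : QCircuit (BCircuit.encLen n m) :=
  ofRaw (BCircuit.encLen n m)
    (BCircuit.encLen n m + 4 * (runCount n m k * (searchBits n m + 1)))
    (outAddr (BCircuit.encLen n m)) (satRaw n m k)

/-! ### Correctness -/

/-- The value of a circuit as a function of finitely many search bits. -/
def searchVal {n m : ℕ} (C : BCircuit n m) (Y : Fin (searchBits n m) → Bool) : Bool :=
  Prog.circuitVal C (extend Y)

lemma computes_oracle {n m : ℕ} (hm : 1 ≤ m) (C : BCircuit n m) (j : ℕ) (F : Config → ℂ)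
    (hF : Frame (BCircuit.encLen n m) (searchBits n m) j (extend C.encode) F) :
    Computes (BCircuit.encLen n m) (searchBits n m) j F (Prog.oracleProg n m (searchBits n m))
      (marked (searchVal C)) := by
  intro y hy
  have hl : BCircuit.encLen n m = (n + m) * (n + m) + 2 * m := rfl
  set s := searchBits n m
  set l := BCircuit.encLen n m
  have hin : ∀ q < l, y (searchMap l s j q) = extend C.encode q := by
    intro q hq
    rw [searchMap, if_pos hq, hF.input y hy q hq]
  have hreg : ∀ i, (hi : i < s + 1) → y (searchMap l s j (l + i)) = register l s j y ⟨i, hi⟩ := by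
    intro i hi
    rw [searchMap, if_neg (by omega), if_pos (by omega), Nat.add_sub_cancel_left]
    rfl
  rw [Prog.exec_apply (searchMap_injective l s j)]
  · have hspec := Prog.oracleProg_spec (n := n) (v := fun i => y (searchMap l s j i)) (s := s) hm
      (E := fun u w => C.hasEdge u w) (lab := fun j => C.gateLabel j)
      (Y := extend fun i : Fin s => register l s j y i.succ) ?_ ?_ ?_ ?_ ?_ ?_
    · rw [hspec.good.2, marked, searchVal, Prog.circuitVal]
      congr 1
      exact hreg 0 (by omega)
    · intro u hu w hw
      rw [hin, Prog.encode_edge C hu hw]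
      calc u * (n + m) + w < u * (n + m) + (n + m) := by omega
        _ = (u + 1) * (n + m) := by ring
        _ ≤ (n + m) * (n + m) := Nat.mul_le_mul_right _ hu
        _ ≤ l := by omega
    · intro i hi
      rw [hin _ (by omega), Prog.encode_label C (by omega), if_pos (by omega),
        show 2 * i / 2 = i by omega]
    · intro i hi
      rw [hin _ (by omega), Prog.encode_label C (by omega), if_neg (by omega),
        show (2 * i + 1) / 2 = i by omega]
    · intro i hi
      have := hreg (i + 1) (by omega)
      rw [show l + (i + 1) = l + 1 + i by omega] at this
      exact this.trans (extend_apply (fun i : Fin s => register l s j y i.succ) ⟨i, hi⟩).symm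
    · exact fun i hi => extend_of_le _ hi
    · have hzero : y (searchMap l s j (l + 1 + s)) = false := by
        rw [searchMap, if_neg (by omega), if_neg (by omega)]
        exact hF.work y hy _
      exact hzero
  · intro i hi
    simp only [searchMap, if_neg (show ¬ i < l by omega), if_neg (show ¬ i < l + 1 + s by omega)]
    exact hF.work y hy _

lemma satCircuit_finalState {n m : ℕ} (k : ℕ) (z : Fin (BCircuit.encLen n m) → Bool) :
    (satCircuit n m k).finalState z = fun y : Fin (satCircuit n m k).width → Bool =>
      runRaw (satRaw n m k) (basisState (extend z)) (extend y) :=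
  ofRaw_finalState _ _ _ z

/-- Separate registers make the runs independent, so the probabilities of failure multiply. -/
lemma outputProb_satCircuit_false {n m : ℕ} (hm : 1 ≤ m) (k : ℕ) (C : BCircuit n m) :
    (satCircuit n m k).outputProb C.encode false =
      ∏ j ∈ Finset.range (runCount n m k), ∑ x,
        survivor (rotParam (rounds (searchBits n m) (j + 1)) (searchBits n m) (j + 1)) (searchVal C)
          (rounds (searchBits n m) (j + 1) + 1) x ^ 2 := by
  have hz : ∀ q, BCircuit.encLen n m ≤ q → extend C.encode q = false :=
    fun q hq => extend_of_le _ hq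
  rw [← sum_productState (l := BCircuit.encLen n m) (w := (satCircuit n m k).width)
    (z := extend C.encode) ((le_max_right _ _).trans (le_max_left _ _))
    (fun q hq => hz q ((satCircuit n m k).le_width.trans hq)) (fun j =>
      survivor (rotParam (rounds (searchBits n m) (j + 1)) (searchBits n m) (j + 1)) (searchVal C)
          (rounds (searchBits n m) (j + 1) + 1)), QCircuit.outputProb]
  refine Finset.sum_congr rfl fun y _ => ?_
  rw [← satList_state hz (computes_oracle hm C) (ρ := fun j => rounds (searchBits n m) (j + 1))
    fun j _ => rounds_le _ _, satCircuit_finalState, satRaw]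
  have hout : extend y (outAddr (BCircuit.encLen n m)) = y (satCircuit n m k).out :=
    extend_apply y (satCircuit n m k).out
  rw [hout]
  split_ifs
  · rfl
  · simp

lemma satisfiable_iff_solutionCount {n m : ℕ} (hm : 1 ≤ m) (C : BCircuit n m) :
    C.Satisfiable ↔ 1 ≤ solutionCount (searchVal C) := by
  rw [Prog.satisfiable_iff hm, solutionCount, Nat.one_le_iff_ne_zero, ← Nat.pos_iff_ne_zero,
    Finset.card_pos]
  constructor
  · rintro ⟨Y, hY⟩
    exact ⟨Y, Finset.mem_filter.mpr ⟨Finset.mem_univ _, hY⟩⟩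
  · rintro ⟨Y, hY⟩
    exact ⟨Y, (Finset.mem_filter.mp hY).2⟩

theorem satCircuit_solves {n m k : ℕ} (hm : 1 ≤ m) {ε : ℝ} (hε : 0 ≤ ε) (hk : (1 / 2) ^ k ≤ ε) :
    SolvesCircuitSat (satCircuit n m k) ε := by
  intro C
  have hp := outputProb_satCircuit_false hm k C
  set s := searchBits n m
  set t := solutionCount (searchVal C) with ht
  by_cases hC : C.Satisfiable
  · simp only [hC, decide_true]
    rw [outputProb_true, hp]
    have ht1 : 1 ≤ t := (satisfiable_iff_solutionCount hm C).mp hC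
    refine sub_le_sub_left ?_ 1
    by_cases htK : t ≤ runCount n m k
    -- Run `j` is tuned to `j + 1` solutions, so the exact run has index `t - 1`.
    · rw [Finset.prod_eq_zero (i := t - 1) (Finset.mem_range.mpr (by omega))]
      · exact hε
      · have e : t - 1 + 1 = t := by omega
        rw [e]
        exact survivor_of_exact (le_four_pow_rounds s ht1) ht1 rfl
    · have hts : t ≤ 2 ^ s := solutionCount_le _
      -- As `t ≤ 2 ^ s`, having more solutions than runs is only possible if the minimum in
      -- `runCount` is `k`.
      have hK : runCount n m k = k := by
        unfold runCount at htK ⊢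
        have : searchBits n m = s := rfl
        rw [this] at htK ⊢
        omega
      rw [hK] at htK ⊢
      refine le_trans ?_ hk
      calc ∏ j ∈ Finset.range k, ∑ x, survivor (rotParam (rounds s (j + 1)) s (j + 1))
            (searchVal C) (rounds s (j + 1) + 1) x ^ 2
          ≤ ∏ _j ∈ Finset.range k, (1 / 2 : ℝ) := by
            refine Finset.prod_le_prod (fun j _ => Finset.sum_nonneg fun x _ => sq_nonneg _)
              fun j hj => ?_
            have hj' : j + 1 ≤ t := by have := Finset.mem_range.mp hj; omega
            exact (survivor_le_quarter (le_four_pow_rounds s (Nat.succ_pos j)) (Nat.succ_pos j)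
              hj').trans (by norm_num)
        _ = (1 / 2) ^ k := by simp
  · simp only [hC, decide_false]
    have ht0 : t = 0 := by
      have := mt (satisfiable_iff_solutionCount hm C).mpr hC
      omega
    rw [hp, Finset.prod_eq_one fun j _ =>
      survivor_of_no_solution (rotParam_nonneg _ _ _) (rotParam_le_one _ _ _) ht0 _]
    linarith

/-! ### Size -/

lemma oracleProg_length (n m s : ℕ) (hm : 1 ≤ m) : (Prog.oracleProg n m s).1.length ≤
    n * ((n + m) * 3 + s * 4) + m * ((n + m) * 11 + 10) + 2 := by
  have h := (Prog.oracleProg_spec (v := fun _ => false) (n := n) (m := m) (s := s) hm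
    (E := fun _ _ => false) (lab := fun _ => (false, false)) (Y := fun _ => false)
    (fun _ _ _ _ => rfl) (fun _ _ => rfl) (fun _ _ => rfl) (fun _ _ => rfl) (fun _ _ => rfl)
    rfl).length_le
  simpa using h

lemma anyProg_length {z i k ι : ℕ} (hz : z < ι) (hk : i + k ≤ ι) :
    (Prog.anyProg ι z i k).1.length ≤ k * 3 := by
  have h := (Prog.anyProg_spec (v := fun _ => false) hz rfl hk).length_le
  simpa using h

lemma flatMap_length_le {α : Type*} (L : List ℕ) (f : ℕ → List α) (B : ℕ → ℕ)
    (h : ∀ i ∈ L, (f i).length ≤ B i) : (L.flatMap f).length ≤ (L.map B).sum := by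
  rw [List.length_flatMap]
  exact List.sum_le_sum h

lemma sum_map_range (B : ℕ → ℕ) (k : ℕ) :
    ((List.range k).map B).sum = ∑ i ∈ Finset.range k, B i := by
  induction k with
  | zero => rfl
  | succ k ih => simp [List.range_succ, Finset.sum_range_succ, ih]

/-- The number `T` bounds the preparation, one detection, and one round alike. There are `2 ^ (r +
1) - 1` rounds, `r + 2` detections and one preparation, and `r + 2 ≤ 2 ^ (r + 1)`. -/
lemma searchList_length {p : Prog × ℕ} {l s j r T : ℕ}
    (hT : 32 * p.1.length + 98 * (s + 1) + 2 ≤ T) :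
    (searchList p l s j r).length ≤ 4 * T * 2 ^ r := by
  have hprep : (prepList l s j r).length = s + 1 := by simp [prepList]
  have hdet : ∀ c, (detectList p l s j c).length ≤ T := by
    intro c
    have := Prog.copyList_length (ι := l + 1 + s + 1) (α := searchMap l s j) p.1 p.2 (flagAddr l c)
    rw [detectList]; omega
  have hamp : (amplifyList p l s j r).length ≤ T := by
    have h1 := Prog.signList_length (ι := l + 1 + s + 1) (α := searchMap l s j) p.1 p.2
    have h2 := Prog.signList_length (ι := l + 1 + s + 1) (α := searchMap l s j)
      (nonzeroProg l s).1 (nonzeroProg l s).2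
    have h3 : (nonzeroProg l s).1.length ≤ (s + 1) * 3 := anyProg_length (by omega) (by omega)
    simp only [amplifyList, List.length_append, List.length_reverse, hprep]
    omega
  have hinner : ∀ i, ((List.range (2 ^ i)).flatMap fun _ => amplifyList p l s j r).length ≤
      2 ^ i * T := by
    intro i
    refine (flatMap_length_le _ _ (fun _ => T) fun _ _ => hamp).trans ?_
    simp
  have hloop : ((List.range (r + 1)).flatMap fun i =>
      (List.range (2 ^ i)).flatMap (fun _ => amplifyList p l s j r) ++
        detectList p l s j (j * (s + 3) + i + 1)).length ≤ (2 ^ (r + 1) + r) * T := by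
    refine (flatMap_length_le _ _ (fun i => 2 ^ i * T + T) fun i _ => ?_).trans ?_
    · rw [List.length_append]
      exact add_le_add (hinner i) (hdet _)
    · rw [sum_map_range, Finset.sum_add_distrib, ← Finset.sum_mul]
      have := Nat.geomSum_eq (le_refl 2) (r + 1)
      rw [this, Finset.sum_const, Finset.card_range, smul_eq_mul, ← add_mul]
      refine Nat.mul_le_mul_right _ ?_
      have : 0 < 2 ^ (r + 1) := by positivity
      omega
  have h1 := hdet (j * (s + 3))
  simp only [searchList, List.length_append, hprep]
  have hr : r + 2 ≤ 2 ^ (r + 1) := Nat.lt_pow_self (n := r + 1) (by norm_num)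
  calc s + 1 + (detectList p l s j (j * (s + 3))).length + _
      ≤ T + T + (2 ^ (r + 1) + r) * T := by
        refine add_le_add (add_le_add ?_ h1) hloop
        omega
    _ = (2 ^ (r + 1) + (r + 2)) * T := by ring
    _ ≤ (2 ^ (r + 1) + 2 ^ (r + 1)) * T := Nat.mul_le_mul_right _ (by omega)
    _ = 4 * T * 2 ^ r := by rw [pow_succ]; ring

lemma sum_one_div_sqrt_le (K : ℕ) : ∑ j ∈ Finset.range K, 1 / √((j + 1 : ℕ) : ℝ) ≤ 2 * √K := by
  induction K with
  | zero => simp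
  | succ K ih =>
    rw [Finset.sum_range_succ]
    have h1 : 0 < √((K + 1 : ℕ) : ℝ) := Real.sqrt_pos.mpr (by positivity)
    have h2 : 0 ≤ √(K : ℝ) := Real.sqrt_nonneg _
    have h3 : √((K + 1 : ℕ) : ℝ) ^ 2 = K + 1 := by
      rw [Real.sq_sqrt (by positivity)]; push_cast; ring
    have h4 : √(K : ℝ) ^ 2 = K := Real.sq_sqrt (by positivity)
    have h5 : 1 / √((K + 1 : ℕ) : ℝ) ≤ 2 * √((K + 1 : ℕ) : ℝ) - 2 * √(K : ℝ) := by
      rw [div_le_iff₀ h1]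
      nlinarith [sq_nonneg (√((K + 1 : ℕ) : ℝ) - √(K : ℝ))]
    linarith

lemma satRaw_length {n m k : ℕ} (hm : 1 ≤ m) (hk : 1 ≤ k) :
    ((satRaw n m k).length : ℝ) ≤ 20000 * (n + m) ^ 2 * (√(2 ^ searchBits n m) * √k) := by
  set s := searchBits n m with hs
  set K := runCount n m k with hK
  have hsn : s ≤ n := min_le_left _ _
  have hKk : K ≤ k := min_le_left _ _
  have hKs : K ≤ 2 ^ s := min_le_right _ _
  set M := n + m with hM
  have hM1 : 1 ≤ M := by omega
  have hMM : M ≤ M ^ 2 := Nat.le_self_pow two_ne_zero M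
  -- The oracle has at most `28 * M ^ 2 + 2` instructions, and `1158 = 32 * 28 + 64 + 98 * 2 + 2`.
  set T := 1158 * M ^ 2 with hT
  have hTp : 32 * (Prog.oracleProg n m s).1.length + 98 * (s + 1) + 2 ≤ T := by
    have h1 := oracleProg_length n m s hm
    have h2 : n * ((n + m) * 3 + s * 4) ≤ M * (M * 3 + M * 4) :=
      Nat.mul_le_mul (by omega) (by omega)
    have h3 : m * ((n + m) * 11 + 10) ≤ M * (M * 11 + M * 10) :=
      Nat.mul_le_mul (by omega) (by omega)
    nlinarith
  have hlen : (satRaw n m k).length ≤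
      (∑ j ∈ Finset.range K, 4 * T * 2 ^ rounds s (j + 1)) + (96 * (K * (s + 3)) + 1) := by
    rw [satRaw, satList, List.length_append]
    simp only [← hs, ← hK]
    refine add_le_add ?_ ?_
    · refine (flatMap_length_le _ _ (fun j => 4 * T * 2 ^ rounds s (j + 1)) fun j _ =>
        searchList_length hTp).trans_eq ?_
      rw [sum_map_range]
    · refine (Prog.copyList_length _ _ _).trans ?_
      have := anyProg_length (z := K * (s + 3)) (i := 0) (k := K * (s + 3)) (ι := K * (s + 3) + 1)
        (by omega) (by omega)
      omega
  have hsqrt : ∀ a : ℝ, 1 ≤ a → 1 ≤ √a := fun a ha => Real.one_le_sqrt.mpr ha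
  have hN1 : (1 : ℝ) ≤ 2 ^ s := one_le_pow₀ (by norm_num)
  have hk1 : (1 : ℝ) ≤ k := by exact_mod_cast hk
  have hP1 : 1 ≤ √((2 : ℝ) ^ s) * √k := one_le_mul_of_one_le_of_one_le (hsqrt _ hN1) (hsqrt _ hk1)
  set P := √((2 : ℝ) ^ s) * √k with hP
  -- Since `K` is at most both `2 ^ s` and `k`, it is at most their geometric mean; this pays for
  -- the final disjunction of the flags.
  have hKP : (K : ℝ) ≤ P := by
    have e : (K : ℝ) = √K * √K := (Real.mul_self_sqrt (by positivity)).symm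
    rw [e]
    refine mul_le_mul (Real.sqrt_le_sqrt ?_) (Real.sqrt_le_sqrt ?_) (Real.sqrt_nonneg _)
      (Real.sqrt_nonneg _)
    · exact_mod_cast hKs
    · exact_mod_cast hKk
  have hsum : ∑ j ∈ Finset.range K, (2 : ℝ) ^ rounds s (j + 1) ≤ 4 * P := by
    calc ∑ j ∈ Finset.range K, (2 : ℝ) ^ rounds s (j + 1)
        ≤ ∑ j ∈ Finset.range K, 2 * (√(2 ^ s) * (1 / √((j + 1 : ℕ) : ℝ))) := by
          refine Finset.sum_le_sum fun j hj => two_pow_rounds_le (by omega) ?_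
          have := Finset.mem_range.mp hj
          omega
      _ = 2 * √(2 ^ s) * ∑ j ∈ Finset.range K, 1 / √((j + 1 : ℕ) : ℝ) := by
          rw [Finset.mul_sum]
          exact Finset.sum_congr rfl fun j _ => by ring
      _ ≤ 2 * √(2 ^ s) * (2 * √K) := by
          gcongr
          exact sum_one_div_sqrt_le K
      _ ≤ 2 * √(2 ^ s) * (2 * √k) := by
          gcongr
      _ = 4 * P := by rw [hP]; ring
  have hMR : (M : ℝ) = n + m := by rw [hM]; push_cast; ring
  have hM1R : (1 : ℝ) ≤ (M : ℝ) ^ 2 := by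
    have : (1 : ℝ) ≤ M := by exact_mod_cast hM1
    exact one_le_pow₀ this
  have hs3 : ((s + 3 : ℕ) : ℝ) ≤ 4 * (M : ℝ) ^ 2 := by
    have : s + 3 ≤ 4 * M ^ 2 := by omega
    exact_mod_cast this
  calc ((satRaw n m k).length : ℝ)
      ≤ ((∑ j ∈ Finset.range K, 4 * T * 2 ^ rounds s (j + 1)) + (96 * (K * (s + 3)) + 1) : ℕ) := by
        exact_mod_cast hlen
    _ = 4 * T * (∑ j ∈ Finset.range K, (2 : ℝ) ^ rounds s (j + 1)) +
        (96 * (K * ((s + 3 : ℕ) : ℝ)) + 1) := by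
        push_cast
        rw [Finset.mul_sum]
    _ ≤ 4 * T * (4 * P) + (96 * (P * (4 * (M : ℝ) ^ 2)) + P * (M : ℝ) ^ 2) := by
        gcongr
        nlinarith
    _ ≤ 20000 * (M : ℝ) ^ 2 * P := by
        have hTR : (T : ℝ) = 1158 * (M : ℝ) ^ 2 := by rw [hT]; push_cast; ring
        rw [hTR]
        have : 0 ≤ (M : ℝ) ^ 2 * P := by positivity
        linarith
    _ = 20000 * (n + m) ^ 2 * P := by rw [hMR]

lemma succ_pow_four_le (δ : ℕ) : (δ + 1) ^ 4 ≤ 64 * 2 ^ δ := by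
  rcases lt_or_ge δ 6 with h | h
  · interval_cases δ <;> norm_num
  · induction δ, h using Nat.le_induction with
    | base => norm_num
    | succ δ hδ ih =>
      -- The induction works because `(7 / 6) ^ 4 < 2`.
      have h1 : 6 * (δ + 1 + 1) ≤ 7 * (δ + 1) := by omega
      have h2 : (6 * (δ + 1 + 1)) ^ 4 ≤ (7 * (δ + 1)) ^ 4 := Nat.pow_le_pow_left h1 4
      rw [mul_pow, mul_pow] at h2
      rw [pow_succ 2 δ]
      omega

/-- For `n ≤ 2 * m` one has `n + m ≤ 3 * m`. Otherwise the search space has only `2 ^ (2 * m)`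
elements, and the surplus factor `2 ^ (n - 2 * m)` dominates the fourth power of `n - 2 * m + 1`.
The fourth power appears because the size contains `(n + m) ^ 2` beside a square root; note `5184 =
81 * 64 = 72 ^ 2`. -/
lemma pow_four_mul_le {n m : ℕ} (hm : 1 ≤ m) :
    (n + m) ^ 4 * 2 ^ searchBits n m ≤ 5184 * m ^ 4 * 2 ^ n := by
  rcases le_total n (2 * m) with h | h
  · rw [searchBits, min_eq_left h]
    refine Nat.mul_le_mul_right _ ?_
    calc (n + m) ^ 4 ≤ (3 * m) ^ 4 := Nat.pow_le_pow_left (by omega) 4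
      _ ≤ 5184 * m ^ 4 := by rw [mul_pow]; omega
  · rw [searchBits, min_eq_right h]
    obtain ⟨δ, rfl⟩ := Nat.exists_eq_add_of_le h
    have h1 : 2 * m + δ + m ≤ 3 * m * (δ + 1) := by nlinarith
    calc (2 * m + δ + m) ^ 4 * 2 ^ (2 * m) ≤ (3 * m * (δ + 1)) ^ 4 * 2 ^ (2 * m) :=
          Nat.mul_le_mul_right _ (Nat.pow_le_pow_left h1 4)
      _ = 81 * m ^ 4 * 2 ^ (2 * m) * (δ + 1) ^ 4 := by ring
      _ ≤ 81 * m ^ 4 * 2 ^ (2 * m) * (64 * 2 ^ δ) := Nat.mul_le_mul_left _ (succ_pow_four_le δ)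
      _ = 5184 * m ^ 4 * 2 ^ (2 * m + δ) := by rw [pow_add]; ring

theorem satCircuit_size {n m : ℕ} {ε : ℝ} (hm : 1 ≤ m) (hε : 0 < ε) (hε2 : ε ≤ 1 / 2) :
    ((satCircuit n m ⌈Real.logb 2 (1 / ε)⌉₊).size : ℝ) ≤
      2880000 * (√(2 ^ n * Real.log (1 / ε)) * (m : ℝ) ^ 2) := by
  set k := ⌈Real.logb 2 (1 / ε)⌉₊ with hk
  have h2 : 2 ≤ 1 / ε := by
    rw [le_div_iff₀ hε]; linarith
  have hlog : 1 ≤ Real.logb 2 (1 / ε) := by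
    rw [Real.le_logb_iff_rpow_le (by norm_num) (by linarith)]
    simpa using h2
  have hk1 : 1 ≤ k := Nat.one_le_ceil_iff.mpr (by linarith)
  have hlog2 : (1 / 2 : ℝ) ≤ Real.log 2 := by
    have := Real.log_two_gt_d9; linarith
  have hL : Real.logb 2 (1 / ε) ≤ 2 * Real.log (1 / ε) := by
    rw [Real.logb, div_le_iff₀ (by linarith)]
    have : 0 ≤ Real.log (1 / ε) := Real.log_nonneg (by linarith)
    nlinarith
  -- For `ε ≤ 1 / 2` the binary logarithm is at least 1, so rounding up at most doubles it.
  have hkL : (k : ℝ) ≤ 4 * Real.log (1 / ε) := by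
    have := Nat.ceil_lt_add_one (show 0 ≤ Real.logb 2 (1 / ε) by linarith)
    linarith
  have hsk : √(k : ℝ) ≤ 2 * √(Real.log (1 / ε)) := by
    calc √(k : ℝ) ≤ √(4 * Real.log (1 / ε)) := Real.sqrt_le_sqrt hkL
      _ = 2 * √(Real.log (1 / ε)) := by
        rw [Real.sqrt_mul (by norm_num), show (4 : ℝ) = 2 ^ 2 by norm_num,
          Real.sqrt_sq (by norm_num)]
  have hM : ((n : ℝ) + m) ^ 2 * √(2 ^ searchBits n m) ≤ 72 * (m : ℝ) ^ 2 * √(2 ^ n) := by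
    have h4 : (((n : ℝ) + m) ^ 2) ^ 2 * 2 ^ searchBits n m ≤ (72 * (m : ℝ) ^ 2) ^ 2 * 2 ^ n := by
      have := pow_four_mul_le (n := n) hm
      have h5 : ((n : ℝ) + m) ^ 4 * 2 ^ searchBits n m ≤ 5184 * (m : ℝ) ^ 4 * 2 ^ n := by
        exact_mod_cast this
      linarith
    calc ((n : ℝ) + m) ^ 2 * √(2 ^ searchBits n m)
        = √((((n : ℝ) + m) ^ 2) ^ 2 * 2 ^ searchBits n m) := by
          rw [Real.sqrt_mul (by positivity), Real.sqrt_sq (by positivity)]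
      _ ≤ √((72 * (m : ℝ) ^ 2) ^ 2 * 2 ^ n) := Real.sqrt_le_sqrt h4
      _ = 72 * (m : ℝ) ^ 2 * √(2 ^ n) := by
          rw [Real.sqrt_mul (by positivity), Real.sqrt_sq (by positivity)]
  calc ((satCircuit n m k).size : ℝ) ≤ (satRaw n m k).length := by
        exact_mod_cast ofRaw_size_le _ _ _ _
    _ ≤ 20000 * (n + m) ^ 2 * (√(2 ^ searchBits n m) * √k) := satRaw_length hm hk1
    _ = 20000 * (((n : ℝ) + m) ^ 2 * √(2 ^ searchBits n m)) * √k := by ring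
    _ ≤ 20000 * (72 * (m : ℝ) ^ 2 * √(2 ^ n)) * (2 * √(Real.log (1 / ε))) := by gcongr
    _ = 2880000 * (√(2 ^ n * Real.log (1 / ε)) * (m : ℝ) ^ 2) := by
        rw [Real.sqrt_mul (by positivity)]; ring

lemma half_pow_ceil_le {ε : ℝ} (hε : 0 < ε) : (1 / 2) ^ ⌈Real.logb 2 (1 / ε)⌉₊ ≤ ε := by
  have h : 1 / ε ≤ 2 ^ ⌈Real.logb 2 (1 / ε)⌉₊ := by
    rw [← Real.rpow_natCast, ← Real.logb_le_iff_le_rpow (by norm_num) (by positivity)]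
    exact Nat.le_ceil _
  rw [_root_.one_div_pow, one_div_le (by positivity) hε]
  exact h


/-! ### Uniformity: the raw gates are computable -/

attribute [fun_prop] Primrec

/-! ### Closure properties of primitive recursive functions -/

section Basic

variable {α β γ δ : Type*} [Primcodable α] [Primcodable β] [Primcodable γ] [Primcodable δ]

@[fun_prop] lemma primrec_id : Primrec fun a : α => a := Primrec.id

@[fun_prop] lemma primrec_const (b : β) : Primrec fun _ : α => b := Primrec.const b

@[fun_prop] lemma primrec_comp {f : β → γ} {g : α → β} (hf : Primrec f) (hg : Primrec g) :
    Primrec fun a => f (g a) := hf.comp hg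

@[fun_prop] lemma primrec_pair {f : α → β} {g : α → γ} (hf : Primrec f) (hg : Primrec g) :
    Primrec fun a => (f a, g a) := hf.pair hg

@[fun_prop] lemma primrec_fst {f : α → β × γ} (hf : Primrec f) : Primrec fun a => (f a).1 :=
  Primrec.fst.comp hf

@[fun_prop] lemma primrec_snd {f : α → β × γ} (hf : Primrec f) : Primrec fun a => (f a).2 :=
  Primrec.snd.comp hf

@[fun_prop] lemma primrec_inl {f : α → β} (hf : Primrec f) :
    Primrec fun a => (Sum.inl (f a) : β ⊕ γ) := Primrec.sumInl.comp hf

@[fun_prop] lemma primrec_inr {f : α → β} (hf : Primrec f) :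
    Primrec fun a => (Sum.inr (f a) : γ ⊕ β) := Primrec.sumInr.comp hf

@[fun_prop] lemma primrec_add {f g : α → ℕ} (hf : Primrec f) (hg : Primrec g) :
    Primrec fun a => f a + g a := Primrec.nat_add.comp hf hg

@[fun_prop] lemma primrec_sub {f g : α → ℕ} (hf : Primrec f) (hg : Primrec g) :
    Primrec fun a => f a - g a := Primrec.nat_sub.comp hf hg

@[fun_prop] lemma primrec_mul {f g : α → ℕ} (hf : Primrec f) (hg : Primrec g) :
    Primrec fun a => f a * g a := Primrec.nat_mul.comp hf hg

@[fun_prop] lemma primrec_div {f g : α → ℕ} (hf : Primrec f) (hg : Primrec g) :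
    Primrec fun a => f a / g a := Primrec.nat_div.comp hf hg

@[fun_prop] lemma primrec_pow {f g : α → ℕ} (hf : Primrec f) (hg : Primrec g) :
    Primrec fun a => f a ^ g a := (Primrec₂.unpaired'.1 Nat.Primrec.pow).comp hf hg

@[fun_prop] lemma primrec_min {f g : α → ℕ} (hf : Primrec f) (hg : Primrec g) :
    Primrec fun a => min (f a) (g a) := Primrec.nat_min.comp hf hg

@[fun_prop] lemma primrec_max {f g : α → ℕ} (hf : Primrec f) (hg : Primrec g) :
    Primrec fun a => max (f a) (g a) := Primrec.nat_max.comp hf hg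

@[fun_prop] lemma primrec_sqrt {f : α → ℕ} (hf : Primrec f) : Primrec fun a => Nat.sqrt (f a) :=
  Primrec.nat_sqrt.comp hf

@[fun_prop] lemma primrec_ite_lt {f g : α → ℕ} {h k : α → β} (hf : Primrec f) (hg : Primrec g)
    (hh : Primrec h) (hk : Primrec k) : Primrec fun a => if f a < g a then h a else k a :=
  Primrec.ite (Primrec.nat_lt.comp hf hg) hh hk

@[fun_prop] lemma primrec_ite_eq [DecidableEq γ] {f g : α → γ} {h k : α → β} (hf : Primrec f)
    (hg : Primrec g) (hh : Primrec h) (hk : Primrec k) :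
    Primrec fun a => if f a = g a then h a else k a :=
  Primrec.ite (Primrec.eq.comp hf hg) hh hk

@[fun_prop] lemma primrec_length {f : α → List β} (hf : Primrec f) :
    Primrec fun a => (f a).length := Primrec.list_length.comp hf

@[fun_prop] lemma primrec_cons {f : α → β} {g : α → List β} (hf : Primrec f) (hg : Primrec g) :
    Primrec fun a => f a :: g a := Primrec.list_cons.comp hf hg

@[fun_prop] lemma primrec_append {f g : α → List β} (hf : Primrec f) (hg : Primrec g) :
    Primrec fun a => f a ++ g a := Primrec.list_append.comp hf hg

@[fun_prop] lemma primrec_reverse {f : α → List β} (hf : Primrec f) :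
    Primrec fun a => (f a).reverse := Primrec.list_reverse.comp hf

@[fun_prop] lemma primrec_range {f : α → ℕ} (hf : Primrec f) :
    Primrec fun a => List.range (f a) := Primrec.list_range.comp hf

@[fun_prop] lemma primrec_getD {f : α → List β} {g : α → ℕ} {d : α → β} (hf : Primrec f)
    (hg : Primrec g) (hd : Primrec d) : Primrec fun a => (f a).getD (g a) (d a) := by
  have h : Primrec fun a => ((f a)[g a]?).getD (d a) :=
    Primrec.option_getD.comp (Primrec.list_getElem?.comp hf hg) hd
  exact h.of_eq fun a => (List.getD_eq_getElem?_getD).symm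

@[fun_prop] lemma primrec_foldl {f : α → List β} {g : α → γ} {h : α → γ → β → γ}
    (hf : Primrec f) (hg : Primrec g) (hh : Primrec fun q : α × γ × β => h q.1 q.2.1 q.2.2) :
    Primrec fun a => (f a).foldl (h a) (g a) :=
  Primrec.list_foldl hf hg (h := fun a q => h a q.1 q.2) hh

@[fun_prop] lemma primrec_map {f : α → List β} {g : α → β → γ} (hf : Primrec f)
    (hg : Primrec fun q : α × β => g q.1 q.2) : Primrec fun a => (f a).map (g a) :=
  Primrec.list_map hf hg

@[fun_prop] lemma primrec_flatMap {f : α → List β} {g : α → β → List γ} (hf : Primrec f)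
    (hg : Primrec fun q : α × β => g q.1 q.2) : Primrec fun a => (f a).flatMap (g a) :=
  Primrec.list_flatMap hf hg

end Basic

/-! ### Primitive recursiveness of the straight-line programs -/

section Programs

open Prog

variable {A : Type*} [Primcodable A] {ι z k x y c : A → ℕ} {P : A → Prog}

@[fun_prop] lemma primrec_nandB (hι : Primrec ι) (hP : Primrec P) (hx : Primrec x)
    (hy : Primrec y) : Primrec fun a => nandB (ι a) (P a) (x a) (y a) := by
  unfold nandB
  fun_prop

@[fun_prop] lemma primrec_notB (hι : Primrec ι) (hP : Primrec P) (hx : Primrec x) :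
    Primrec fun a => notB (ι a) (P a) (x a) := by
  unfold notB
  fun_prop

@[fun_prop] lemma primrec_andB (hι : Primrec ι) (hP : Primrec P) (hx : Primrec x)
    (hy : Primrec y) : Primrec fun a => andB (ι a) (P a) (x a) (y a) := by
  unfold andB
  fun_prop

@[fun_prop] lemma primrec_orB (hι : Primrec ι) (hP : Primrec P) (hx : Primrec x)
    (hy : Primrec y) : Primrec fun a => orB (ι a) (P a) (x a) (y a) := by
  simp only [orB]
  fun_prop

@[fun_prop] lemma primrec_muxB (hι : Primrec ι) (hP : Primrec P) (hc : Primrec c)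
    (hx : Primrec x) (hy : Primrec y) :
    Primrec fun a => muxB (ι a) (P a) (c a) (x a) (y a) := by
  simp only [muxB]
  fun_prop

@[fun_prop] lemma primrec_orFold {f : A → Prog → ℕ → Prog × ℕ} (hι : Primrec ι) (hz : Primrec z)
    (hf : Primrec fun q : A × Prog × ℕ => f q.1 q.2.1 q.2.2) (hP : Primrec P)
    (hk : Primrec k) : Primrec fun a => orFold (ι a) (z a) (f a) (P a) (k a) := by
  simp only [orFold]
  have hf' := fun (x : (A × (Prog × ℕ) × ℕ) → A × Prog × ℕ) hx => hf.comp (g := x) hx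
  refine primrec_foldl (by fun_prop) (by fun_prop) ?_
  fun_prop

@[fun_prop] lemma primrec_mapFold {f : A → Prog → ℕ → Prog × ℕ}
    (hf : Primrec fun q : A × Prog × ℕ => f q.1 q.2.1 q.2.2) (hP : Primrec P)
    (hk : Primrec k) : Primrec fun a => mapFold (f a) (P a) (k a) := by
  simp only [mapFold]
  have hf' := fun (x : (A × (Prog × List ℕ) × ℕ) → A × Prog × ℕ) hx => hf.comp (g := x) hx
  refine primrec_foldl (by fun_prop) (by fun_prop) ?_
  fun_prop

@[fun_prop] lemma primrec_anyProg (hι : Primrec ι) (hz : Primrec z) (hx : Primrec x)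
    (hk : Primrec k) : Primrec fun a => anyProg (ι a) (z a) (x a) (k a) := by
  unfold anyProg
  fun_prop

@[fun_prop] lemma primrec_usedB (hι : Primrec ι) (hz : Primrec z) (hk : Primrec k)
    (hP : Primrec P) (hx : Primrec x) : Primrec fun a => usedB (ι a) (z a) (k a) (P a) (x a) := by
  unfold usedB
  fun_prop

@[fun_prop] lemma primrec_queueStep {S : A → QueueState} (hι : Primrec ι) (hz : Primrec z)
    (hx : Primrec x) (hy : Primrec y) (hS : Primrec S) (hk : Primrec k) :
    Primrec fun a => queueStep (ι a) (z a) (x a) (y a) (S a) (k a) := by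
  -- The intermediate program stays hidden behind a name until the end, so that its definition is
  -- not copied into each of its uses.
  obtain ⟨p, hp, hpe⟩ : ∃ p : A → Prog × ℕ, Primrec p ∧
    p = fun a => usedB (ι a) (z a) (y a) (S a).1 (k a) := ⟨_, by fun_prop, rfl⟩
  have h : Primrec fun a => mapFold (fun P i => muxB (ι a) P (p a).2 ((S a).2.1.getD (i + 1) (z a))
    ((S a).2.1.getD i (z a))) (p a).1 (x a) := by fun_prop
  have h' : Primrec fun a => (S a).2.2 ++ [(S a).2.1.getD 0 (z a)] := by fun_prop
  subst hpe
  exact (Primrec.fst.comp h).pair ((Primrec.snd.comp h).pair h')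

@[fun_prop] lemma primrec_queueProg (hι : Primrec ι) (hz : Primrec z) (hx : Primrec x)
    (hy : Primrec y) (hk : Primrec k) (hc : Primrec c) :
    Primrec fun a => queueProg (ι a) (z a) (x a) (y a) (k a) (c a) := by
  simp only [queueProg]
  fun_prop

@[fun_prop] lemma primrec_gateStep {S : A → Prog × List ℕ} {n m j : A → ℕ} (hι : Primrec ι)
    (hz : Primrec z) (hn : Primrec n) (hm : Primrec m) (hS : Primrec S) (hj : Primrec j) :
    Primrec fun a => gateStep (ι a) (z a) (n a) (m a) (S a) (j a) := by
  obtain ⟨p1, hp1, e1⟩ : ∃ p : A → Prog × ℕ, Primrec p ∧ p = fun a =>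
      orFold (ι a) (z a) (fun P u => andB (ι a) P (u * (n a + m a) + (n a + j a))
        ((S a).2.getD u (z a))) (S a).1 (n a + j a) := ⟨_, by fun_prop, rfl⟩
  obtain ⟨p2, hp2, e2⟩ : ∃ p : A → Prog × ℕ, Primrec p ∧ p = fun a =>
      orFold (ι a) (z a) (fun P u => andB (ι a) (notB (ι a) P ((S a).2.getD u (z a))).1
        (u * (n a + m a) + (n a + j a)) (notB (ι a) P ((S a).2.getD u (z a))).2) (p1 a).1
        (n a + j a) := ⟨_, by fun_prop, rfl⟩
  obtain ⟨p3, hp3, e3⟩ : ∃ p : A → Prog × ℕ, Primrec p ∧ p = fun a =>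
      notB (ι a) (p2 a).1 (p1 a).2 := ⟨_, by fun_prop, rfl⟩
  obtain ⟨p4, hp4, e4⟩ : ∃ p : A → Prog × ℕ, Primrec p ∧ p = fun a =>
      notB (ι a) (p3 a).1 (p2 a).2 := ⟨_, by fun_prop, rfl⟩
  obtain ⟨p5, hp5, e5⟩ : ∃ p : A → Prog × ℕ, Primrec p ∧ p = fun a =>
      muxB (ι a) (p4 a).1 ((n a + m a) * (n a + m a) + (2 * j a + 1)) (p1 a).2 (p4 a).2 :=
    ⟨_, by fun_prop, rfl⟩
  obtain ⟨p6, hp6, e6⟩ : ∃ p : A → Prog × ℕ, Primrec p ∧ p = fun a =>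
      muxB (ι a) (p5 a).1 ((n a + m a) * (n a + m a) + 2 * j a) (p3 a).2 (p5 a).2 :=
    ⟨_, by fun_prop, rfl⟩
  have h : Primrec fun a => ((p6 a).1, (S a).2 ++ [(p6 a).2]) := by fun_prop
  subst e6 e5 e4 e3 e2 e1
  exact h

@[fun_prop] lemma primrec_oracleProg {n m s : A → ℕ} (hn : Primrec n) (hm : Primrec m)
    (hs : Primrec s) : Primrec fun a => oracleProg (n a) (m a) (s a) := by
  obtain ⟨l, hl, el⟩ : ∃ l : A → ℕ, Primrec l ∧ l = fun a => BCircuit.encLen (n a) (m a) :=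
    ⟨_, by unfold BCircuit.encLen; fun_prop, rfl⟩
  obtain ⟨z, hz, ez⟩ : ∃ z : A → ℕ, Primrec z ∧ z = fun a => l a + 1 + s a :=
    ⟨_, by fun_prop, rfl⟩
  obtain ⟨S, hS, eS⟩ : ∃ S : A → QueueState, Primrec S ∧ S = fun a =>
      queueProg (z a + 1) (z a) (s a) (n a + m a) (l a) (n a) := ⟨_, by fun_prop, rfl⟩
  obtain ⟨T, hT, eT⟩ : ∃ T : A → Prog × List ℕ, Primrec T ∧ T = fun a =>
      (List.range (m a)).foldl (gateStep (z a + 1) (z a) (n a) (m a)) ((S a).1, (S a).2.2) :=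
    ⟨_, by fun_prop, rfl⟩
  have h : Primrec fun a => andB (z a + 1) (T a).1 ((T a).2.getD (n a + m a - 1) (z a)) (l a) := by
    fun_prop
  subst eT eS ez el
  exact h

end Programs


/-! ### Primitive recursiveness of the gate lists and of the layout -/

section RawGates

variable {A : Type*} [Primcodable A] {p q r s j i k l e a b c K : A → ℕ}

@[fun_prop] lemma primrec_encLen {n m : A → ℕ} (hn : Primrec n) (hm : Primrec m) :
    Primrec fun x => BCircuit.encLen (n x) (m x) := by
  unfold BCircuit.encLen
  fun_prop

@[fun_prop] lemma primrec_xAddr (hl : Primrec l) (hs : Primrec s) (hj : Primrec j)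
    (hi : Primrec i) : Primrec fun x => xAddr (l x) (s x) (j x) (i x) := by
  unfold xAddr
  fun_prop

@[fun_prop] lemma primrec_flagAddr (hl : Primrec l) (hi : Primrec i) :
    Primrec fun x => flagAddr (l x) (i x) := by
  unfold flagAddr
  fun_prop

@[fun_prop] lemma primrec_workAddr (hl : Primrec l) (hi : Primrec i) :
    Primrec fun x => workAddr (l x) (i x) := by
  unfold workAddr
  fun_prop

@[fun_prop] lemma primrec_outAddr (hl : Primrec l) : Primrec fun x => outAddr (l x) := by
  unfold outAddr
  fun_prop

@[fun_prop] lemma primrec_searchMap (hl : Primrec l) (hs : Primrec s) (hj : Primrec j)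
    (hi : Primrec i) : Primrec fun x => searchMap (l x) (s x) (j x) (i x) := by
  unfold searchMap
  fun_prop

@[fun_prop] lemma primrec_flagMap (hl : Primrec l) (hk : Primrec k) (hi : Primrec i) :
    Primrec fun x => flagMap (l x) (k x) (i x) := by
  unfold flagMap
  fun_prop

@[fun_prop] lemma primrec_tGate (he : Primrec e) (hq : Primrec q) :
    Primrec fun x => tGate (e x) (q x) := by
  unfold tGate
  fun_prop

@[fun_prop] lemma primrec_hGate (hq : Primrec q) : Primrec fun x => hGate (q x) := by
  unfold hGate
  fun_prop

@[fun_prop] lemma primrec_xGate (hq : Primrec q) : Primrec fun x => xGate (q x) := by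
  unfold xGate
  fun_prop

@[fun_prop] lemma primrec_zGate (hq : Primrec q) : Primrec fun x => zGate (q x) := by
  unfold zGate
  fun_prop

@[fun_prop] lemma primrec_cnotGate (hp : Primrec p) (hq : Primrec q) :
    Primrec fun x => cnotGate (p x) (q x) := by
  unfold cnotGate
  fun_prop

@[fun_prop] lemma primrec_toffoliList (ha : Primrec a) (hb : Primrec b) (hc : Primrec c) :
    Primrec fun x => toffoliList (a x) (b x) (c x) := by
  unfold toffoliList cczList
  fun_prop

@[fun_prop] lemma primrec_nandList (ha : Primrec a) (hb : Primrec b) (hc : Primrec c) :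
    Primrec fun x => nandList (a x) (b x) (c x) := by
  unfold nandList
  fun_prop

section Programs

open Prog

variable {α : A → ℕ → ℕ} {ι : A → ℕ} {P : A → Prog}

lemma primrec_instr {u : A → ℕ × ℕ} (hα : Primrec fun x : A × ℕ => α x.1 x.2)
    (hc : Primrec c) (hu : Primrec u) : Primrec fun x => instr (α x) (c x) (u x) := by
  have h : Primrec fun x => if (u x).1 < c x then if (u x).2 < c x then
      nandList (α x (u x).1) (α x (u x).2) (α x (c x)) else [] else [] := by
    have h1 : Primrec fun x => α x (u x).1 := hα.comp (g := fun x => (x, (u x).1)) (by fun_prop)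
    have h2 : Primrec fun x => α x (u x).2 := hα.comp (g := fun x => (x, (u x).2)) (by fun_prop)
    have h3 : Primrec fun x => α x (c x) := hα.comp (g := fun x => (x, c x)) (by fun_prop)
    fun_prop
  exact h.of_eq fun x => by simp only [instr, ite_and]

lemma compute_eq_rec (ι : ℕ) (α : ℕ → ℕ) (P : Prog) : compute ι α P =
    List.recOn P [] fun u P IH => IH ++ instr α (ι + P.length) u := by
  induction P with
  | nil => rfl
  | cons u P ih => simp only [compute, ih]

lemma uncompute_eq_rec (ι : ℕ) (α : ℕ → ℕ) (P : Prog) : uncompute ι α P =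
    List.recOn P [] fun u P IH => instr α (ι + P.length) u ++ IH := by
  induction P with
  | nil => rfl
  | cons u P ih => simp only [uncompute, ih]

@[fun_prop] lemma primrec_compute (hα : Primrec fun x : A × ℕ => α x.1 x.2) (hι : Primrec ι)
    (hP : Primrec P) : Primrec fun x => compute (ι x) (α x) (P x) := by
  simp only [compute_eq_rec]
  have h : Primrec fun y : A × (ℕ × ℕ) × Prog × List RawGate =>
      instr (α y.1) (ι y.1 + y.2.2.1.length) y.2.1 := by
    refine primrec_instr (hα.comp (g := fun z : (A × (ℕ × ℕ) × Prog × List RawGate) × ℕ =>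
      (z.1.1, z.2)) (by fun_prop)) (by fun_prop) (by fun_prop)
  refine Primrec.list_rec (h := fun x y => y.2.2 ++ instr (α x) (ι x + y.2.1.length) y.1)
    hP (.const []) ?_
  exact primrec_append (by fun_prop) h

@[fun_prop] lemma primrec_uncompute (hα : Primrec fun x : A × ℕ => α x.1 x.2) (hι : Primrec ι)
    (hP : Primrec P) : Primrec fun x => uncompute (ι x) (α x) (P x) := by
  simp only [uncompute_eq_rec]
  have h : Primrec fun y : A × (ℕ × ℕ) × Prog × List RawGate =>
      instr (α y.1) (ι y.1 + y.2.2.1.length) y.2.1 := by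
    refine primrec_instr (hα.comp (g := fun z : (A × (ℕ × ℕ) × Prog × List RawGate) × ℕ =>
      (z.1.1, z.2)) (by fun_prop)) (by fun_prop) (by fun_prop)
  refine Primrec.list_rec (h := fun x y => instr (α x) (ι x + y.2.1.length) y.1 ++ y.2.2)
    hP (.const []) ?_
  exact primrec_append h (by fun_prop)

@[fun_prop] lemma primrec_signList (hα : Primrec fun x : A × ℕ => α x.1 x.2) (hι : Primrec ι)
    (hP : Primrec P) (hr : Primrec r) :
    Primrec fun x => signList (ι x) (α x) (P x) (r x) := by
  have h : Primrec fun x => α x (r x) := hα.comp (g := fun x => (x, r x)) (by fun_prop)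
  unfold signList
  fun_prop

@[fun_prop] lemma primrec_copyList (hα : Primrec fun x : A × ℕ => α x.1 x.2) (hι : Primrec ι)
    (hP : Primrec P) (hr : Primrec r) (hq : Primrec q) :
    Primrec fun x => copyList (ι x) (α x) (P x) (r x) (q x) := by
  have h : Primrec fun x => α x (r x) := hα.comp (g := fun x => (x, r x)) (by fun_prop)
  unfold copyList
  fun_prop

end Programs

@[fun_prop] lemma primrec_prepCode (hs : Primrec s) (hj : Primrec j) (hr : Primrec r)
    (hi : Primrec i) : Primrec fun x => prepCode (s x) (j x) (r x) (i x) := by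
  unfold prepCode
  fun_prop

@[fun_prop] lemma primrec_prepList (hl : Primrec l) (hs : Primrec s) (hj : Primrec j)
    (hr : Primrec r) : Primrec fun x => prepList (l x) (s x) (j x) (r x) := by
  unfold prepList
  fun_prop

@[fun_prop] lemma primrec_nonzeroProg (hl : Primrec l) (hs : Primrec s) :
    Primrec fun x => nonzeroProg (l x) (s x) := by
  unfold nonzeroProg
  fun_prop

variable {o : A → Prog × ℕ}

@[fun_prop] lemma primrec_amplifyList (ho : Primrec o) (hl : Primrec l) (hs : Primrec s)
    (hj : Primrec j) (hr : Primrec r) :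
    Primrec fun x => amplifyList (o x) (l x) (s x) (j x) (r x) := by
  unfold amplifyList
  fun_prop

@[fun_prop] lemma primrec_detectList (ho : Primrec o) (hl : Primrec l) (hs : Primrec s)
    (hj : Primrec j) (hc : Primrec c) :
    Primrec fun x => detectList (o x) (l x) (s x) (j x) (c x) := by
  unfold detectList
  fun_prop

@[fun_prop] lemma primrec_searchList (ho : Primrec o) (hl : Primrec l) (hs : Primrec s)
    (hj : Primrec j) (hr : Primrec r) :
    Primrec fun x => searchList (o x) (l x) (s x) (j x) (r x) := by
  unfold searchList
  fun_prop

@[fun_prop] lemma primrec_satList {ρ : A → ℕ → ℕ} (ho : Primrec o) (hl : Primrec l)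
    (hs : Primrec s) (hK : Primrec K) (hρ : Primrec fun x : A × ℕ => ρ x.1 x.2) :
    Primrec fun x => satList (o x) (l x) (s x) (K x) (ρ x) := by
  unfold satList
  fun_prop

@[fun_prop] lemma primrec_rounds (hs : Primrec s) (hj : Primrec j) :
    Primrec fun x => rounds (s x) (j x) := by
  have h : Primrec fun x => (s x).rec (motive := fun _ => ℕ) 0 fun _ IH =>
      if 4 ^ IH * j x < 2 ^ s x then IH + 1 else IH := by
    refine Primrec.nat_rec' (h := fun x y => if 4 ^ y.2 * j x < 2 ^ s x then y.2 + 1 else y.2)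
      hs (.const 0) ?_
    unfold Primrec₂
    fun_prop
  refine h.of_eq fun x => ?_
  rw [rounds]
  generalize s x = t, j x = u
  have : ∀ i, Nat.rec (motive := fun _ => ℕ) 0 (fun _ IH =>
      if 4 ^ IH * u < 2 ^ t then IH + 1 else IH) i = roundsAux t u i := by
    intro i
    induction i with
    | zero => rfl
    | succ i ih => simp only [roundsAux, ← ih]
  exact this t

@[fun_prop] lemma primrec_searchBits {n m : A → ℕ} (hn : Primrec n) (hm : Primrec m) :
    Primrec fun x => searchBits (n x) (m x) := by
  unfold searchBits
  fun_prop

@[fun_prop] lemma primrec_runCount {n m : A → ℕ} (hn : Primrec n) (hm : Primrec m)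
    (hk : Primrec k) : Primrec fun x => runCount (n x) (m x) (k x) := by
  unfold runCount
  fun_prop

@[fun_prop] lemma primrec_satRaw {n m : A → ℕ} (hn : Primrec n) (hm : Primrec m)
    (hk : Primrec k) : Primrec fun x => satRaw (n x) (m x) (k x) := by
  unfold satRaw
  fun_prop

@[fun_prop] lemma primrec_sum_elim {B C D : Type*} [Primcodable B] [Primcodable C] [Primcodable D]
    {f : A → B ⊕ C} {g : A → B → D} {h : A → C → D} (hf : Primrec f)
    (hg : Primrec fun x : A × B => g x.1 x.2) (hh : Primrec fun x : A × C => h x.1 x.2) :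
    Primrec fun x => Sum.elim (g x) (h x) (f x) :=
  (Primrec.sumCasesOn hf hg hh).of_eq fun x => by cases f x <;> rfl

@[fun_prop] lemma primrec_bound {g : A → RawGate} (hg : Primrec g) :
    Primrec fun x => (g x).bound := by
  have h : Primrec fun x => Sum.elim (fun u : ℕ × ℕ × ℕ × ℕ => u.1 + 1)
    (fun u : ℕ × ℕ => max (u.1 + 1) (u.2 + 1)) (g x) := by fun_prop
  exact h.of_eq fun x => by cases g x <;> rfl

@[fun_prop] lemma primrec_wiring {g : A → RawGate} (hg : Primrec g) :
    Primrec fun x => (g x).wiring := by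
  have h : Primrec fun x => Sum.elim (fun u : ℕ × ℕ × ℕ × ℕ => (Sum.inl u.1 : ℕ ⊕ ℕ × ℕ))
    (fun u : ℕ × ℕ => Sum.inr u) (g x) := by fun_prop
  exact h.of_eq fun x => by cases g x <;> rfl

@[fun_prop] lemma primrec_filter_proper {L : A → List RawGate} (hL : Primrec L) :
    Primrec fun x => (L x).filter RawGate.proper := by
  have h : Primrec fun x => (L x).flatMap fun g => Sum.elim (fun _ : ℕ × ℕ × ℕ × ℕ => [g])
    (fun u : ℕ × ℕ => if u.1 = u.2 then [] else [g]) g := by fun_prop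
  refine h.of_eq fun x => ?_
  induction L x with
  | nil => rfl
  | cons g L ih =>
    rw [List.flatMap_cons, ih]
    rcases g with u | ⟨u, v⟩
    · rw [List.filter_cons_of_pos rfl]; rfl
    · by_cases huv : u = v <;> simp [RawGate.proper, huv]

@[fun_prop] lemma primrec_listBound {L : A → List RawGate} (hL : Primrec L) :
    Primrec fun x => listBound (L x) := by
  unfold listBound
  fun_prop

lemma computable_layout :
    Computable fun a : ℕ × ℕ × ℕ => (satCircuit a.1 a.2.1 a.2.2).layout := by
  refine Primrec.to_comp ?_
  simp only [satCircuit, ofRaw_layout, rawWidth]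
  fun_prop

end RawGates


/-! ### Approximation of the matrix entries -/

/-- Approximation of `√(2 + √(2 + ⋯)) * 2 ^ P`, with `r` square roots. -/
def seriesApprox (P : ℕ) : ℕ → ℕ
  | 0 => 0
  | r + 1 => Nat.sqrt ((2 * 2 ^ P + seriesApprox P r) * 2 ^ P)

/-- The error does not accumulate: the radicand is at least `4 ^ P`, so an error of `2 * 2 ^ P` in
it changes the root by at most 1, and rounding down costs at most 1 more. -/
lemma seriesApprox_spec (P r : ℕ) :
    (seriesApprox P r : ℝ) ≤ Real.sqrtTwoAddSeries 0 r * 2 ^ P ∧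
      Real.sqrtTwoAddSeries 0 r * 2 ^ P ≤ seriesApprox P r + 2 := by
  induction r with
  | zero => simp [seriesApprox]
  | succ r ih =>
    obtain ⟨h1, h2⟩ := ih
    rw [seriesApprox, Real.sqrtTwoAddSeries]
    set N := (2 * 2 ^ P + seriesApprox P r) * 2 ^ P with hN
    have hP : (0 : ℝ) < 2 ^ P := by positivity
    have hNr : (N : ℝ) = (2 * 2 ^ P + seriesApprox P r) * 2 ^ P := by rw [hN]; push_cast; rfl
    have hA : (0 : ℝ) ≤ seriesApprox P r := Nat.cast_nonneg _
    have hS : √(2 + Real.sqrtTwoAddSeries 0 r) * 2 ^ P =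
        √((2 * 2 ^ P + Real.sqrtTwoAddSeries 0 r * 2 ^ P) * 2 ^ P) := by
      rw [← Real.sqrt_sq hP.le, ← Real.sqrt_mul' _ (by positivity), Real.sqrt_sq hP.le]
      congr 1; ring
    rw [hS]
    constructor
    · refine Real.nat_sqrt_le_real_sqrt.trans (Real.sqrt_le_sqrt ?_)
      rw [hNr]
      gcongr
    · have h3 : (2 : ℝ) ^ P ≤ √N := by
        apply Real.le_sqrt_of_sq_le
        rw [hNr, sq]
        gcongr
        linarith
      have h4 : √((2 * 2 ^ P + Real.sqrtTwoAddSeries 0 r * 2 ^ P) * 2 ^ P) ≤ √N + 1 := by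
        rw [Real.sqrt_le_left (by positivity), add_sq, Real.sq_sqrt (Nat.cast_nonneg N)]
        nlinarith [mul_le_mul_of_nonneg_right h2 hP.le]
      have h5 := (Real.real_sqrt_lt_nat_sqrt_succ (a := N)).le
      linarith

/-- Approximation of `rotParam r s j * 2 ^ P`. -/
def paramApprox (r s j P : ℕ) : ℕ :=
  min (2 ^ P) (2 ^ s * (2 * 2 ^ P - seriesApprox P r) / (4 * j))

lemma cast_div_le_and_le (a b : ℕ) (hb : 0 < b) :
    ((a / b : ℕ) : ℝ) ≤ a / b ∧ (a : ℝ) / b ≤ (a / b : ℕ) + 1 := by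
  refine ⟨Nat.cast_div_le, ?_⟩
  rw [div_le_iff₀ (by exact_mod_cast hb)]
  have := Nat.lt_div_mul_add (a := a) hb
  have h2 : a ≤ (a / b + 1) * b := by linarith
  exact_mod_cast h2

/-- The half-angle formula gives `sin (π / 2 ^ (r + 2)) ^ 2 = (2 - S) / 4` with the nested radical
`S`. Replacing `S` by a lower bound raises the quotient by at most `2 ^ s`, while rounding down
lowers it by at most 1. -/
lemma paramApprox_spec (r s j P : ℕ) :
    |(paramApprox r s j P : ℝ) - rotParam r s j * 2 ^ P| ≤ 2 ^ s := by
  have hP : (0 : ℝ) < 2 ^ P := by positivity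
  have hs : (1 : ℝ) ≤ 2 ^ s := one_le_pow₀ (by norm_num)
  obtain ⟨h1, h2⟩ := seriesApprox_spec P r
  have h3 := Real.sqrtTwoAddSeries_lt_two r
  set S := Real.sqrtTwoAddSeries 0 r
  set A := seriesApprox P r with hA
  have hle : A ≤ 2 * 2 ^ P := by
    have : (A : ℝ) ≤ 2 * 2 ^ P := h1.trans (by gcongr)
    exact_mod_cast this
  have e : rotParam r s j * 2 ^ P = min (2 ^ P) (2 ^ s * (2 * 2 ^ P - S * 2 ^ P) / (4 * j)) := by
    rw [rotParam, Real.sin_sq_pi_over_two_pow_succ, min_mul_of_nonneg _ _ hP.le, one_mul]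
    congr 1
    ring
  rw [e, paramApprox]
  push_cast
  refine (abs_min_sub_min_le_max _ _ _ _).trans (max_le (by simp) ?_)
  rcases Nat.eq_zero_or_pos j with rfl | hj
  · simp
  have hj1 : (1 : ℝ) ≤ j := by exact_mod_cast hj
  obtain ⟨h4, h5⟩ := cast_div_le_and_le (2 ^ s * (2 * 2 ^ P - A)) (4 * j) (by omega)
  set q := 2 ^ s * (2 * 2 ^ P - A) / (4 * j)
  push_cast [Nat.cast_sub hle] at h4 h5
  have h6 : 2 ^ s * (2 * 2 ^ P - S * 2 ^ P) / (4 * (j : ℝ)) ≤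
      2 ^ s * (2 * 2 ^ P - A) / (4 * (j : ℝ)) := by gcongr
  have h7 : 2 ^ s * (2 * 2 ^ P - (A : ℝ)) / (4 * (j : ℝ)) ≤
      2 ^ s * (2 * 2 ^ P - S * 2 ^ P) / (4 * (j : ℝ)) + 2 ^ s := by
    rw [div_add' _ _ _ (by positivity)]
    gcongr
    nlinarith
  rw [abs_le]
  constructor <;> linarith

/-- The square root of `Y`, divided by `2 ^ t` and rounded. -/
def rootApprox (Y t : ℕ) : ℕ := (2 * Nat.sqrt Y + 2 ^ t) / (2 * 2 ^ t)

/-- An error of `2 ^ s` in the radicand gives at most `2 ^ s` in the root, even near zero, and the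
integer root adds at most 1. The six guard bits turn this into `2 * 2 ^ s / 2 ^ (s + 6) = 1 / 32`,
and rounding to the nearest integer adds `1 / 2`. -/
lemma rootApprox_spec {Y s p : ℕ} {x : ℝ} (hx : 0 ≤ x)
    (h : |(Y : ℝ) - x * 2 ^ (2 * (p + s + 6))| ≤ 2 ^ s) :
    |(rootApprox Y (s + 6) : ℝ) - √x * 2 ^ p| ≤ 17 / 32 := by
  have hs : (1 : ℝ) ≤ 2 ^ s := one_le_pow₀ (by norm_num)
  have e : √(x * 2 ^ (2 * (p + s + 6))) = √x * 2 ^ p * 2 ^ (s + 6) := by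
    rw [Real.sqrt_mul hx, mul_comm 2, pow_mul, Real.sqrt_sq (by positivity)]
    ring
  have key : ∀ a b : ℝ, 0 ≤ b → a ≤ b + 2 ^ s → √a ≤ √b + 2 ^ s := by
    intro a b hb hab
    rw [Real.sqrt_le_left (by positivity)]
    nlinarith [Real.sq_sqrt hb, Real.sqrt_nonneg b]
  obtain ⟨h1, h2⟩ := abs_le.mp h
  have h3 := key Y (x * 2 ^ (2 * (p + s + 6))) (by positivity) (by linarith)
  have h4 := key (x * 2 ^ (2 * (p + s + 6))) Y (by positivity) (by linarith)
  rw [e] at h3 h4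
  have h5 := Real.nat_sqrt_le_real_sqrt (a := Y)
  have h6 := (Real.real_sqrt_lt_nat_sqrt_succ (a := Y)).le
  obtain ⟨h7, h8⟩ := cast_div_le_and_le (2 * Nat.sqrt Y + 2 ^ (s + 6)) (2 * 2 ^ (s + 6))
    (by positivity)
  rw [rootApprox]
  set q := (2 * Nat.sqrt Y + 2 ^ (s + 6)) / (2 * 2 ^ (s + 6))
  set R := Nat.sqrt Y
  set z := √x * 2 ^ p
  have hD : (2 : ℝ) ^ (s + 6) = 64 * 2 ^ s := by ring
  push_cast at h7 h8
  rw [hD] at h3 h4 h7 h8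
  rw [le_div_iff₀ (by positivity)] at h7
  rw [div_le_iff₀ (by positivity)] at h8
  rw [abs_le]
  constructor <;> nlinarith

/-- Approximation of the off-diagonal entry of a reflection gate. -/
def offApprox (r s j p : ℕ) : ℕ := rootApprox (paramApprox r s j (2 * (p + s + 6))) (s + 6)

/-- Approximation of the upper diagonal entry of a reflection gate. -/
def diagApprox (r s j p : ℕ) : ℕ :=
  rootApprox (2 ^ (2 * (p + s + 6)) - paramApprox r s j (2 * (p + s + 6))) (s + 6)

lemma offApprox_spec (r s j p : ℕ) :
    |√(rotParam r s j) * 2 ^ p - offApprox r s j p| ≤ 17 / 32 := by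
  rw [abs_sub_comm]
  exact rootApprox_spec (rotParam_nonneg r s j) (paramApprox_spec r s j _)

lemma diagApprox_spec (r s j p : ℕ) :
    |√(1 - rotParam r s j) * 2 ^ p - diagApprox r s j p| ≤ 17 / 32 := by
  rw [abs_sub_comm]
  refine rootApprox_spec (sub_nonneg.mpr (rotParam_le_one r s j)) ?_
  have h := paramApprox_spec r s j (2 * (p + s + 6))
  rw [Nat.cast_sub (show paramApprox r s j _ ≤ _ from min_le_left _ _), ← abs_neg]
  push_cast
  convert h using 2
  ring

/-- Approximation of the entries of the unitary with code `c`, scaled by `2 ^ p`. -/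
def entryApprox (c : ℕ × ℕ × ℕ) (u : Bool × Bool) (p : ℕ) : ℤ × ℤ :=
  if c.1 = 0 then
    if u.1 = u.2 then
      if u.1 = true then
        if c.2.1 = 0 then ((offApprox 0 0 1 p : ℕ), (offApprox 0 0 1 p : ℕ))
        else ((offApprox 0 0 1 p : ℕ), -(offApprox 0 0 1 p : ℕ))
      else ((2 ^ p : ℕ), 0)
    else (0, 0)
  else if u.1 = u.2 then
    if u.1 = true then (-(diagApprox (c.1 - 1) c.2.1 c.2.2 p : ℕ), 0)
    else ((diagApprox (c.1 - 1) c.2.1 c.2.2 p : ℕ), 0)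
  else ((offApprox (c.1 - 1) c.2.1 c.2.2 p : ℕ), 0)

/-- Both coordinates contribute, and `2 * (17 / 32) ^ 2 ≤ 1`. Coordinate errors of up to 1, as from
plain truncation, would be too large. -/
lemma norm_sub_div_two_pow_le {x y : ℝ} {a b : ℤ} {p : ℕ} (hx : |x * 2 ^ p - a| ≤ 17 / 32)
    (hy : |y * 2 ^ p - b| ≤ 17 / 32) :
    ‖(x + y * Complex.I : ℂ) - (a + b * Complex.I) / 2 ^ p‖ ≤ 1 / 2 ^ p := by
  have hp : (0 : ℝ) < 2 ^ p := by positivity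
  have hp' : (2 : ℂ) ^ p ≠ 0 := pow_ne_zero p two_ne_zero
  have e : (x + y * Complex.I : ℂ) - (a + b * Complex.I) / 2 ^ p =
      (((x * 2 ^ p - a : ℝ) : ℂ) + ((y * 2 ^ p - b : ℝ) : ℂ) * Complex.I) / ((2 ^ p : ℝ) : ℂ) := by
    push_cast
    field_simp
    ring
  rw [e, norm_div, Complex.norm_real, Real.norm_of_nonneg hp.le, Complex.norm_add_mul_I]
  gcongr
  rw [Real.sqrt_le_one]
  have h1 := sq_le_sq' (abs_le.mp hx).1 (abs_le.mp hx).2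
  have h2 := sq_le_sq' (abs_le.mp hy).1 (abs_le.mp hy).2
  linarith

lemma entryApprox_spec (c : ℕ × ℕ × ℕ) (r s : Bool) (p : ℕ) :
    ‖(unitaryOf c : Matrix Bool Bool ℂ) r s - (((entryApprox c (r, s) p).1 : ℂ)
      + ((entryApprox c (r, s) p).2 : ℂ) * Complex.I) / 2 ^ p‖ ≤ 1 / 2 ^ p := by
  obtain ⟨_ | t, e, j⟩ := c
  · have h := offApprox_spec 0 0 1 p
    rw [rotParam_hadamard] at h
    have h2 : ((√2 : ℝ) : ℂ)⁻¹ = ((√(1 / 2) : ℝ) : ℂ) := by simp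
    have hU : ((unitaryOf (0, e, j) : Matrix Bool Bool ℂ) true true) = phaseUnit e := by
      simp [unitaryOf, phaseMat]
    have h3 : |-√(1 / 2) * 2 ^ p - ((-(offApprox 0 0 1 p : ℕ) : ℤ) : ℝ)| ≤ 17 / 32 := by
      rw [← abs_neg]; push_cast; convert h using 2; ring
    cases r <;> cases s
    · simp [unitaryOf, phaseMat, entryApprox]
    · simp [unitaryOf, phaseMat, entryApprox]
    · simp [unitaryOf, phaseMat, entryApprox]
    · rw [hU, phaseUnit]
      split_ifs with he
      · have := norm_sub_div_two_pow_le (a := (offApprox 0 0 1 p : ℕ))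
          (b := (offApprox 0 0 1 p : ℕ)) (by exact_mod_cast h) (by exact_mod_cast h)
        convert this using 3
        · rw [div_eq_mul_inv, h2]
          ring
        · simp [entryApprox, he]
      · have := norm_sub_div_two_pow_le (a := (offApprox 0 0 1 p : ℕ)) (by exact_mod_cast h) h3
        convert this using 3
        · rw [div_eq_mul_inv, h2]
          push_cast
          ring
        · simp [entryApprox, he]
  · have h1 := offApprox_spec t e j p
    have h2 := diagApprox_spec t e j p
    have h0 : |(0 : ℝ) * 2 ^ p - (0 : ℤ)| ≤ 17 / 32 := by norm_num
    have h3 : |-√(1 - rotParam t e j) * 2 ^ p - ((-(diagApprox t e j p : ℕ) : ℤ) : ℝ)| ≤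
        17 / 32 := by
      rw [← abs_neg]; push_cast; convert h2 using 2; ring
    have g1 := norm_sub_div_two_pow_le (a := (offApprox t e j p : ℕ)) (by exact_mod_cast h1) h0
    have g2 := norm_sub_div_two_pow_le (a := (diagApprox t e j p : ℕ)) (by exact_mod_cast h2) h0
    have g3 := norm_sub_div_two_pow_le h3 h0
    cases r <;> cases s
    · convert g2 using 3 <;> simp [unitaryOf, reflMat, reflEntry, entryApprox]
    · convert g1 using 3 <;> simp [unitaryOf, reflMat, reflEntry, entryApprox]
    · convert g1 using 3 <;> simp [unitaryOf, reflMat, reflEntry, entryApprox]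
    · convert g3 using 3 <;> simp [unitaryOf, reflMat, reflEntry, entryApprox]

/-! ### Primitive recursiveness of the approximations -/

section Computability

variable {A : Type*} [Primcodable A] {r s j p : A → ℕ}

@[fun_prop] lemma primrec_intCast {f : A → ℕ} (hf : Primrec f) :
    Primrec fun x => (f x : ℤ) := by
  refine Primrec.encode_iff.mp ?_
  have h : Primrec fun x => 2 * f x := by fun_prop
  exact h.of_eq fun x => rfl

-- The integer `-k` with `k ≥ 1` has code `2 * k - 1`, and truncated subtraction gives the correct
-- code 0 for `k = 0`.
@[fun_prop] lemma primrec_neg_intCast {f : A → ℕ} (hf : Primrec f) :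
    Primrec fun x => -(f x : ℤ) := by
  refine Primrec.encode_iff.mp ?_
  have h : Primrec fun x => 2 * f x - 1 := by fun_prop
  refine h.of_eq fun x => ?_
  rcases f x with _ | n
  · rfl
  · change _ = 2 * n + 1
    omega

@[fun_prop] lemma primrec_seriesApprox (hp : Primrec p) (hr : Primrec r) :
    Primrec fun x => seriesApprox (p x) (r x) := by
  have h : Primrec fun x => (r x).rec (motive := fun _ => ℕ) 0 fun _ IH =>
      Nat.sqrt ((2 * 2 ^ p x + IH) * 2 ^ p x) := by
    refine Primrec.nat_rec' (h := fun x y => Nat.sqrt ((2 * 2 ^ p x + y.2) * 2 ^ p x))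
      hr (.const 0) ?_
    unfold Primrec₂
    fun_prop
  refine h.of_eq fun x => ?_
  induction r x with
  | zero => rfl
  | succ i ih => simp only [seriesApprox, ← ih]

@[fun_prop] lemma primrec_rootApprox (hr : Primrec r) (hs : Primrec s) :
    Primrec fun x => rootApprox (r x) (s x) := by
  unfold rootApprox
  fun_prop

@[fun_prop] lemma primrec_paramApprox (hr : Primrec r) (hs : Primrec s) (hj : Primrec j)
    (hp : Primrec p) : Primrec fun x => paramApprox (r x) (s x) (j x) (p x) := by
  unfold paramApprox
  fun_prop

@[fun_prop] lemma primrec_offApprox (hr : Primrec r) (hs : Primrec s) (hj : Primrec j)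
    (hp : Primrec p) : Primrec fun x => offApprox (r x) (s x) (j x) (p x) := by
  unfold offApprox
  fun_prop

@[fun_prop] lemma primrec_diagApprox (hr : Primrec r) (hs : Primrec s) (hj : Primrec j)
    (hp : Primrec p) : Primrec fun x => diagApprox (r x) (s x) (j x) (p x) := by
  unfold diagApprox
  fun_prop

@[fun_prop] lemma primrec_entryApprox {c : A → ℕ × ℕ × ℕ} {u : A → Bool × Bool} (hc : Primrec c)
    (hu : Primrec u) (hp : Primrec p) : Primrec fun x => entryApprox (c x) (u x) (p x) := by
  unfold entryApprox
  fun_prop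

end Computability

/-- The code of the one-qubit unitary of a raw gate. -/
def rawCode (g : RawGate) : ℕ × ℕ × ℕ := Sum.elim Prod.snd (fun _ => (0, 0, 0)) g

lemma uniformFamily_satCircuit : UniformFamily satCircuit := by
  refine ⟨computable_layout, fun x => entryApprox (rawCode
    (((satRaw x.1.1 x.1.2.1 x.1.2.2).filter RawGate.proper).getD x.2.1 (Sum.inr (0, 0))))
    x.2.2.1 x.2.2.2, Primrec.to_comp ?_, ?_⟩
  · unfold rawCode
    fun_prop
  · intro n m k i U q h r s p
    -- Position `i` of the circuit is position `i` of the filtered raw list, so for a one-qubit gate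
    -- the default entry is never used.
    obtain ⟨c, hc, rfl⟩ := ofRaw_getElem? h
    simp only [List.getD_eq_getElem?_getD, hc, Option.getD_some]
    exact entryApprox_spec c r s p

end SatSearch

theorem theorem4 :
    ∃ Q : (n m k : ℕ) → QCircuit (BCircuit.encLen n m),
      UniformFamily Q ∧
      ∃ c : ℝ, 0 < c ∧ ∃ d : ℕ,
        ∀ (n m : ℕ) (ε : ℝ), 1 ≤ m → 0 < ε → ε ≤ 1 / 2 →
          ((Q n m ⌈Real.logb 2 (1 / ε)⌉₊).size : ℝ)
              ≤ c * (Real.sqrt (2 ^ n * Real.log (1 / ε)) * (m : ℝ) ^ d) ∧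
            SolvesCircuitSat (Q n m ⌈Real.logb 2 (1 / ε)⌉₊) ε :=
  ⟨SatSearch.satCircuit, SatSearch.uniformFamily_satCircuit, 2880000, by norm_num, 2,
    fun _ _ _ hm hε hε2 => ⟨SatSearch.satCircuit_size hm hε hε2,
      SatSearch.satCircuit_solves hm hε.le (SatSearch.half_pow_ceil_le hε)⟩⟩
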